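/- **Setting.** Let $\mathcal S^n$ be the real symmetric $n\times n$ matrices ($n\ge 1$) with $\langle U,V\rangle=\mathrm{Tr}(UV)$; $\|\cdot\|_F$ is the Frobenius norm, bold letters denote vectorized matrices, $\|\cdot\|_2$ is the Euclidean norm of (stacked) vectors and the spectral norm of matrices. Given $A_1,\dots,A_m,C\in\mathcal S^n$ and $b\in\mathbb R^m$, put $\mathcal A X=(\langle A_i,X\rangle)_{i}$, $\mathcal A^*y=\sum_i y_iA_i$, let $A\in\mathbb R^{m\times n^2}$ have the rows $\bm A_i^\top$, and consider $$\min\{\langle C,X\rangle:\mathcal AX=b,\ X\succeq0\},\qquad \max\{b^\top y:\mathcal A^*y+Z=C,\ Z\succeq 0\}.$$ Let $\|(u,\bm M)\|_{\mathcal S}=\min\{\|(\bm X,\bm Z)\|_2: A\bm X=u,\ A^\top y+\bm Z=\bm M\}$ and $H_Q(B)=\tfrac12\big(QBQ^{-1}+(QBQ^{-1})^\top\big)$. **Assumption 1** (constant $K_*>0$). Both problems are strictly feasible, and some pair of optimal solutions $X^*$ and $(y^*,Z^*)$ satisfies $\|(\bm X^*,y^*,\bm Z^*)\|_2\le K_*\sqrt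 n$. **Assumption 2** (constants $K_{A,1},K_{A,2},K_{r,1},K_{r,2}>0$). $\mathrm{rank}(A)=m$, the $m$ singular values of $A$ lie in $[K_{A,1},K_{A,2}]$, $\|b\|_\infty\le K_{r,1}$, $\|C\|_2\le K_{r,2}\sqrt n$. **Method (IP-PMM).** Parameters: $0<\sigma_{\min}\le\sigma_{\max}\le\frac12$, $K_N>0$, $\gamma_{\mathcal S},\gamma_\mu\in(0,1)$, $\rho>0$. Start: $X_0=Z_0=\rho I_n$, $y_0\in\mathbb R^m$, $\Xi_0=X_0$, $\lambda_0=y_0$, $\bar b=\mathcal AX_0-b$, $\bar C=\mathcal A^*y_0+Z_0-C$. Throughout $\mu_k=\langle X_k,Z_k\rangle/n$. The neighbourhood $\mathscr N_{\mu}(\Xi,\lambda)$ consists of the $(X,y,Z)$ with $X,Z\succ0$, $\|H_{Z^{1/2}}(XZ)-\mu I_n\|_F\le\gamma_\mu\mu$, for which there are $\tilde b,\tilde C$ with $\|(\tilde b,\tilde{\bm C})\|_2\le K_N$, $\|(\tilde b,\tilde{\bm C})\|_{\mathcal S}\le\gamma_{\mathcal S}\rho$ and $$\mathcal AX+\mu(y-\lambda)=b+\tfrac{\mu}{\mu_0}(\bar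 b+\tilde b),\qquad \mathcal A^*y+Z-\mu(X-\Xi)=C+\tfrac{\mu}{\mu_0}(\bar C+\tilde C).$$ Iteration $k=0,1,2,\dots$: choose $\sigma_k\in[\sigma_{\min},\sigma_{\max}]$ and $(\Delta X_k,\Delta y_k,\Delta Z_k)\in\mathcal S^n\times\mathbb R^m\times\mathcal S^n$ with $$\begin{aligned} -\mu_k\Delta X_k+\mathcal A^*\Delta y_k+\Delta Z_k&=C+\tfrac{\sigma_k\mu_k}{\mu_0}\bar C-\mathcal A^*y_k-Z_k+\sigma_k\mu_k(X_k-\Xi_k)+\mathsf E_{d,k},\\ \mathcal A\Delta X_k+\mu_k\Delta y_k&=b+\tfrac{\sigma_k\mu_k}{\mu_0}\bar b-\mathcal AX_k-\sigma_k\mu_k(y_k-\lambda_k)+\epsilon_{p,k},\\ E_k\bm{\Delta X}_k+F_k\bm{\Delta Z}_k&=-E_k\bm X_k+\sigma_k\mu_k\bm I_n, \end{aligned}$$ where $E_k=Z_k^{1/2}\otimes Z_k^{1/2}$, $F_k=\frac12\big(Z_k^{1/2}X_k\otimes Z_k^{-1/2}+Z_k^{-1/2}\otimes Z_k^{1/2}X_k\big)$,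 and the errors satisfy $\|(\epsilon_{p,k},\bm{\mathsf E}_{d,k})\|_2\le\frac{\sigma_{\min}}{4\mu_0}K_N\mu_k$ and $\|(\epsilon_{p,k},\bm{\mathsf E}_{d,k})\|_{\mathcal S}\le\frac{\sigma_{\min}}{4\mu_0}\gamma_{\mathcal S}\rho\mu_k$. Call $\alpha\in(0,1]$ *acceptable* at iteration $k$ if, with $\mu_k(\alpha)=\langle X_k+\alpha\Delta X_k,Z_k+\alpha\Delta Z_k\rangle/n$, one has $\mu_k(\alpha)\le(1-0.01\alpha)\mu_k$ and $(X_k,y_k,Z_k)+\alpha(\Delta X_k,\Delta y_k,\Delta Z_k)\in\mathscr N_{\mu_k(\alpha)}(\Xi_k,\lambda_k)$. Let $\alpha_k$ be the largest acceptable $\alpha$ and $(X_{k+1},y_{k+1},Z_{k+1})=(X_k,y_k,Z_k)+\alpha_k(\Delta X_k,\Delta y_k,\Delta Z_k)$. With $r_p=\mathcal AX_{k+1}-b-\frac{\mu_{k+1}}{\mu_0}\bar b$ and $R_d=C+\frac{\mu_{k+1}}{\mu_0}\bar C-\mathcal A^*y_{k+1}-Z_{k+1}$, set $(\Xi_{k+1},\lambda_{k+1})=(X_{k+1},y_{k+1})$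 if $\|(r_p,\bm R_d)\|_2\le K_N\frac{\mu_{k+1}}{\mu_0}$ and $\|(r_p,\bm R_d)\|_{\mathcal S}\le\gamma_{\mathcal S}\rho\frac{\mu_{k+1}}{\mu_0}$, and $(\Xi_{k+1},\lambda_{k+1})=(\Xi_k,\lambda_k)$ otherwise. **Theorem.** Fix the parameters of the method and constants $K_*,K_{A,1},K_{A,2},K_{r,1},K_{r,2},K_y>0$. There is $\bar\kappa>0$, depending only on these (not on $n$, $m$ or $k$), such that for all $n\ge1$, $m$ and all data satisfying Assumptions 1 and 2 there is $\bar\alpha\in(0,1)$ with $\bar\alpha\ge\bar\kappa/n^4$ such that, for every infinite sequence generated by IP-PMM with $\|y_0\|_2\le K_y\sqrt n$: 1. for every $k\ge0$, every $\alpha\in(0,\bar\alpha]$ is acceptable at iteration $k$, $\alpha_k\ge\bar\alpha$, and $\mu_{k+1}\le(1-0.01\,\bar\alpha)\mu_k$; 2. $\mu_k\to0$ Q-linearly (i.e. $\mu_{k+1}\le q\mu_k$ for some $q\in(0,1)$ and all large $k$); 3. the residual norms $$\Big\|A\bm X_k+\mu_k(y_k-\lambda_k)-b-\tfrac{\mu_k}{\mu_0}\bar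 b\Big\|_2\quad\text{and}\quad\Big\|A^\top y_k+\bm Z_k-\mu_k(\bm X_k-\bm\Xi_k)-\bm C-\tfrac{\mu_k}{\mu_0}\bar{\bm C}\Big\|_2$$ converge R-linearly to zero (i.e. each is dominated by a nonnegative sequence converging Q-linearly to zero), and both are at most $K_N(1-0.01\,\bar\alpha)^k$ for every $k\ge0$. -/

import Mathlib

open Filter Topology Matrix
open scoped Kronecker

noncomputable section

namespace IPPMM

/-- Real square matrices of size `n`. -/
abbrev Mat (n : ℕ) := Matrix (Fin n) (Fin n) ℝ

/-- Data of the primal-dual pair of linear semidefinite programs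
`min ⟨C, X⟩` s.t. `⟨A i, X⟩ = b i`, `X ⪰ 0`, and `max bᵀ y` s.t. `∑ y i • A i + Z = C`, `Z ⪰ 0`. -/
structure SDP (n m : ℕ) where
  A : Fin m → Mat n
  b : Fin m → ℝ
  C : Mat n
  A_symm : ∀ i, (A i).IsSymm
  C_symm : C.IsSymm

/-- The trace inner product `⟨X, Y⟩ = Tr (X Y)`. -/
def ip {n : ℕ} (X Y : Mat n) : ℝ := (X * Y).trace

/-- Frobenius norm of a matrix, i.e. the Euclidean norm of its vectorization. -/
def normF {n : ℕ} (M : Mat n) : ℝ := √(M.vec ⬝ᵥ M.vec)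

/-- Euclidean norm of a real vector. -/
def normE {m : ℕ} (u : Fin m → ℝ) : ℝ := √(u ⬝ᵥ u)

/-- Euclidean norm of the stacked vector `(u, vec M)`. -/
def normPair {n m : ℕ} (u : Fin m → ℝ) (M : Mat n) : ℝ := √(u ⬝ᵥ u + M.vec ⬝ᵥ M.vec)

/-- Spectral norm of a matrix (operator norm for the Euclidean norm). -/
def normSpec {n : ℕ} (M : Mat n) : ℝ := ‖Matrix.toEuclideanCLM (𝕜 := ℝ) M‖

namespace SDP

variable {n m : ℕ} (P : SDP n m)

/-- The operator `𝒜 X = (⟨A i, X⟩)_i`. -/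
def op (X : Mat n) : Fin m → ℝ := fun i => ip (P.A i) X

/-- The adjoint `𝒜* y = ∑ y i • A i`. -/
def adj (y : Fin m → ℝ) : Mat n := ∑ i, y i • P.A i

/-- The `m × n²` matrix whose `i`-th row is the vectorization of `A i`. -/
def vecMat : Matrix (Fin m) (Fin n × Fin n) ℝ := Matrix.of fun i => (P.A i).vec

/-- The singular values of `vecMat` in decreasing order; only the first `m` are relevant. -/
def singVal (i : ℕ) : ℝ := (Matrix.toEuclideanLin P.vecMat).singularValues i

def PrimalFeasible (X : Mat n) : Prop := X.PosSemidef ∧ P.op X = P.b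

def DualFeasible (y : Fin m → ℝ) (Z : Mat n) : Prop := Z.PosSemidef ∧ P.adj y + Z = P.C

/-- Slater's condition for both problems. -/
def StrictlyFeasible : Prop :=
  (∃ X : Mat n, X.PosDef ∧ P.op X = P.b) ∧
    ∃ (y : Fin m → ℝ) (Z : Mat n), Z.PosDef ∧ P.adj y + Z = P.C

/-- `X` solves the primal problem and `(y, Z)` solves the dual problem. -/
def IsOptimal (X : Mat n) (y : Fin m → ℝ) (Z : Mat n) : Prop :=
  P.PrimalFeasible X ∧ (∀ X', P.PrimalFeasible X' → ip P.C X ≤ ip P.C X') ∧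
    P.DualFeasible y Z ∧ ∀ y' Z', P.DualFeasible y' Z' → P.b ⬝ᵥ y' ≤ P.b ⬝ᵥ y

/-- Both problems are strictly feasible, and some optimal solution has norm at most `Ks √n`. -/
def Assumption1 (Ks : ℝ) : Prop :=
  P.StrictlyFeasible ∧ ∃ X y Z, P.IsOptimal X y Z ∧
    √(X.vec ⬝ᵥ X.vec + y ⬝ᵥ y + Z.vec ⬝ᵥ Z.vec) ≤ Ks * √n

/-- Full row rank, singular values in `[KA1, KA2]`, and bounds on the data `b`, `C`
(the norm on `Fin m → ℝ` is the maximum norm). -/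
def Assumption2 (KA1 KA2 Kr1 Kr2 : ℝ) : Prop :=
  P.vecMat.rank = m ∧ (∀ i < m, KA1 ≤ P.singVal i ∧ P.singVal i ≤ KA2) ∧
    ‖P.b‖ ≤ Kr1 ∧ normSpec P.C ≤ Kr2 * √n

/-- The semi-norm `‖(u, M)‖_S`, the least Euclidean norm of `(X, Z)` subject to
`𝒜 X = u` and `𝒜* y + Z = M`. -/
def semiNorm (u : Fin m → ℝ) (M : Mat n) : ℝ :=
  sInf {r : ℝ | ∃ (X : Mat n) (y : Fin m → ℝ) (Z : Mat n),
    P.op X = u ∧ P.adj y + Z = M ∧ r = √(X.vec ⬝ᵥ X.vec + Z.vec ⬝ᵥ Z.vec)}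

end SDP

/-- The parameters of the method, including the scale `ρ` of the starting point. -/
structure Params where
  σmin : ℝ
  σmax : ℝ
  KN : ℝ
  γS : ℝ
  γμ : ℝ
  ρ : ℝ
  σmin_pos : 0 < σmin
  σmin_le : σmin ≤ σmax
  σmax_le : σmax ≤ 1 / 2
  KN_pos : 0 < KN
  γS_pos : 0 < γS
  γS_lt : γS < 1
  γμ_pos : 0 < γμ
  γμ_lt : γμ < 1
  ρ_pos : 0 < ρ

/-- The complementarity measure `⟨X, Z⟩ / n`. -/
def mu {n : ℕ} (X Z : Mat n) : ℝ := ip X Z / n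

open scoped MatrixOrder in
/-- The positive semidefinite square root of a positive semidefinite matrix. -/
def msqrt {n : ℕ} (Z : Mat n) : Mat n := CFC.sqrt Z

/-- The symmetrization `H_Q(B) = (Q B Q⁻¹ + (Q B Q⁻¹)ᵀ) / 2`. -/
def symmetrize {n : ℕ} (Q B : Mat n) : Mat n :=
  (1 / 2 : ℝ) • (Q * B * Q⁻¹ + (Q * B * Q⁻¹)ᵀ)

/-- The initial matrix `X₀ = Z₀ = ρ I`. -/
def init {n : ℕ} (p : Params) : Mat n := p.ρ • (1 : Mat n)

/-- The initial complementarity measure `μ₀`. -/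
def mu0 (n : ℕ) (p : Params) : ℝ := mu (init p : Mat n) (init p)

/-- The initial primal infeasibility `b̄ = 𝒜 X₀ - b`. -/
def bbar {n m : ℕ} (P : SDP n m) (p : Params) : Fin m → ℝ := P.op (init p) - P.b

/-- The initial dual infeasibility `C̄ = 𝒜* y₀ + Z₀ - C`. -/
def Cbar {n m : ℕ} (P : SDP n m) (p : Params) (y0 : Fin m → ℝ) : Mat n :=
  P.adj y0 + init p - P.C

/-- The regularized primal residual `𝒜 X + μ (y - lam) - b - (μ / μ₀) b̄`. -/
def primalRes {n m : ℕ} (P : SDP n m) (p : Params) (μ : ℝ) (lam : Fin m → ℝ)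
    (X : Mat n) (y : Fin m → ℝ) : Fin m → ℝ :=
  P.op X + μ • (y - lam) - P.b - (μ / mu0 n p) • bbar P p

/-- The regularized dual residual `𝒜* y + Z - μ (X - Ξ) - C - (μ / μ₀) C̄`. -/
def dualRes {n m : ℕ} (P : SDP n m) (p : Params) (y0 : Fin m → ℝ) (μ : ℝ) (Ξ X : Mat n)
    (y : Fin m → ℝ) (Z : Mat n) : Mat n :=
  P.adj y + Z - μ • (X - Ξ) - P.C - (μ / mu0 n p) • Cbar P p y0

/-- Membership of `(X, y, Z)` in the neighbourhood `𝒩_μ(Ξ, lam)`. -/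
def Nbhd {n m : ℕ} (P : SDP n m) (p : Params) (y0 : Fin m → ℝ) (μ : ℝ) (Ξ : Mat n)
    (lam : Fin m → ℝ) (X : Mat n) (y : Fin m → ℝ) (Z : Mat n) : Prop :=
  (∃ (bt : Fin m → ℝ) (Ct : Mat n),
    P.op X + μ • (y - lam) = P.b + (μ / mu0 n p) • (bbar P p + bt) ∧
    P.adj y + Z - μ • (X - Ξ) = P.C + (μ / mu0 n p) • (Cbar P p y0 + Ct) ∧
    normPair bt Ct ≤ p.KN ∧ P.semiNorm bt Ct ≤ p.γS * p.ρ) ∧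
  X.PosDef ∧ Z.PosDef ∧
  normF (symmetrize (msqrt Z) (X * Z) - μ • (1 : Mat n)) ≤ p.γμ * μ

/-- `(dX, dy, dZ)` solves the symmetrized Newton system at `(X, y, Z)`, `μ = mu X Z`, with proximal
estimates `(Ξ, lam)`, centering parameter `σ` and errors `(Ed, εp)` in the first two blocks (and
none in the third). -/
def NewtonSystem {n m : ℕ} (P : SDP n m) (p : Params) (y0 : Fin m → ℝ)
    (X : Mat n) (y : Fin m → ℝ) (Z : Mat n) (Ξ : Mat n) (lam : Fin m → ℝ) (σ : ℝ)
    (dX : Mat n) (dy : Fin m → ℝ) (dZ : Mat n) (Ed : Mat n) (εp : Fin m → ℝ) : Prop :=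
  dX.IsSymm ∧ dZ.IsSymm ∧
  -(mu X Z • dX) + P.adj dy + dZ =
    (P.C + (σ * mu X Z / mu0 n p) • Cbar P p y0) - P.adj y - Z + (σ * mu X Z) • (X - Ξ) + Ed ∧
  P.op dX + mu X Z • dy =
    -P.op X - (σ * mu X Z) • (y - lam) + (P.b + (σ * mu X Z / mu0 n p) • bbar P p) + εp ∧
  (msqrt Z ⊗ₖ msqrt Z) *ᵥ dX.vec +
      ((1 / 2 : ℝ) • ((msqrt Z * X) ⊗ₖ (msqrt Z)⁻¹ + (msqrt Z)⁻¹ ⊗ₖ (msqrt Z * X))) *ᵥ dZ.vec =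
    -((msqrt Z ⊗ₖ msqrt Z) *ᵥ X.vec) + (σ * mu X Z) • (1 : Mat n).vec

/-- The accuracy required of the Newton direction. -/
def Accurate {n m : ℕ} (P : SDP n m) (p : Params) (μ : ℝ) (Ed : Mat n) (εp : Fin m → ℝ) : Prop :=
  normPair εp Ed ≤ p.σmin / (4 * mu0 n p) * p.KN * μ ∧
  P.semiNorm εp Ed ≤ p.σmin / (4 * mu0 n p) * p.γS * p.ρ * μ

/-- The conditions that the line search imposes on a step-length `α`. -/
def Acceptable {n m : ℕ} (P : SDP n m) (p : Params) (y0 : Fin m → ℝ)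
    (X : Mat n) (y : Fin m → ℝ) (Z : Mat n) (Ξ : Mat n) (lam : Fin m → ℝ)
    (dX : Mat n) (dy : Fin m → ℝ) (dZ : Mat n) (α : ℝ) : Prop :=
  0 < α ∧ α ≤ 1 ∧
  mu (X + α • dX) (Z + α • dZ) ≤ (1 - 0.01 * α) * mu X Z ∧
  Nbhd P p y0 (mu (X + α • dX) (Z + α • dZ)) Ξ lam (X + α • dX) (y + α • dy) (Z + α • dZ)

/-- The test that decides whether the proximal estimates are replaced by the new iterate. -/
def UpdateTest {n m : ℕ} (P : SDP n m) (p : Params) (y0 : Fin m → ℝ)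
    (X : Mat n) (y : Fin m → ℝ) (Z : Mat n) : Prop :=
  normPair (P.op X - (P.b + (mu X Z / mu0 n p) • bbar P p))
      ((P.C + (mu X Z / mu0 n p) • Cbar P p y0) - P.adj y - Z) ≤ p.KN * (mu X Z / mu0 n p) ∧
  P.semiNorm (P.op X - (P.b + (mu X Z / mu0 n p) • bbar P p))
      ((P.C + (mu X Z / mu0 n p) • Cbar P p y0) - P.adj y - Z)
    ≤ p.γS * p.ρ * (mu X Z / mu0 n p)

/-- The sequences produced by the method (run without stopping test): iterates `(X, y, Z)`,
proximal estimates `(Ξ, lam)`, directions `(dX, dy, dZ)`, errors `(Ed, εp)`, centering parameters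
`σ` and step-lengths `α`. -/
structure Run {n m : ℕ} (P : SDP n m) (p : Params) where
  X : ℕ → Mat n
  y : ℕ → Fin m → ℝ
  Z : ℕ → Mat n
  Ξ : ℕ → Mat n
  lam : ℕ → Fin m → ℝ
  dX : ℕ → Mat n
  dy : ℕ → Fin m → ℝ
  dZ : ℕ → Mat n
  Ed : ℕ → Mat n
  εp : ℕ → Fin m → ℝ
  σ : ℕ → ℝ
  α : ℕ → ℝ
  X_zero : X 0 = init p
  Z_zero : Z 0 = init p
  Ξ_zero : Ξ 0 = X 0
  lam_zero : lam 0 = y 0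
  σ_mem : ∀ k, p.σmin ≤ σ k ∧ σ k ≤ p.σmax
  newton : ∀ k, NewtonSystem P p (y 0) (X k) (y k) (Z k) (Ξ k) (lam k) (σ k)
    (dX k) (dy k) (dZ k) (Ed k) (εp k)
  accurate : ∀ k, Accurate P p (mu (X k) (Z k)) (Ed k) (εp k)
  step : ∀ k, IsGreatest {a : ℝ | Acceptable P p (y 0) (X k) (y k) (Z k) (Ξ k) (lam k)
    (dX k) (dy k) (dZ k) a} (α k)
  X_succ : ∀ k, X (k + 1) = X k + α k • dX k
  y_succ : ∀ k, y (k + 1) = y k + α k • dy k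
  Z_succ : ∀ k, Z (k + 1) = Z k + α k • dZ k
  update : ∀ k, UpdateTest P p (y 0) (X (k + 1)) (y (k + 1)) (Z (k + 1)) →
    Ξ (k + 1) = X (k + 1) ∧ lam (k + 1) = y (k + 1)
  no_update : ∀ k, ¬ UpdateTest P p (y 0) (X (k + 1)) (y (k + 1)) (Z (k + 1)) →
    Ξ (k + 1) = Ξ k ∧ lam (k + 1) = lam k

namespace Run

variable {n m : ℕ} {P : SDP n m} {p : Params} (R : Run P p)

/-- The complementarity measure `μ_k` of the `k`-th iterate. -/
def μ (k : ℕ) : ℝ := mu (R.X k) (R.Z k)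

/-- Norm of the regularized primal residual of the `k`-th iterate. -/
def primalResNorm (k : ℕ) : ℝ := normE (primalRes P p (R.μ k) (R.lam k) (R.X k) (R.y k))

/-- Norm of the regularized dual residual of the `k`-th iterate. -/
def dualResNorm (k : ℕ) : ℝ :=
  normF (dualRes P p (R.y 0) (R.μ k) (R.Ξ k) (R.X k) (R.y k) (R.Z k))

end Run

/-- Q-linear convergence of a real sequence. -/
def QLinear (u : ℕ → ℝ) (L : ℝ) : Prop :=
  Tendsto u atTop (𝓝 L) ∧
    ∃ q : ℝ, 0 < q ∧ q < 1 ∧ ∀ᶠ k in atTop, |u (k + 1) - L| ≤ q * |u k - L|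

/-- R-linear convergence of a real sequence: the error is dominated by a nonnegative sequence that
converges Q-linearly to zero. -/
def RLinear (u : ℕ → ℝ) (L : ℝ) : Prop :=
  ∃ v : ℕ → ℝ, (∀ k, 0 ≤ v k ∧ |u k - L| ≤ v k) ∧ QLinear v 0

end IPPMM

end

open IPPMM

/-! Everything rests on bounds that are uniform in the iteration, with explicit powers of `n`. Write
`θ = μ / μ₀`, with `μ₀ = ρ²`. By `exists_target`, the perturbed equations satisfied by an iterate,
stripped of their proximal terms, have a comparison solution: the convex combination, with weights
`1 - θ` and `θ`, of a complementary optimal solution and a corrected starting point. The semi-norm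
bound `γS * ρ < ρ` keeps the corrected starting point inside the cone, so the comparison solution is
bounded below by a multiple of `θ I`, while its own inner product is `O(θ n)`.

Comparing with this solution gives two bounds of order `n`. The proximal estimates are either the
starting point or iterates that passed the update test; for the latter the proximal terms vanish and
a trace argument applies (`exists_bound_of_feasible`). The iterates are then controlled by the
coercivity of the proximal terms (`exists_bound_of_proximal`). The factors `θ` and `μ` cancel in
these arguments, so the bounds do not degenerate as `μ → 0`.

For the Newton direction, an explicit shift makes the two linear blocks homogeneous up to proximal
terms (`exists_shift`). Scaling by `Z^{1/2}` and using centrality gives an energy inequality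
(`scaled_energy`), and coercivity controls its cross term. The scaled directions are then `O(μ n²)`
and `O(n²)` (`exists_direction_bound`), so the second-order term of the complementarity product is
`O(μ n⁴)`.

Along the direction, `μ` decreases to first order at rate `1 - σ`, whereas the residuals and the
centrality defect decrease at rate at least `1 - σmin / 4`. The resulting margin, proportional to `α
σmin μ`, absorbs the second-order terms once `α n⁴ ≤ κ` (`exists_step_bound`). Short steps are
therefore always acceptable, and the convergence rates follow from the geometric decrease of `μ`. -/

noncomputable section

namespace IPPMM

/-! ### Euclidean and Frobenius norms. -/

section Norms

/-- The Euclidean norm of a real vector with an arbitrary finite index type. -/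
def l2 {ι : Type*} [Fintype ι] (v : ι → ℝ) : ℝ := √(v ⬝ᵥ v)

variable {ι : Type*} [Fintype ι]

theorem l2_eq_norm (v : ι → ℝ) : l2 v = ‖WithLp.toLp 2 v‖ := by
  simp [l2, EuclideanSpace.norm_eq, dotProduct, pow_two]

theorem l2_nonneg (v : ι → ℝ) : 0 ≤ l2 v := Real.sqrt_nonneg _

theorem dotProduct_self_nonneg' (v : ι → ℝ) : 0 ≤ v ⬝ᵥ v :=
  Finset.sum_nonneg fun i _ => mul_self_nonneg (v i)

theorem l2_sq (v : ι → ℝ) : l2 v ^ 2 = v ⬝ᵥ v := Real.sq_sqrt (dotProduct_self_nonneg' v)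

theorem l2_add_le (v w : ι → ℝ) : l2 (v + w) ≤ l2 v + l2 w := by
  simp only [l2_eq_norm, WithLp.toLp_add]
  exact norm_add_le _ _

theorem l2_smul (c : ℝ) (v : ι → ℝ) : l2 (c • v) = |c| * l2 v := by
  simp only [l2_eq_norm, WithLp.toLp_smul, norm_smul, Real.norm_eq_abs]

theorem l2_neg (v : ι → ℝ) : l2 (-v) = l2 v := by simp [l2]

theorem abs_dotProduct_le (v w : ι → ℝ) : |v ⬝ᵥ w| ≤ l2 v * l2 w := by
  have h := abs_real_inner_le_norm (WithLp.toLp 2 v) (WithLp.toLp 2 w)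
  rw [← l2_eq_norm, ← l2_eq_norm] at h
  simpa [PiLp.inner_apply, dotProduct, mul_comm] using h

variable {m n : ℕ}

theorem normE_eq_l2 (u : Fin m → ℝ) : normE u = l2 u := rfl

theorem normF_eq_l2 (M : Mat n) : normF M = l2 M.vec := rfl

theorem normPair_eq_l2 (u : Fin m → ℝ) (M : Mat n) : normPair u M = l2 (Sum.elim u M.vec) := by
  simp [normPair, l2]

theorem normE_nonneg (u : Fin m → ℝ) : 0 ≤ normE u := l2_nonneg _

theorem normF_nonneg (M : Mat n) : 0 ≤ normF M := l2_nonneg _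

theorem normPair_nonneg (u : Fin m → ℝ) (M : Mat n) : 0 ≤ normPair u M := Real.sqrt_nonneg _

theorem normE_sq (u : Fin m → ℝ) : normE u ^ 2 = u ⬝ᵥ u := l2_sq u

theorem normE_add_le (u v : Fin m → ℝ) : normE (u + v) ≤ normE u + normE v := l2_add_le u v

theorem normE_neg (u : Fin m → ℝ) : normE (-u) = normE u := l2_neg u

theorem normE_sub_le (u v : Fin m → ℝ) : normE (u - v) ≤ normE u + normE v := by
  rw [sub_eq_add_neg, ← normE_neg v]; exact normE_add_le _ _

theorem normE_smul (c : ℝ) (u : Fin m → ℝ) : normE (c • u) = |c| * normE u := l2_smul c u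

theorem normF_add_le (M N : Mat n) : normF (M + N) ≤ normF M + normF N := by
  simp only [normF_eq_l2, vec_add]; exact l2_add_le _ _

theorem normF_neg (M : Mat n) : normF (-M) = normF M := by
  simp only [normF_eq_l2, vec_neg]; exact l2_neg _

theorem normF_sub_le (M N : Mat n) : normF (M - N) ≤ normF M + normF N := by
  rw [sub_eq_add_neg, ← normF_neg N]; exact normF_add_le _ _

theorem normF_smul (c : ℝ) (M : Mat n) : normF (c • M) = |c| * normF M := by
  simp only [normF_eq_l2, vec_smul]; exact l2_smul _ _

theorem normF_transpose (M : Mat n) : normF Mᵀ = normF M := by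
  simp only [normF, vec_dotProduct_vec, transpose_transpose]
  rw [trace_mul_comm]

theorem normPair_add_le (u v : Fin m → ℝ) (M N : Mat n) :
    normPair (u + v) (M + N) ≤ normPair u M + normPair v N := by
  simp only [normPair_eq_l2]
  refine le_trans (le_of_eq ?_) (l2_add_le _ _)
  congr 1
  ext i
  cases i <;> simp

theorem normPair_smul (c : ℝ) (u : Fin m → ℝ) (M : Mat n) :
    normPair (c • u) (c • M) = |c| * normPair u M := by
  simp only [normPair_eq_l2]
  rw [← l2_smul]
  congr 1
  ext i
  cases i <;> simp

theorem normPair_sq (u : Fin m → ℝ) (M : Mat n) :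
    normPair u M ^ 2 = normE u ^ 2 + normF M ^ 2 := by
  rw [normPair_eq_l2, normE_eq_l2, normF_eq_l2]
  simp [l2_sq]

theorem normPair_le_add (u : Fin m → ℝ) (M : Mat n) : normPair u M ≤ normE u + normF M := by
  refine abs_le_of_sq_le_sq' ?_ (add_nonneg (normE_nonneg u) (normF_nonneg M)) |>.2
  rw [normPair_sq]
  nlinarith [mul_nonneg (normE_nonneg u) (normF_nonneg M)]

theorem normE_le_normPair (u : Fin m → ℝ) (M : Mat n) : normE u ≤ normPair u M := by
  refine abs_le_of_sq_le_sq' ?_ (normPair_nonneg u M) |>.2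
  rw [normPair_sq]
  nlinarith [sq_nonneg (normF M)]

theorem normF_le_normPair (u : Fin m → ℝ) (M : Mat n) : normF M ≤ normPair u M := by
  refine abs_le_of_sq_le_sq' ?_ (normPair_nonneg u M) |>.2
  rw [normPair_sq]
  nlinarith [sq_nonneg (normE u)]

theorem normPair_neg_right (u : Fin m → ℝ) (M : Mat n) : normPair u (-M) = normPair u M := by
  rw [normPair, normPair]
  simp [vec_neg]

theorem normPair_vec (X Z : Mat n) :
    √(X.vec ⬝ᵥ X.vec + Z.vec ⬝ᵥ Z.vec) = l2 (Sum.elim X.vec Z.vec) := by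
  simp [l2]

end Norms

/-! ### The trace inner product and positive semidefinite matrices. -/

section TraceInner

variable {n : ℕ}

theorem ip_comm (X Y : Mat n) : ip X Y = ip Y X := trace_mul_comm _ _

theorem ip_add_left (X Y W : Mat n) : ip (X + Y) W = ip X W + ip Y W := by
  simp [ip, add_mul]

theorem ip_add_right (X Y W : Mat n) : ip W (X + Y) = ip W X + ip W Y := by
  simp [ip, mul_add]

theorem ip_sub_left (X Y W : Mat n) : ip (X - Y) W = ip X W - ip Y W := by
  simp [ip, sub_mul]

theorem ip_sub_right (X Y W : Mat n) : ip W (X - Y) = ip W X - ip W Y := by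
  simp [ip, mul_sub]

theorem ip_smul_left (c : ℝ) (X Y : Mat n) : ip (c • X) Y = c * ip X Y := by
  simp [ip]

theorem ip_smul_right (c : ℝ) (X Y : Mat n) : ip X (c • Y) = c * ip X Y := by
  simp [ip]

theorem ip_one_right (X : Mat n) : ip X 1 = X.trace := by simp [ip]

theorem ip_one_left (X : Mat n) : ip 1 X = X.trace := by simp [ip]

theorem ip_transpose_left (X Y : Mat n) : ip Xᵀ Y = X.vec ⬝ᵥ Y.vec := by
  rw [vec_dotProduct_vec]; rfl

theorem ip_self {X : Mat n} (hX : X.IsSymm) : ip X X = normF X ^ 2 := by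
  rw [normF_eq_l2, l2_sq, ← ip_transpose_left, hX]

theorem abs_ip_le (X Y : Mat n) : |ip X Y| ≤ normF X * normF Y := by
  rw [← normF_transpose X, normF_eq_l2, normF_eq_l2]
  have h := ip_transpose_left Xᵀ Y
  rw [transpose_transpose] at h
  rw [h]
  exact abs_dotProduct_le _ _

theorem ip_le (X Y : Mat n) : ip X Y ≤ normF X * normF Y := (le_abs_self _).trans (abs_ip_le X Y)

open scoped Matrix.Norms.Frobenius in
theorem normF_eq_norm (M : Mat n) : normF M = ‖M‖ := by
  rw [normF, frobenius_norm_def, Real.sqrt_eq_rpow]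
  congr 1
  simp only [dotProduct, vec, Real.norm_eq_abs, Fintype.sum_prod_type]
  rw [Finset.sum_comm]
  refine Finset.sum_congr rfl fun i _ => Finset.sum_congr rfl fun j _ => ?_
  rw [← pow_two, ← sq_abs]
  norm_cast

open scoped Matrix.Norms.Frobenius in
theorem normF_mul_le (X Y : Mat n) : normF (X * Y) ≤ normF X * normF Y := by
  simp only [normF_eq_norm]
  exact norm_mul_le X Y

theorem normF_one : normF (1 : Mat n) = √n := by
  have h := ip_self (isSymm_one : (1 : Mat n).IsSymm)
  rw [ip_one_right, trace_one, Fintype.card_fin] at h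
  rw [h, Real.sqrt_sq (normF_nonneg _)]

theorem dotProduct_mulVec_eq_ip (S : Mat n) (x : Fin n → ℝ) :
    x ⬝ᵥ S *ᵥ x = ip S (vecMulVec x x) := by
  simp only [ip, trace, diag, mul_apply, vecMulVec_apply, dotProduct, mulVec, Finset.mul_sum]
  refine Finset.sum_congr rfl fun i _ => Finset.sum_congr rfl fun j _ => ?_
  ring

theorem normF_vecMulVec (x : Fin n → ℝ) : normF (vecMulVec x x) = x ⬝ᵥ x := by
  have hs : (vecMulVec x x).IsSymm := by
    ext i j; simp [vecMulVec_apply, mul_comm]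
  have h := ip_self hs
  rw [← dotProduct_mulVec_eq_ip, vecMulVec_mulVec] at h
  have h' : (x ⬝ᵥ x) ^ 2 = normF (vecMulVec x x) ^ 2 := by
    rw [← h]; simp [pow_two]
  exact ((sq_eq_sq₀ (dotProduct_self_nonneg' x) (normF_nonneg _)).1 h').symm

theorem abs_quadForm_le (S : Mat n) (x : Fin n → ℝ) : |x ⬝ᵥ S *ᵥ x| ≤ normF S * (x ⬝ᵥ x) := by
  rw [dotProduct_mulVec_eq_ip, ← normF_vecMulVec]
  exact abs_ip_le _ _

theorem isHermitian_iff_isSymm {S : Mat n} : S.IsHermitian ↔ S.IsSymm := by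
  rw [IsHermitian, IsSymm, conjTranspose_eq_transpose_of_trivial]

theorem _root_.Matrix.PosDef.symm' {S : Mat n} (h : S.PosDef) : S.IsSymm :=
  isHermitian_iff_isSymm.1 h.isHermitian

theorem _root_.Matrix.PosSemidef.symm' {S : Mat n} (h : S.PosSemidef) : S.IsSymm :=
  isHermitian_iff_isSymm.1 h.isHermitian

theorem isSymm_smul_one (c : ℝ) : (c • (1 : Mat n)).IsSymm := by
  rw [IsSymm, transpose_smul, transpose_one]

theorem posDef_smul_one_add {S : Mat n} (hS : S.IsSymm) {c : ℝ} (h : normF S < c) :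
    (c • (1 : Mat n) + S).PosDef := by
  refine PosDef.of_dotProduct_mulVec_pos (isHermitian_iff_isSymm.2 ((isSymm_smul_one c).add hS)) ?_
  intro x hx
  have h1 := neg_le_of_abs_le (abs_quadForm_le S x)
  have h2 : 0 < x ⬝ᵥ x := lt_of_le_of_ne (dotProduct_self_nonneg' x)
    (fun h => hx (dotProduct_self_eq_zero.1 h.symm))
  simp only [star_trivial, add_mulVec, smul_mulVec, one_mulVec, dotProduct_add, dotProduct_smul,
    smul_eq_mul]
  nlinarith

theorem posSemidef_smul_one_add {S : Mat n} (hS : S.IsSymm) {c : ℝ} (h : normF S ≤ c) :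
    (c • (1 : Mat n) + S).PosSemidef := by
  refine PosSemidef.of_dotProduct_mulVec_nonneg
    (isHermitian_iff_isSymm.2 ((isSymm_smul_one c).add hS)) ?_
  intro x
  have h1 := neg_le_of_abs_le (abs_quadForm_le S x)
  have h2 := dotProduct_self_nonneg' x
  simp only [star_trivial, add_mulVec, smul_mulVec, one_mulVec, dotProduct_add, dotProduct_smul,
    smul_eq_mul]
  nlinarith

open scoped MatrixOrder Matrix.Norms.L2Operator in
theorem _root_.Matrix.PosSemidef.exists_eq_transpose_mul {X : Mat n} (hX : X.PosSemidef) :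
    ∃ B : Mat n, X = Bᵀ * B := by
  obtain ⟨B, hB⟩ := CStarAlgebra.nonneg_iff_eq_star_mul_self.mp hX.nonneg
  exact ⟨B, by rw [hB, star_eq_conjTranspose, conjTranspose_eq_transpose_of_trivial]⟩

theorem ip_nonneg {X Y : Mat n} (hX : X.PosSemidef) (hY : Y.PosSemidef) : 0 ≤ ip X Y := by
  obtain ⟨B, rfl⟩ := hX.exists_eq_transpose_mul
  have h := (hY.mul_mul_conjTranspose_same B).trace_nonneg
  rw [conjTranspose_eq_transpose_of_trivial] at h
  rwa [ip, Matrix.mul_assoc, trace_mul_comm]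

theorem normF_le_trace {X : Mat n} (hX : X.PosSemidef) : normF X ≤ X.trace := by
  obtain ⟨B, rfl⟩ := hX.exists_eq_transpose_mul
  refine (normF_mul_le _ _).trans (le_of_eq ?_)
  rw [normF_transpose, ← pow_two, normF_eq_l2, l2_sq, ← ip_transpose_left, ip]

/-- The Frobenius norm of `S p S` is controlled by that of `S²` and `p`. -/
theorem normF_conj_le {S p : Mat n} (hS : S.IsSymm) (hp : p.IsSymm) :
    normF (S * p * S) ≤ normF (S * S) * normF p := by
  have hs : (S * p * S).IsSymm := by
    rw [IsSymm, transpose_mul, transpose_mul, hS, hp, Matrix.mul_assoc]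
  -- Cyclicity of the trace groups the two factors `S` together, so that only `S * S` enters the
  -- bound; in the application `S * S = Z`, whose norm is known.
  have h1 : normF (S * p * S) ^ 2 = ip (S * S * p) (S * S * p) := by
    rw [← ip_self hs, ip, ip]
    rw [show S * p * S * (S * p * S) = (S * p * S * S * p) * S by simp only [Matrix.mul_assoc],
      trace_mul_comm]
    simp only [Matrix.mul_assoc]
  have h2 := ip_le (S * S * p) (S * S * p)
  have h3 := normF_mul_le (S * S) p
  refine (abs_le_of_sq_le_sq' ?_ (mul_nonneg (normF_nonneg _) (normF_nonneg _))).2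
  rw [h1]
  refine h2.trans ?_
  rw [← pow_two]
  exact pow_le_pow_left₀ (normF_nonneg _) h3 2

end TraceInner

/-! ### The matrix square root. -/

section SquareRoot

variable {n : ℕ}

open scoped MatrixOrder Matrix.Norms.L2Operator in
theorem msqrt_mul_self {Z : Mat n} (hZ : Z.PosDef) : msqrt Z * msqrt Z = Z :=
  CFC.sqrt_mul_sqrt_self Z hZ.posSemidef.nonneg

open scoped MatrixOrder Matrix.Norms.L2Operator in
theorem posSemidef_msqrt (Z : Mat n) : (msqrt Z).PosSemidef :=
  nonneg_iff_posSemidef.1 (CFC.sqrt_nonneg Z)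

theorem isSymm_msqrt (Z : Mat n) : (msqrt Z).IsSymm := (posSemidef_msqrt Z).symm'

theorem isUnit_det_msqrt {Z : Mat n} (hZ : Z.PosDef) : IsUnit (msqrt Z).det := by
  have h := hZ.det_pos
  rw [← msqrt_mul_self hZ, det_mul] at h
  exact isUnit_iff_ne_zero.2 fun h0 => by simp [h0] at h

end SquareRoot

/-! ### Singular values as bounds for a linear map and for a right inverse. -/

section SingularValues

open Module

variable {E F : Type*} [NormedAddCommGroup E] [InnerProductSpace ℝ E] [FiniteDimensional ℝ E]
  [NormedAddCommGroup F] [InnerProductSpace ℝ F] [FiniteDimensional ℝ F]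

/-- Expansion in an orthonormal eigenbasis of `T* T`, whose eigenvalues are the squared singular
values. -/
theorem norm_sq_apply_eq_sum (T : E →ₗ[ℝ] F) (x : E) :
    ‖T x‖ ^ 2 = ∑ i : Fin (finrank ℝ E), T.singularValues i ^ 2 *
      inner ℝ (T.isSymmetric_adjoint_comp_self.eigenvectorBasis rfl i) x ^ 2 := by
  set e := T.isSymmetric_adjoint_comp_self.eigenvectorBasis rfl
  have h1 : ‖T x‖ ^ 2 = inner ℝ x ((LinearMap.adjoint T ∘ₗ T) x) := by
    rw [LinearMap.comp_apply, LinearMap.adjoint_inner_right, real_inner_self_eq_norm_sq]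
  rw [h1, ← e.sum_inner_mul_inner]
  refine Finset.sum_congr rfl fun i _ => ?_
  have h2 : inner ℝ (e i) ((LinearMap.adjoint T ∘ₗ T) x) =
      T.singularValues i ^ 2 * inner ℝ (e i) x := by
    rw [← T.isSymmetric_adjoint_comp_self (e i) x, T.sq_singularValues_fin rfl i,
      T.isSymmetric_adjoint_comp_self.apply_eigenvectorBasis]
    exact real_inner_smul_left _ _ _
  rw [h2, real_inner_comm]
  ring

theorem norm_apply_le_of_singularValues_le (T : E →ₗ[ℝ] F) {b : ℝ} (hb : 0 ≤ b)
    (h : ∀ i < finrank ℝ T.range, T.singularValues i ≤ b) (x : E) : ‖T x‖ ≤ b * ‖x‖ := by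
  refine (abs_le_of_sq_le_sq' ?_ (mul_nonneg hb (norm_nonneg x))).2
  set e := T.isSymmetric_adjoint_comp_self.eigenvectorBasis rfl with he
  rw [norm_sq_apply_eq_sum, mul_pow, ← real_inner_self_eq_norm_sq x, ← e.sum_inner_mul_inner,
    Finset.mul_sum]
  refine Finset.sum_le_sum fun i _ => ?_
  have hs : T.singularValues i ^ 2 ≤ b ^ 2 := by
    refine pow_le_pow_left₀ (T.singularValues_nonneg i) ?_ 2
    by_cases hi : (i : ℕ) < finrank ℝ T.range
    · exact h i hi
    · rw [T.singularValues_eq_zero_iff_le_finrank_range.2 (not_lt.1 hi)]; exact hb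
  rw [real_inner_comm (e i) x, ← pow_two]
  exact mul_le_mul_of_nonneg_right hs (sq_nonneg _)

/-- The preimage is the component of `x₀` orthogonal to the kernel. Right singular vectors with
index beyond the rank lie in the kernel, so this component does not see the vanishing singular
values. -/
theorem exists_preimage_of_le_singularValues (T : E →ₗ[ℝ] F) {a : ℝ} (ha : 0 ≤ a)
    (h : ∀ i < finrank ℝ T.range, a ≤ T.singularValues i) (x₀ : E) :
    ∃ x, T x = T x₀ ∧ a * ‖x‖ ≤ ‖T x₀‖ := by
  obtain ⟨k, hk, x, hx, hsum⟩ := (LinearMap.ker T).exists_add_mem_mem_orthogonal x₀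
  have hTx : T x = T x₀ := by rw [hsum, map_add, LinearMap.mem_ker.1 hk, zero_add]
  refine ⟨x, hTx, ?_⟩
  rw [← hTx]
  refine (abs_le_of_sq_le_sq' ?_ (norm_nonneg _)).2
  set e := T.isSymmetric_adjoint_comp_self.eigenvectorBasis rfl with he
  rw [norm_sq_apply_eq_sum, mul_pow, ← real_inner_self_eq_norm_sq x, ← e.sum_inner_mul_inner,
    Finset.mul_sum]
  refine Finset.sum_le_sum fun i _ => ?_
  rw [real_inner_comm (e i) x, ← pow_two]
  by_cases hi : (i : ℕ) < finrank ℝ T.range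
  · exact mul_le_mul_of_nonneg_right (pow_le_pow_left₀ ha (h i hi) 2) (sq_nonneg _)
  · have h0 : inner ℝ (e i) x = 0 := by
      refine (Submodule.mem_orthogonal _ _).1 hx _ ?_
      rw [LinearMap.mem_ker, ← norm_eq_zero, ← sq_eq_zero_iff, norm_sq_apply_eq_sum]
      refine Finset.sum_eq_zero fun j _ => ?_
      rw [← he]
      by_cases hij : i = j
      · rw [← hij, T.singularValues_eq_zero_iff_le_finrank_range.2 (not_lt.1 hi)]; simp
      · rw [e.orthonormal.2 (Ne.symm hij)]; simp
    rw [h0]; simp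

end SingularValues

/-! ### The operator `𝒜`, its adjoint and their conditioning. -/

namespace SDP

variable {n m : ℕ} (P : SDP n m)

theorem op_add (X Y : Mat n) : P.op (X + Y) = P.op X + P.op Y := by
  ext i; simp [op, ip_add_right]

theorem op_sub (X Y : Mat n) : P.op (X - Y) = P.op X - P.op Y := by
  ext i; simp [op, ip_sub_right]

theorem op_smul (c : ℝ) (X : Mat n) : P.op (c • X) = c • P.op X := by
  ext i; simp [op, ip_smul_right]

theorem op_transpose (X : Mat n) : P.op Xᵀ = P.op X := by
  ext i
  rw [op, op, ip, ip, ← trace_transpose, transpose_mul, transpose_transpose, P.A_symm i,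
    trace_mul_comm]

theorem adj_add (y z : Fin m → ℝ) : P.adj (y + z) = P.adj y + P.adj z := by
  simp [adj, add_smul, Finset.sum_add_distrib]

theorem adj_sub (y z : Fin m → ℝ) : P.adj (y - z) = P.adj y - P.adj z := by
  simp [adj, sub_smul, Finset.sum_sub_distrib]

theorem adj_smul (c : ℝ) (y : Fin m → ℝ) : P.adj (c • y) = c • P.adj y := by
  simp [adj, Finset.smul_sum, smul_smul]

theorem adj_isSymm (y : Fin m → ℝ) : (P.adj y).IsSymm := by
  rw [IsSymm, adj, transpose_sum]
  exact Finset.sum_congr rfl fun i _ => by rw [transpose_smul, P.A_symm i]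

theorem ip_adj (y : Fin m → ℝ) (X : Mat n) : ip (P.adj y) X = y ⬝ᵥ P.op X := by
  simp [ip, adj, op, dotProduct, Finset.sum_mul, trace_sum]

theorem op_eq_mulVec (X : Mat n) : P.op X = P.vecMat *ᵥ X.vec := by
  ext i
  simp only [op, mulVec, vecMat, of_apply]
  rw [← ip_transpose_left, P.A_symm i]

/-- The quantitative consequences of the bounds on the singular values: `𝒜` is bounded by `b`, and
has a right inverse bounded by `a⁻¹`. -/
structure WellConditioned (a b : ℝ) : Prop where
  pos : 0 < a
  normE_op_le : ∀ X, normE (P.op X) ≤ b * normF X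
  exists_lift : ∀ u, ∃ X : Mat n, X.IsSymm ∧ P.op X = u ∧ a * normF X ≤ normE u

theorem Assumption2.wellConditioned {P : SDP n m} {a b c d : ℝ} (ha : 0 < a) (hb : 0 ≤ b)
    (h : P.Assumption2 a b c d) : P.WellConditioned a b := by
  obtain ⟨hr, hs, -, -⟩ := h
  set T := toEuclideanLin P.vecMat with hT
  have hsurj : Function.Surjective P.vecMat.mulVecLin := by
    rw [← LinearMap.range_eq_top]
    refine Submodule.eq_top_of_finrank_eq ?_
    rw [← Matrix.rank, hr, Module.finrank_fin_fun]
  have hrange : LinearMap.range T = ⊤ := by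
    rw [LinearMap.range_eq_top]
    intro u
    obtain ⟨x, hx⟩ := hsurj u.ofLp
    refine ⟨WithLp.toLp 2 x, ?_⟩
    rw [hT, toLpLin_toLp]
    exact congrArg (WithLp.toLp 2) hx
  have hfin : Module.finrank ℝ (LinearMap.range T) = m := by
    rw [hrange, finrank_top, finrank_euclideanSpace_fin]
  have hTop : ∀ X : Mat n, ‖T (WithLp.toLp 2 X.vec)‖ = normE (P.op X) := by
    intro X
    rw [normE_eq_l2, l2_eq_norm, op_eq_mulVec, hT, toLpLin_toLp]
    rfl
  refine ⟨ha, fun X => ?_, fun u => ?_⟩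
  · rw [← hTop, normF_eq_l2, l2_eq_norm]
    exact norm_apply_le_of_singularValues_le T hb (fun i hi => (hs i (hfin ▸ hi)).2) _
  · obtain ⟨x₀, hx₀⟩ := LinearMap.range_eq_top.1 hrange (WithLp.toLp 2 u)
    obtain ⟨x, hx, hxn⟩ := exists_preimage_of_le_singularValues T ha.le
      (fun i hi => (hs i (hfin ▸ hi)).1) x₀
    rw [hx₀] at hx hxn
    obtain ⟨X, hX⟩ := (vec_bijective (R := ℝ) (m := Fin n) (n := Fin n)).2 x.ofLp
    have hXu : P.op X = u := by
      rw [op_eq_mulVec, hX]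
      have := congrArg WithLp.ofLp hx
      rwa [hT, ofLp_toLpLin] at this
    have hXn : a * normF X ≤ normE u := by
      rw [normF_eq_l2, normE_eq_l2, l2_eq_norm, l2_eq_norm, hX]
      exact hxn
    -- Since every `A i` is symmetric, the symmetric part has the same image, and its norm is no
    -- larger.
    refine ⟨(1 / 2 : ℝ) • (X + Xᵀ), ?_, ?_, ?_⟩
    · rw [IsSymm, transpose_smul, transpose_add, transpose_transpose, add_comm]
    · rw [op_smul, op_add, op_transpose, hXu, ← two_smul ℝ u, smul_smul]; norm_num
    · refine le_trans (mul_le_mul_of_nonneg_left ?_ ha.le) hXn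
      rw [normF_smul]
      have := normF_add_le X Xᵀ
      rw [normF_transpose] at this
      rw [abs_of_pos (by norm_num)]
      linarith

namespace WellConditioned

variable {P} {a b : ℝ} (h : P.WellConditioned a b)
include h

/-- Duality: pairing `𝒜* y` with a bounded lift of `y` recovers `‖y‖²`. -/
theorem le_normF_adj (y : Fin m → ℝ) : a * normE y ≤ normF (P.adj y) := by
  obtain ⟨X, -, hX, hn⟩ := h.exists_lift y
  have h1 : normE y ^ 2 ≤ normF (P.adj y) * normF X := by
    rw [normE_sq]
    nth_rw 2 [← hX]
    rw [← P.ip_adj]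
    exact ip_le _ _
  have h2 := normE_nonneg y
  have h3 := normF_nonneg (P.adj y)
  rcases h2.eq_or_lt with h0 | h0
  · rw [← h0]; simpa using h3
  · refine le_of_mul_le_mul_right ?_ h0
    have := h.pos
    nlinarith

theorem normE_le (y : Fin m → ℝ) : normE y ≤ a⁻¹ * normF (P.adj y) := by
  rw [← div_eq_inv_mul, le_div_iff₀ h.pos, mul_comm]
  exact h.le_normF_adj y

theorem normF_adj_le (hb : 0 ≤ b) (y : Fin m → ℝ) : normF (P.adj y) ≤ b * normE y := by
  have h1 : normF (P.adj y) ^ 2 ≤ normE y * (b * normF (P.adj y)) := by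
    rw [← ip_self (P.adj_isSymm y), ip_adj]
    exact (le_abs_self _).trans ((abs_dotProduct_le _ _).trans
      (mul_le_mul_of_nonneg_left (h.normE_op_le _) (normE_nonneg y)))
  have h3 := normF_nonneg (P.adj y)
  rcases h3.eq_or_lt with h0 | h0
  · rw [← h0]; exact mul_nonneg hb (normE_nonneg y)
  · refine le_of_mul_le_mul_right ?_ h0
    nlinarith

end WellConditioned

/-! ### The semi-norm `‖·‖_S`. -/

section SemiNorm

/-- The set whose infimum is `semiNorm u M`. -/
def decompNorms (u : Fin m → ℝ) (M : Mat n) : Set ℝ :=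
  {r : ℝ | ∃ (X : Mat n) (y : Fin m → ℝ) (Z : Mat n),
    P.op X = u ∧ P.adj y + Z = M ∧ r = √(X.vec ⬝ᵥ X.vec + Z.vec ⬝ᵥ Z.vec)}

theorem bddBelow_decompNorms (u : Fin m → ℝ) (M : Mat n) : BddBelow (P.decompNorms u M) :=
  ⟨0, by rintro _ ⟨X, y, Z, -, -, rfl⟩; exact Real.sqrt_nonneg _⟩

variable {P} {a b : ℝ}

theorem WellConditioned.nonempty_decompNorms (h : P.WellConditioned a b) (u : Fin m → ℝ)
    (M : Mat n) : (P.decompNorms u M).Nonempty := by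
  obtain ⟨X, -, hX, -⟩ := h.exists_lift u
  exact ⟨_, X, 0, M, hX, by simp [adj], rfl⟩

theorem WellConditioned.semiNorm_add_le (h : P.WellConditioned a b) (u v : Fin m → ℝ)
    (M N : Mat n) : P.semiNorm (u + v) (M + N) ≤ P.semiNorm u M + P.semiNorm v N := by
  rw [← sub_le_iff_le_add']
  refine le_csInf (h.nonempty_decompNorms v N) ?_
  rintro _ ⟨X₂, y₂, Z₂, h₂, k₂, rfl⟩
  rw [sub_le_comm]
  refine le_csInf (h.nonempty_decompNorms u M) ?_
  rintro _ ⟨X₁, y₁, Z₁, h₁, k₁, rfl⟩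
  rw [sub_le_iff_le_add]
  refine le_trans (csInf_le (P.bddBelow_decompNorms _ _)
    ⟨X₁ + X₂, y₁ + y₂, Z₁ + Z₂, ?_, ?_, rfl⟩) ?_
  · rw [op_add, h₁, h₂]
  · rw [adj_add, ← k₁, ← k₂]; abel
  · simp only [normPair_vec]
    refine le_trans (le_of_eq ?_) (l2_add_le _ _)
    congr 1
    ext i
    cases i <;> simp

theorem WellConditioned.semiNorm_smul_le (h : P.WellConditioned a b) {t : ℝ} (ht : 0 < t)
    (u : Fin m → ℝ) (M : Mat n) : P.semiNorm (t • u) (t • M) ≤ t * P.semiNorm u M := by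
  rw [← div_le_iff₀' ht]
  refine le_csInf (h.nonempty_decompNorms u M) ?_
  rintro _ ⟨X, y, Z, h₁, k₁, rfl⟩
  rw [div_le_iff₀' ht]
  refine csInf_le (P.bddBelow_decompNorms _ _) ⟨t • X, t • y, t • Z, ?_, ?_, ?_⟩
  · rw [op_smul, h₁]
  · rw [adj_smul, ← k₁, smul_add]
  · simp only [normPair_vec]
    rw [← abs_of_pos ht, ← l2_smul, abs_of_pos ht]
    congr 1
    ext i
    cases i <;> simp

/-- Needed because the update test and the neighbourhood use opposite signs for the dual residual.
-/
theorem WellConditioned.semiNorm_neg_right_le (h : P.WellConditioned a b)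
    (u : Fin m → ℝ) (M : Mat n) : P.semiNorm u (-M) ≤ P.semiNorm u M := by
  refine le_csInf (h.nonempty_decompNorms u M) ?_
  rintro _ ⟨X, y, Z, h₁, k₁, rfl⟩
  refine csInf_le (P.bddBelow_decompNorms _ _) ⟨X, (-1 : ℝ) • y, -Z, h₁, ?_, ?_⟩
  · rw [adj_smul, ← k₁]; simp [add_comm]
  · simp [vec_neg]

theorem WellConditioned.semiNorm_le (h : P.WellConditioned a b) (u : Fin m → ℝ) (M : Mat n) :
    P.semiNorm u M ≤ a⁻¹ * normE u + normF M := by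
  obtain ⟨X, -, hX, hn⟩ := h.exists_lift u
  refine (csInf_le (P.bddBelow_decompNorms _ _) ⟨X, 0, M, hX, by simp [adj], rfl⟩).trans ?_
  have h1 : normF X ≤ a⁻¹ * normE u := by
    rw [← div_eq_inv_mul, le_div_iff₀ h.pos, mul_comm]; exact hn
  refine le_trans ?_ (add_le_add_left h1 _)
  rw [Real.sqrt_le_left (add_nonneg (normF_nonneg _) (normF_nonneg _))]
  have h2 := l2_sq X.vec
  have h3 := l2_sq M.vec
  rw [← normF_eq_l2] at h2 h3
  rw [← h2, ← h3]
  nlinarith [mul_nonneg (normF_nonneg X) (normF_nonneg M)]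

/-- A nearly optimal decomposition in the definition of the semi-norm, by symmetric matrices. -/
theorem WellConditioned.exists_decomp (h : P.WellConditioned a b) {u : Fin m → ℝ} {M : Mat n}
    (hM : M.IsSymm) {r : ℝ} (hr : P.semiNorm u M < r) :
    ∃ (X : Mat n) (y : Fin m → ℝ) (Z : Mat n), X.IsSymm ∧ Z.IsSymm ∧
      P.op X = u ∧ P.adj y + Z = M ∧ normF X ≤ r ∧ normF Z ≤ r := by
  obtain ⟨_, ⟨X, y, Z, h₁, k₁, rfl⟩, hlt⟩ := exists_lt_of_csInf_lt (h.nonempty_decompNorms u M) hr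
  have hX : normF X ≤ r := (Real.sqrt_le_sqrt
    (le_add_of_nonneg_right (dotProduct_self_nonneg' _))).trans hlt.le
  have hZ : normF Z ≤ r := (Real.sqrt_le_sqrt
    (le_add_of_nonneg_left (dotProduct_self_nonneg' _))).trans hlt.le
  refine ⟨(1 / 2 : ℝ) • (X + Xᵀ), y, Z, ?_, ?_, ?_, k₁, ?_, hZ⟩
  · rw [IsSymm, transpose_smul, transpose_add, transpose_transpose, add_comm]
  · rw [← sub_eq_iff_eq_add'.2 k₁.symm]; exact hM.sub (P.adj_isSymm y)
  · rw [op_smul, op_add, op_transpose, h₁, ← two_smul ℝ u, smul_smul]; norm_num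
  · rw [normF_smul]
    have := normF_add_le X Xᵀ
    rw [normF_transpose] at this
    rw [abs_of_pos (by norm_num)]
    linarith

end SemiNorm

end SDP

/-! ### Congruence and openness of the positive definite cone. -/

section PosDef

variable {n : ℕ}

theorem posDef_conj {S M : Mat n} (hS : S.IsSymm) (hu : IsUnit S.det) (hM : M.PosDef) :
    (S * M * S).PosDef := by
  have h := (IsUnit.posDef_star_right_conjugate_iff
    ((isUnit_iff_isUnit_det S).2 hu) (x := M)).2 hM
  rwa [star_eq_conjTranspose, conjTranspose_eq_transpose_of_trivial, hS] at h

theorem isSymm_inv {S : Mat n} (hS : S.IsSymm) : (S⁻¹).IsSymm := by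
  rw [IsSymm, transpose_nonsing_inv, hS]

theorem isSymm_conj {S p : Mat n} (hS : S.IsSymm) (hp : p.IsSymm) : (S * p * S).IsSymm := by
  rw [IsSymm, transpose_mul, transpose_mul, hS, hp, Matrix.mul_assoc]

theorem conj_inv_cancel {S : Mat n} (hu : IsUnit S.det) (p : Mat n) :
    S * (S⁻¹ * p * S⁻¹) * S = p := by
  have h1 := mul_nonsing_inv S hu
  have h2 := nonsing_inv_mul S hu
  calc S * (S⁻¹ * p * S⁻¹) * S = (S * S⁻¹) * p * (S⁻¹ * S) := by simp only [Matrix.mul_assoc]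
    _ = p := by rw [h1, h2, Matrix.one_mul, Matrix.mul_one]

/-- With `S = X^{1/2}`, `X + E` is congruent to `I + S⁻¹ E S⁻¹`, whose perturbation has norm below
`1` for small `E`. -/
theorem exists_posDef_add {X : Mat n} (hX : X.PosDef) :
    ∃ δ > 0, ∀ E : Mat n, E.IsSymm → normF E < δ → (X + E).PosDef := by
  set S := msqrt X with hS
  have hu : IsUnit S.det := isUnit_det_msqrt hX
  have hs : S.IsSymm := isSymm_msqrt X
  have hc : 0 < normF S⁻¹ * normF S⁻¹ + 1 := by nlinarith [normF_nonneg S⁻¹]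
  refine ⟨(normF S⁻¹ * normF S⁻¹ + 1)⁻¹, inv_pos.2 hc, fun E hE hlt => ?_⟩
  have h1 : normF (S⁻¹ * E * S⁻¹) < 1 := by
    have h2 := normF_mul_le (S⁻¹ * E) S⁻¹
    have h3 := normF_mul_le S⁻¹ E
    have h4 := normF_nonneg S⁻¹
    have h5 := normF_nonneg E
    have h6 : (normF S⁻¹ * normF S⁻¹ + 1) * normF E < 1 := by
      rwa [← lt_inv_mul_iff₀ hc, mul_one]
    nlinarith
  have h2 := posDef_conj hs hu (posDef_smul_one_add (isSymm_conj (isSymm_inv hs) hE) h1)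
  rw [one_smul, mul_add, add_mul, Matrix.mul_one, msqrt_mul_self hX, conj_inv_cancel hu] at h2
  exact h2

end PosDef

/-! ### Strong duality and complementarity. -/

namespace SDP

variable {n m : ℕ} {P : SDP n m} {a b : ℝ}

theorem continuous_normE : Continuous (normE : (Fin m → ℝ) → ℝ) := by
  unfold normE
  exact Real.continuous_sqrt.comp (continuous_id.dotProduct continuous_id)

/-- The set separated from the origin in the proof of strong duality. -/
def valueSet (P : SDP n m) (v : ℝ) : Set ((Fin m → ℝ) × ℝ) :=
  {q | ∃ X : Mat n, X.PosDef ∧ P.op X - P.b = q.1 ∧ ip P.C X - v < q.2}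

theorem convex_valueSet (v : ℝ) : Convex ℝ (P.valueSet v) := by
  rintro ⟨u₁, t₁⟩ ⟨X₁, h₁, e₁, l₁⟩ ⟨u₂, t₂⟩ ⟨X₂, h₂, e₂, l₂⟩ α β hα hβ hαβ
  simp only at e₁ e₂ l₁ l₂
  rcases hα.eq_or_lt with rfl | hα'
  · obtain rfl : β = 1 := by linarith
    exact ⟨X₂, h₂, by simpa using e₂, by simpa using l₂⟩
  rcases hβ.eq_or_lt with rfl | hβ'
  · obtain rfl : α = 1 := by linarith
    exact ⟨X₁, h₁, by simpa using e₁, by simpa using l₁⟩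
  refine ⟨α • X₁ + β • X₂, (h₁.smul hα').add (h₂.smul hβ'), ?_, ?_⟩
  · simp only [Prod.smul_mk, Prod.mk_add_mk, ← e₁, ← e₂, op_add, op_smul]
    obtain rfl : β = 1 - α := by linarith
    module
  · simp only [Prod.smul_mk, Prod.mk_add_mk, ip_add_right, ip_smul_right, smul_eq_mul]
    have : v = α * v + β * v := by rw [← add_mul, hαβ, one_mul]
    nlinarith

/-- A small change of `u` is matched by a bounded lift added to `X`: the sum stays positive definite
and the cost changes proportionally, which the strict inequality tolerates. -/
theorem WellConditioned.isOpen_valueSet (h : P.WellConditioned a b) (v : ℝ) :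
    IsOpen (P.valueSet v) := by
  rw [isOpen_iff_mem_nhds]
  rintro ⟨u, t⟩ ⟨X, hX, hu, ht⟩
  simp only at hu ht
  obtain ⟨δ, hδ, hpd⟩ := exists_posDef_add hX
  have c1 : Continuous fun q : (Fin m → ℝ) × ℝ => normE (q.1 - u) :=
    continuous_normE.comp (continuous_fst.sub continuous_const)
  have e1 : ∀ᶠ q : (Fin m → ℝ) × ℝ in 𝓝 (u, t), normE (q.1 - u) < a * δ := by
    refine c1.continuousAt.eventually_lt continuousAt_const ?_
    simpa [normE] using mul_pos h.pos hδ
  have e2 : ∀ᶠ q : (Fin m → ℝ) × ℝ in 𝓝 (u, t),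
      normF P.C * (a⁻¹ * normE (q.1 - u)) + (ip P.C X - v) < q.2 := by
    refine ContinuousAt.eventually_lt ?_ continuousAt_snd ?_
    · exact ((continuous_const.mul (continuous_const.mul c1)).add continuous_const).continuousAt
    · simpa [normE] using ht
  filter_upwards [e1, e2] with q h1 h2
  obtain ⟨E, hE, hEu, hEn⟩ := h.exists_lift (q.1 - u)
  refine ⟨X + E, hpd E hE (lt_of_mul_lt_mul_left (hEn.trans_lt h1) h.pos.le), ?_, ?_⟩
  · rw [op_add, hEu, ← hu]; abel
  · rw [ip_add_right]
    have h3 : normF E ≤ a⁻¹ * normE (q.1 - u) := by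
      rw [← div_eq_inv_mul, le_div_iff₀ h.pos, mul_comm]; exact hEn
    have h4 := (ip_le P.C E).trans (mul_le_mul_of_nonneg_left h3 (normF_nonneg _))
    linarith

/-- Dual attainment under the primal Slater condition. A functional `(w, τ)` separating the origin
from `valueSet`, normalized by `τ`, is the multiplier. -/
theorem WellConditioned.exists_dual_certificate (h : P.WellConditioned a b)
    (hslater : ∃ X : Mat n, X.PosDef ∧ P.op X = P.b) {v : ℝ}
    (hv : ∀ X, P.PrimalFeasible X → v ≤ ip P.C X) :
    ∃ y, P.DualFeasible y (P.C - P.adj y) ∧ v ≤ P.b ⬝ᵥ y := by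
  have h0 : (0 : (Fin m → ℝ) × ℝ) ∉ P.valueSet v := by
    rintro ⟨X, hX, hu, ht⟩
    simp only [Prod.fst_zero, Prod.snd_zero] at hu ht
    have := hv X ⟨hX.posSemidef, sub_eq_zero.1 hu⟩
    linarith
  obtain ⟨f, hf⟩ := geometric_hahn_banach_point_open (convex_valueSet v) (h.isOpen_valueSet v) h0
  rw [map_zero] at hf
  set τ := f (0, 1) with hτ
  set w : Fin m → ℝ := fun i => f (Pi.single i 1, 0) with hw
  have hfe : ∀ (u : Fin m → ℝ) (t : ℝ), f (u, t) = w ⬝ᵥ u + τ * t := by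
    intro u t
    have h1 : ((u, t) : (Fin m → ℝ) × ℝ) =
        ∑ i, u i • ((Pi.single i 1, 0) : (Fin m → ℝ) × ℝ) + t • (0, 1) := by
      ext j
      · simp [Prod.fst_sum, Finset.sum_apply, Pi.single_apply]
      · simp [Prod.snd_sum]
    rw [h1, map_add, map_sum, map_smul]
    simp only [map_smul, smul_eq_mul, dotProduct]
    rw [mul_comm t]
    congr 1
    exact Finset.sum_congr rfl fun i _ => mul_comm _ _
  have hpos : ∀ X : Mat n, X.PosDef → ∀ t, ip P.C X - v < t → 0 < w ⬝ᵥ (P.op X - P.b) + τ * t := by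
    intro X hX t ht
    rw [← hfe]
    exact hf _ ⟨X, hX, rfl, ht⟩
  -- At a Slater point the constraint component vanishes, so a positive `t` fixes the sign of `τ`.
  have hτpos : 0 < τ := by
    obtain ⟨X, hX, hb⟩ := hslater
    have h1 := hpos X hX (max (ip P.C X - v + 1) 1) (lt_of_lt_of_le (by linarith) (le_max_left _ _))
    rw [hb, sub_self, dotProduct_zero, zero_add] at h1
    exact pos_of_mul_pos_left h1 (le_trans zero_le_one (le_max_right _ _))
  set y : Fin m → ℝ := -(τ⁻¹ • w) with hy
  have hc1 : ∀ X : Mat n, X.PosDef → v - P.b ⬝ᵥ y ≤ ip (P.C - P.adj y) X := by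
    intro X hX
    refine le_of_forall_pos_le_add fun ε hε => ?_
    have h1 := hpos X hX (ip P.C X - v + ε) (by linarith)
    have h2 : 0 < τ⁻¹ * (w ⬝ᵥ (P.op X - P.b) + τ * (ip P.C X - v + ε)) :=
      mul_pos (inv_pos.2 hτpos) h1
    rw [mul_add, ← mul_assoc, inv_mul_cancel₀ hτpos.ne', one_mul, dotProduct_sub] at h2
    rw [ip_sub_left, ip_adj, hy, dotProduct_comm P.b]
    simp only [neg_dotProduct, smul_dotProduct, smul_eq_mul]
    linarith
  have hc2 : ∀ X : Mat n, X.PosSemidef → v - P.b ⬝ᵥ y ≤ ip (P.C - P.adj y) X := by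
    intro X hX
    have hlim : Tendsto (fun ε : ℝ => ip (P.C - P.adj y) X + ε * ip (P.C - P.adj y) 1)
        (𝓝[>] 0) (𝓝 (ip (P.C - P.adj y) X + 0 * ip (P.C - P.adj y) 1)) := by
      refine Tendsto.mono_left (Continuous.tendsto ?_ 0) nhdsWithin_le_nhds
      fun_prop
    rw [zero_mul, add_zero] at hlim
    refine ge_of_tendsto hlim ?_
    filter_upwards [self_mem_nhdsWithin] with ε hε
    have h1 : (X + ε • (1 : Mat n)).PosDef := by
      rw [add_comm]; exact (PosDef.one.smul hε).add_posSemidef hX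
    have := hc1 _ h1
    rwa [ip_add_right, ip_smul_right] at this
  -- A functional bounded below on a cone is nonnegative there: a negative value could be scaled
  -- past the bound.
  have hc3 : ∀ X : Mat n, X.PosSemidef → 0 ≤ ip (P.C - P.adj y) X := by
    intro X hX
    by_contra! hneg
    set c : ℝ := (|v - P.b ⬝ᵥ y| + 1) / (-ip (P.C - P.adj y) X) with hc
    have h1 := hc2 (c • X) (hX.smul (div_nonneg (by positivity) (by linarith)))
    rw [ip_smul_right, hc, div_mul_eq_mul_div, div_neg, mul_div_assoc, div_self hneg.ne] at h1
    have := neg_abs_le (v - P.b ⬝ᵥ y)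
    linarith
  refine ⟨y, ⟨?_, by abel⟩, ?_⟩
  · refine PosSemidef.of_dotProduct_mulVec_nonneg
      (isHermitian_iff_isSymm.2 (P.C_symm.sub (P.adj_isSymm y))) fun x => ?_
    rw [star_trivial, dotProduct_mulVec_eq_ip]
    refine hc3 _ ?_
    have := posSemidef_vecMulVec_self_star x
    rwa [star_trivial] at this
  -- The inequality at `X = 0` is the bound on the dual value.
  · have := hc2 0 PosSemidef.zero
    simp only [ip, Matrix.mul_zero, trace_zero] at this
    linarith

/-- Complementarity of optimal solutions. -/
theorem WellConditioned.ip_eq_zero_of_isOptimal (h : P.WellConditioned a b)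
    (hslater : P.StrictlyFeasible) {X Z : Mat n} {y : Fin m → ℝ} (hopt : P.IsOptimal X y Z) :
    ip X Z = 0 := by
  obtain ⟨hX, hXmin, hyZ, hymax⟩ := hopt
  obtain ⟨y', hf, hle⟩ := h.exists_dual_certificate hslater.1 hXmin
  have h1 := hymax _ _ hf
  have h2 := ip_nonneg hX.1 hyZ.1
  have h3 : ip X Z = ip P.C X - P.b ⬝ᵥ y := by
    rw [← hyZ.2, ip_add_left, ip_adj, hX.2, dotProduct_comm y, ip_comm X Z]; ring
  linarith

end SDP

/-! ### Coercivity of the proximal terms and the standing data. -/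

theorem mu0_eq {n : ℕ} (hn : 0 < n) (p : Params) : mu0 n p = p.ρ ^ 2 := by
  have : (n : ℝ) ≠ 0 := by positivity
  simp only [mu0, mu, init, ip_smul_left, ip_smul_right, ip_one_left, trace_one, Fintype.card_fin]
  field_simp

theorem normF_init {n : ℕ} (p : Params) : normF (init p : Mat n) = p.ρ * √n := by
  rw [init, normF_smul, normF_one, abs_of_pos p.ρ_pos]

namespace SDP

variable {n m : ℕ} (P : SDP n m)

/-- Since `⟨U, 𝒜* v⟩ = v ⬝ 𝒜 U`, the first equation turns the cross term into a proximal term too;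
what remains is a positive quadratic form minus the offsets `qX`, `qy`. -/
theorem ip_eq_of_coupled {U W qX : Mat n} {v qy : Fin m → ℝ} {μ : ℝ} (hU : U.IsSymm)
    (h₁ : P.op U = -(μ • (v - qy))) (h₂ : P.adj v + W = μ • (U - qX)) :
    ip U W = μ * (normF U ^ 2 + normE v ^ 2) - μ * ip U qX - μ * (v ⬝ᵥ qy) := by
  have h3 : W = μ • (U - qX) - P.adj v := eq_sub_of_add_eq' h₂
  rw [h3, ip_sub_right, ip_smul_right, ip_sub_right, ip_self hU, ip_comm U (P.adj v), ip_adj, h₁,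
    normE_sq]
  simp only [dotProduct_neg, dotProduct_smul, dotProduct_sub, smul_eq_mul]
  ring

/-- Coercivity of the proximal regularization. -/
theorem le_ip_of_coupled {U W qX : Mat n} {v qy : Fin m → ℝ} {μ : ℝ} (hμ : 0 ≤ μ) (hU : U.IsSymm)
    (h₁ : P.op U = -(μ • (v - qy))) (h₂ : P.adj v + W = μ • (U - qX)) :
    μ * (normF U ^ 2 + normE v ^ 2) - μ * (normF qX ^ 2 + normE qy ^ 2) ≤ 2 * ip U W := by
  rw [P.ip_eq_of_coupled hU h₁ h₂]
  have h3 := ip_le U qX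
  have h4 : v ⬝ᵥ qy ≤ normE v * normE qy := (le_abs_self _).trans (abs_dotProduct_le _ _)
  have h5 : 0 ≤ μ * ((normF U ^ 2 + normF qX ^ 2 - 2 * ip U qX)) :=
    mul_nonneg hμ (by nlinarith [sq_nonneg (normF U - normF qX)])
  have h6 : 0 ≤ μ * ((normE v ^ 2 + normE qy ^ 2 - 2 * (v ⬝ᵥ qy))) :=
    mul_nonneg hμ (by nlinarith [sq_nonneg (normE v - normE qy)])
  nlinarith

end SDP

/-- The standing data: a well-conditioned problem with a complementary primal-dual solution and a
starting multiplier of size `O(√n)`. -/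
structure Setting (p : Params) (a b Ks Ky : ℝ) {n m : ℕ} (P : SDP n m) (y0 : Fin m → ℝ)
    (Xs : Mat n) (ys : Fin m → ℝ) (Zs : Mat n) : Prop where
  n_pos : 0 < n
  Ks_pos : 0 < Ks
  Ky_pos : 0 < Ky
  b_pos : 0 < b
  wc : P.WellConditioned a b
  Xs_psd : Xs.PosSemidef
  Zs_psd : Zs.PosSemidef
  compl : ip Xs Zs = 0
  op_Xs : P.op Xs = P.b
  adj_ys : P.adj ys + Zs = P.C
  Xs_le : normF Xs ≤ Ks * √n
  ys_le : normE ys ≤ Ks * √n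
  Zs_le : normF Zs ≤ Ks * √n
  y0_le : normE y0 ≤ Ky * √n

theorem exists_setting {p : Params} {Ks KA1 KA2 Kr1 Kr2 Ky : ℝ} {n m : ℕ} {P : SDP n m}
    (hKs : 0 < Ks) (hKA1 : 0 < KA1) (hKA2 : 0 < KA2) (hKy : 0 < Ky) (hn : 0 < n)
    (h1 : P.Assumption1 Ks) (h2 : P.Assumption2 KA1 KA2 Kr1 Kr2) {y0 : Fin m → ℝ}
    (hy0 : normE y0 ≤ Ky * √n) : ∃ Xs ys Zs, Setting p KA1 KA2 Ks Ky P y0 Xs ys Zs := by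
  have wc := h2.wellConditioned hKA1 hKA2.le
  obtain ⟨hs, X, y, Z, hopt, hle⟩ := h1
  have hX := dotProduct_self_nonneg' X.vec
  have hy := dotProduct_self_nonneg' y
  have hZ := dotProduct_self_nonneg' Z.vec
  refine ⟨X, y, Z, hn, hKs, hKy, hKA2, wc, hopt.1.1, hopt.2.2.1.1,
    wc.ip_eq_zero_of_isOptimal hs hopt, hopt.1.2, hopt.2.2.1.2, ?_, ?_, ?_, hy0⟩
  all_goals exact (Real.sqrt_le_sqrt (by linarith)).trans hle

section Dimension

variable {n : ℕ} (hn : 0 < n)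
include hn

theorem one_le_sqrt_natCast : 1 ≤ √(n : ℝ) := by
  rw [Real.one_le_sqrt]; exact_mod_cast hn

theorem sqrt_natCast_le : √(n : ℝ) ≤ n := by
  have h1 := one_le_sqrt_natCast hn
  have h2 := Real.mul_self_sqrt (Nat.cast_nonneg n : (0 : ℝ) ≤ n)
  nlinarith

end Dimension

/-- A constant strictly between `γS` and `1`: the slack lets decompositions that are only nearly
optimal for the semi-norm be used. -/
def Params.γ' (p : Params) : ℝ := (1 + p.γS) / 2

theorem Params.γ'_lt (p : Params) : p.γ' < 1 := by
  have := p.γS_lt; unfold Params.γ'; linarith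

theorem Params.γ'_pos (p : Params) : 0 < p.γ' := by
  have := p.γS_pos; unfold Params.γ'; linarith

theorem Params.γS_lt_γ' (p : Params) : p.γS < p.γ' := by
  have := p.γS_lt; unfold Params.γ'; linarith

/-! ### The comparison solution. -/

section Target

variable {p : Params} {a b Ks Ky : ℝ} {n m : ℕ} {P : SDP n m} {y0 : Fin m → ℝ}
  {Xs : Mat n} {ys : Fin m → ℝ} {Zs : Mat n}

theorem Setting.bbar_eq (S : Setting p a b Ks Ky P y0 Xs ys Zs) :
    bbar P p = P.op (init p - Xs) := by
  rw [bbar, SDP.op_sub, S.op_Xs]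

theorem Setting.Cbar_eq (S : Setting p a b Ks Ky P y0 Xs ys Zs) :
    Cbar P p y0 = P.adj (y0 - ys) + (init p - Zs) := by
  rw [Cbar, SDP.adj_sub, ← S.adj_ys]; abel

theorem isSymm_init (p : Params) : (init p : Mat n).IsSymm := isSymm_smul_one _

theorem isSymm_Cbar (P : SDP n m) (p : Params) (y0 : Fin m → ℝ) : (Cbar P p y0).IsSymm :=
  ((P.adj_isSymm y0).add (isSymm_init p)).sub P.C_symm

/-- The factor `t` serves two uses: `t = 1` for residuals in the neighbourhood, and `t = (σmin / 4)
θ` for the Newton errors. The bound on `y` comes from `𝒜* y = Ct - Z` and the conditioning of `𝒜*`.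
-/
theorem Setting.exists_decomp (S : Setting p a b Ks Ky P y0 Xs ys Zs) {bt : Fin m → ℝ} {Ct : Mat n}
    (hCt : Ct.IsSymm) {t : ℝ} (ht : 0 < t)
    (h1 : normPair bt Ct ≤ t * p.KN) (h2 : P.semiNorm bt Ct ≤ t * (p.γS * p.ρ)) :
    ∃ (X : Mat n) (y : Fin m → ℝ) (Z : Mat n), X.IsSymm ∧ Z.IsSymm ∧
      P.op X = bt ∧ P.adj y + Z = Ct ∧ normF X ≤ t * (p.γ' * p.ρ) ∧ normF Z ≤ t * (p.γ' * p.ρ) ∧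
      normE y ≤ t * (a⁻¹ * (p.KN + p.ρ)) := by
  have hlt : P.semiNorm bt Ct < t * (p.γ' * p.ρ) := h2.trans_lt
    (mul_lt_mul_of_pos_left (mul_lt_mul_of_pos_right p.γS_lt_γ' p.ρ_pos) ht)
  obtain ⟨X, y, Z, hX, hZ, e1, e2, n1, n2⟩ := S.wc.exists_decomp hCt hlt
  refine ⟨X, y, Z, hX, hZ, e1, e2, n1, n2, (S.wc.normE_le y).trans ?_⟩
  rw [mul_left_comm]
  refine mul_le_mul_of_nonneg_left ?_ (inv_nonneg.2 S.wc.pos.le)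
  rw [eq_sub_of_add_eq e2]
  have h3 := normF_sub_le Ct Z
  have h4 := (normF_le_normPair bt Ct).trans h1
  have h5 : p.γ' * p.ρ ≤ p.ρ := by nlinarith [p.ρ_pos, p.γ'_lt]
  nlinarith [mul_le_mul_of_nonneg_left h5 ht.le]

theorem ip_le_mul_of_le {X Z : Mat n} {r s t : ℝ} (ht : 0 ≤ t) (hr : 0 ≤ r)
    (hX : normF X ≤ r * t) (hZ : normF Z ≤ s * t) : ip X Z ≤ r * s * (t * t) := by
  calc ip X Z ≤ normF X * normF Z := ip_le _ _
    _ ≤ (r * t) * (s * t) := mul_le_mul hX hZ (normF_nonneg _) (mul_nonneg hr ht)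
    _ = _ := by ring

/-- A point that satisfies the same perturbed equations as an iterate, without proximal terms, and
is bounded away from the boundary of the cone by a multiple of `θ`. -/
structure Target (P : SDP n m) (p : Params) (y0 : Fin m → ℝ) (θ K c : ℝ) (bt : Fin m → ℝ)
    (Ct : Mat n) (X : Mat n) (y : Fin m → ℝ) (Z : Mat n) : Prop where
  X_symm : X.IsSymm
  op_X : P.op X = P.b + θ • (bbar P p + bt)
  adj_y : P.adj y + Z = P.C + θ • (Cbar P p y0 + Ct)
  X_le : normF X ≤ K * √n
  y_le : normE y ≤ K * √n
  Z_le : normF Z ≤ K * √n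
  ip_le : ip X Z ≤ θ * (K * n)
  le_ip_X : ∀ V : Mat n, V.PosSemidef → θ * (c * V.trace) ≤ ip X V
  le_ip_Z : ∀ V : Mat n, V.PosSemidef → θ * (c * V.trace) ≤ ip V Z

/-- The perturbation `E` removes at most `g * ρ` from the eigenvalues of `ρ I`, and the semidefinite
part `Y` can only help. -/
theorem le_ip_convexComb {Y E V : Mat n} (hY : Y.PosSemidef) (hE : E.IsSymm) {θ g : ℝ}
    (h0 : 0 ≤ θ) (h1 : θ ≤ 1) (hg : normF E ≤ g * p.ρ) (hV : V.PosSemidef) :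
    θ * ((1 - g) * p.ρ * V.trace) ≤ ip ((1 - θ) • Y + θ • (init p + E)) V := by
  have h2 := ip_nonneg hY hV
  have h3 := ip_nonneg (posSemidef_smul_one_add hE hg) hV
  rw [ip_add_left, ip_smul_left, ip_one_left] at h3
  rw [ip_add_left, ip_smul_left, ip_smul_left, ip_add_left, init, ip_smul_left, ip_one_left]
  have h4 := mul_nonneg (sub_nonneg.2 h1) h2
  have h5 := mul_nonneg h0 h3
  nlinarith

/-- The literal `0` stands for `⟨X*, Z*⟩`. Complementarity removes the only term of the bilinear
expansion that carries no factor `θ`. -/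
theorem combination_le {θ A B C r t : ℝ} (h0 : 0 ≤ θ) (h1 : θ ≤ 1) (hr : 0 ≤ r) (ht : 0 ≤ t)
    (hA : A ≤ r) (hB : B ≤ r) (hC : C ≤ t) :
    (1 - θ) * ((1 - θ) * 0) + θ * ((1 - θ) * A) + ((1 - θ) * (θ * B) + θ * (θ * C)) ≤
      θ * (2 * r + t) := by
  have h2 : 0 ≤ 1 - θ := sub_nonneg.2 h1
  have l1 : (1 - θ) * A ≤ r := by nlinarith
  have l2 : (1 - θ) * B ≤ r := by nlinarith
  have l3 : θ * C ≤ t := by nlinarith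
  calc _ = θ * ((1 - θ) * A + (1 - θ) * B + θ * C) := by ring
    _ ≤ _ := mul_le_mul_of_nonneg_left (by linarith) h0

/-- The witness is `(1 - θ)(X*, y*, Z*) + θ (X₀ + X, y₀ + y, Z₀ + Z)`, where `(X, y, Z)` decomposes
`(bt, Ct)`. The optimal solution produces `b` and `C`, the differences to the starting point produce
`θ b̄` and `θ C̄`, and `‖X‖, ‖Z‖ ≤ γ' ρ < ρ` keeps the second point well inside the cone. -/
theorem exists_target (p : Params) {a Ks Ky : ℝ} (ha : 0 < a) (hKs : 0 < Ks) (hKy : 0 < Ky) :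
    ∃ K > 0, ∃ c > 0, ∀ {b : ℝ} {n m : ℕ} {P : SDP n m} {y0 : Fin m → ℝ} {Xs : Mat n}
      {ys : Fin m → ℝ} {Zs : Mat n}, Setting p a b Ks Ky P y0 Xs ys Zs →
      ∀ {θ : ℝ} {bt : Fin m → ℝ} {Ct : Mat n}, 0 ≤ θ → θ ≤ 1 → Ct.IsSymm →
        normPair bt Ct ≤ p.KN → P.semiNorm bt Ct ≤ p.γS * p.ρ →
        ∃ X y Z, Target P p y0 θ K c bt Ct X y Z := by
  have hρ := p.ρ_pos
  have hKN := p.KN_pos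
  have hγ := p.γ'_lt
  -- The first summands dominate the norm bounds of the two combined points. The last bracket bounds
  -- the inner products: `2 (Ks * 2ρ) + (2ρ)²`.
  refine ⟨Ks + 2 * p.ρ + Ky + a⁻¹ * (p.KN + p.ρ) + (4 * Ks * p.ρ + 4 * p.ρ ^ 2), by positivity,
    (1 - p.γ') * p.ρ, mul_pos (by linarith) hρ, ?_⟩
  intro b n m P y0 Xs ys Zs S θ bt Ct h0 h1 hCt hn1 hn2
  obtain ⟨X, y, Z, hX, hZ, e1, e2, nX, nZ, ny⟩ := S.exists_decomp hCt one_pos (t := 1)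
    (by simpa using hn1) (by simpa using hn2)
  rw [one_mul] at nX nZ ny
  set s := √(n : ℝ) with hs
  have hs1 : 1 ≤ s := one_le_sqrt_natCast S.n_pos
  have hss : s * s = n := Real.mul_self_sqrt (Nat.cast_nonneg n)
  have hap : 0 < a⁻¹ * (p.KN + p.ρ) := by positivity
  have hX0 : normF (init p + X) ≤ (2 * p.ρ) * s := by
    have := normF_add_le (init p) X
    rw [normF_init] at this
    nlinarith [mul_le_mul_of_nonneg_left hs1 hρ.le]
  have hZ0 : normF (init p + Z) ≤ (2 * p.ρ) * s := by
    have := normF_add_le (init p) Z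
    rw [normF_init] at this
    nlinarith [mul_le_mul_of_nonneg_left hs1 hρ.le]
  have hy0' : normE (y0 + y) ≤ (Ky + a⁻¹ * (p.KN + p.ρ)) * s := by
    have := normE_add_le y0 y
    have := S.y0_le
    nlinarith [mul_le_mul_of_nonneg_left hs1 hap.le]
  have comb : ∀ {r₁ r₂ A B : ℝ}, A ≤ r₁ * s → B ≤ r₂ * s → 0 ≤ r₁ → 0 ≤ r₂ →
      |1 - θ| * A + |θ| * B ≤ (r₁ + r₂) * s := by
    intro r₁ r₂ A B hA hB hr₁ hr₂
    rw [abs_of_nonneg h0, abs_of_nonneg (sub_nonneg.2 h1)]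
    have k1 := mul_le_mul_of_nonneg_left hA (sub_nonneg.2 h1)
    have k2 := mul_le_mul_of_nonneg_left hB h0
    have k3 : 0 ≤ θ * (r₁ * s) := by positivity
    have k4 : 0 ≤ (1 - θ) * (r₂ * s) := mul_nonneg (sub_nonneg.2 h1) (by positivity)
    nlinarith
  have big : ∀ {r : ℝ}, r ≤ Ks + 2 * p.ρ + Ky + a⁻¹ * (p.KN + p.ρ) + (4 * Ks * p.ρ + 4 * p.ρ ^ 2) →
      r * s ≤ (Ks + 2 * p.ρ + Ky + a⁻¹ * (p.KN + p.ρ) + (4 * Ks * p.ρ + 4 * p.ρ ^ 2)) * s :=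
    fun h => mul_le_mul_of_nonneg_right h (by linarith)
  have hq : 0 < 4 * Ks * p.ρ + 4 * p.ρ ^ 2 := by positivity
  refine ⟨(1 - θ) • Xs + θ • (init p + X), (1 - θ) • ys + θ • (y0 + y),
    (1 - θ) • Zs + θ • (init p + Z), ?_, ?_, ?_, ?_, ?_, ?_, ?_, ?_, ?_⟩
  · exact (S.Xs_psd.symm'.smul _).add (((isSymm_init p).add hX).smul _)
  · rw [bbar, SDP.op_add, SDP.op_smul, SDP.op_smul, SDP.op_add, S.op_Xs, e1]; module
  · rw [Cbar, SDP.adj_add, SDP.adj_smul, SDP.adj_smul, SDP.adj_add, ← S.adj_ys, ← e2]; module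
  · refine (normF_add_le _ _).trans ?_
    rw [normF_smul, normF_smul]
    exact (comb S.Xs_le hX0 hKs.le (by positivity)).trans (big (by linarith))
  · refine (normE_add_le _ _).trans ?_
    rw [normE_smul, normE_smul]
    exact (comb S.ys_le hy0' hKs.le (by positivity)).trans (big (by linarith))
  · refine (normF_add_le _ _).trans ?_
    rw [normF_smul, normF_smul]
    exact (comb S.Zs_le hZ0 hKs.le (by positivity)).trans (big (by linarith))
  · have k1 := ip_le_mul_of_le (by linarith) hKs.le S.Xs_le hZ0
    have k2 := ip_le_mul_of_le (by linarith) (by positivity) hX0 S.Zs_le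
    rw [mul_comm (2 * p.ρ) Ks] at k2
    have k3 := ip_le_mul_of_le (by linarith) (by positivity) hX0 hZ0
    rw [hss] at k1 k2 k3
    rw [ip_add_left, ip_add_right, ip_add_right]
    simp only [ip_smul_left, ip_smul_right]
    rw [S.compl]
    refine le_trans (combination_le h0 h1 (by positivity) (by positivity) k1 k2 k3) ?_
    refine mul_le_mul_of_nonneg_left ?_ h0
    have l6 : 0 ≤ (Ks + 2 * p.ρ + Ky + a⁻¹ * (p.KN + p.ρ)) * n := by positivity
    linarith
  · exact fun V hV => le_ip_convexComb S.Xs_psd hX h0 h1 nX hV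
  · intro V hV
    rw [ip_comm]
    exact le_ip_convexComb S.Zs_psd hZ h0 h1 nZ hV

end Target

/-! ### Bounds of order `n` for proximal estimates and iterates. -/

section Bounds

/-- A perturbed feasible pair (without proximal terms) is bounded by a multiple of `n`. -/
theorem exists_bound_of_feasible (p : Params) {a Ks Ky : ℝ} (ha : 0 < a) (hKs : 0 < Ks)
    (hKy : 0 < Ky) :
    ∃ L > 0, ∀ {b : ℝ} {n m : ℕ} {P : SDP n m} {y0 : Fin m → ℝ} {Xs : Mat n}
      {ys : Fin m → ℝ} {Zs : Mat n}, Setting p a b Ks Ky P y0 Xs ys Zs →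
      ∀ {θ : ℝ} {bt : Fin m → ℝ} {Ct X Z : Mat n} {y : Fin m → ℝ}, 0 < θ → θ ≤ 1 →
        normPair bt Ct ≤ p.KN → P.semiNorm bt Ct ≤ p.γS * p.ρ →
        X.PosSemidef → Z.PosSemidef → Ct.IsSymm → ip X Z = n * (θ * p.ρ ^ 2) →
        P.op X = P.b + θ • (bbar P p + bt) → P.adj y + Z = P.C + θ • (Cbar P p y0 + Ct) →
        normF X ≤ L * n ∧ normE y ≤ L * n := by
  obtain ⟨K, hK, c, hc, hT⟩ := exists_target p ha hKs hKy
  have hρ := p.ρ_pos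
  set t := (p.ρ ^ 2 + K) / c with ht
  have htp : 0 < t := by positivity
  refine ⟨t + (K + a⁻¹ * (t + K)), by positivity, ?_⟩
  intro b n m P y0 Xs ys Zs S θ bt Ct X Z y h0 h1 hn1 hn2 hX hZ hCt hip e1 e2
  obtain ⟨X', y', Z', T⟩ := hT S h0.le h1 hCt hn1 hn2
  have hsn := sqrt_natCast_le S.n_pos
  have hN : (0 : ℝ) ≤ n := Nat.cast_nonneg n
  have hv : P.adj (y - y') = -(Z - Z') := by
    rw [SDP.adj_sub, eq_sub_of_add_eq e2, eq_sub_of_add_eq T.adj_y]; abel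
  -- Both points have the same residuals, so `X - X'` lies in the kernel of `𝒜` and `Z - Z'` in the
  -- range of `𝒜*`.
  have hz : ip (X - X') (Z - Z') = 0 := by
    rw [← neg_neg (Z - Z'), ← hv, ip_comm, ip, Matrix.neg_mul, trace_neg, ← ip, SDP.ip_adj,
      SDP.op_sub, e1, T.op_X, sub_self, dotProduct_zero, neg_zero]
  rw [ip_sub_left, ip_sub_right, ip_sub_right, hip] at hz
  have k1 := T.le_ip_X Z hZ
  have k2 := T.le_ip_Z X hX
  have k3 := T.ip_le
  -- Orthogonality reads `⟨X, Z'⟩ + ⟨X', Z⟩ = ⟨X, Z⟩ + ⟨X', Z'⟩`. The left side bounds the traces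
  -- from above and the right side is `O(θ n)`, so `θ` cancels.
  have k4 : θ * (c * (X.trace + Z.trace)) ≤ θ * ((p.ρ ^ 2 + K) * n) := by nlinarith
  have k5 : X.trace + Z.trace ≤ t * n := by
    rw [ht, div_mul_eq_mul_div, le_div_iff₀ hc, mul_comm]
    exact le_of_mul_le_mul_left k4 h0
  have k6 := normF_le_trace hX
  have k7 := normF_le_trace hZ
  have k8 := hX.trace_nonneg
  have k9 := hZ.trace_nonneg
  have hKn : K * √n ≤ K * n := mul_le_mul_of_nonneg_left hsn hK.le
  have hai : 0 < a⁻¹ := inv_pos.2 ha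
  constructor
  · have : 0 ≤ (K + a⁻¹ * (t + K)) * n := by positivity
    nlinarith
  · have m1 := S.wc.normE_le (y - y')
    rw [hv, normF_neg] at m1
    have m2 := normF_sub_le Z Z'
    have m3 := T.Z_le
    have m4 : normF (Z - Z') ≤ (t + K) * n := by linarith
    have m5 := mul_le_mul_of_nonneg_left m4 hai.le
    have m6 := normE_add_le (y - y') y'
    rw [sub_add_cancel] at m6
    have m7 := T.y_le
    have : 0 ≤ t * n := by positivity
    linarith

theorem sum_sq_bound {x w N : ℝ} (hx : 1 ≤ x) (hw : 0 ≤ w) (hN : 1 ≤ N) :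
    2 * (x * N) + 2 * (w * N) ^ 2 ≤ ((2 * x + 2 * w) * N) ^ 2 := by
  have h1 : 1 ≤ x * N := one_le_mul_of_one_le_of_one_le hx hN
  have h2 : 0 ≤ w * N := by positivity
  rw [show (2 * x + 2 * w) * N = 2 * (x * N) + 2 * (w * N) by ring]
  nlinarith [mul_nonneg (zero_le_one.trans h1) h2]

set_option maxHeartbeats 400000 in
/-- The iterates are bounded by a multiple of `n` if the proximal estimates are. -/
theorem exists_bound_of_proximal (p : Params) {a b Ks Ky L : ℝ} (ha : 0 < a) (hb : 0 < b)
    (hKs : 0 < Ks) (hKy : 0 < Ky) (hL : 0 < L) :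
    ∃ B > 0, ∀ {n m : ℕ} {P : SDP n m} {y0 : Fin m → ℝ} {Xs : Mat n}
      {ys : Fin m → ℝ} {Zs : Mat n}, Setting p a b Ks Ky P y0 Xs ys Zs →
      ∀ {θ : ℝ} {bt : Fin m → ℝ} {Ct X Z Ξ : Mat n} {y lam : Fin m → ℝ}, 0 < θ → θ ≤ 1 →
        normPair bt Ct ≤ p.KN → P.semiNorm bt Ct ≤ p.γS * p.ρ →
        X.PosSemidef → Z.PosSemidef → Ct.IsSymm → ip X Z = n * (θ * p.ρ ^ 2) →
        P.op X + (θ * p.ρ ^ 2) • (y - lam) = P.b + θ • (bbar P p + bt) →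
        P.adj y + Z - (θ * p.ρ ^ 2) • (X - Ξ) = P.C + θ • (Cbar P p y0 + Ct) →
        normF Ξ ≤ L * n → normE lam ≤ L * n →
        normF X ≤ B * n ∧ normE y ≤ B * n ∧ normF Z ≤ B * n := by
  obtain ⟨K, hK, c, hc, hT⟩ := exists_target p ha hKs hKy
  have hρ := p.ρ_pos
  set x := 1 + K / p.ρ ^ 2 with hx
  have hx1 : 1 ≤ x := by rw [hx]; have : 0 < K / p.ρ ^ 2 := by positivity
                         linarith
  set M := 2 * x + 2 * (L + K) with hM
  have hMp : 0 < M := by positivity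
  refine ⟨M + K + (p.ρ ^ 2 * (M + K + L) + b * M), by positivity, ?_⟩
  intro n m P y0 Xs ys Zs S θ bt Ct X Z Ξ y lam h0 h1 hn1 hn2 hX hZ hCt hip e1 e2 hΞ hlam
  obtain ⟨X', y', Z', T⟩ := hT S h0.le h1 hCt hn1 hn2
  have hsn := sqrt_natCast_le S.n_pos
  have hN1 : (1 : ℝ) ≤ n := by exact_mod_cast S.n_pos
  have hKn : K * √n ≤ K * n := mul_le_mul_of_nonneg_left hsn hK.le
  set μ := θ * p.ρ ^ 2 with hμ
  have hμp : 0 < μ := by positivity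
  have hμ1 : μ ≤ p.ρ ^ 2 := by rw [hμ]; nlinarith [sq_nonneg p.ρ]
  have f1 : P.op (X - X') = -(μ • ((y - y') - (lam - y'))) := by
    rw [SDP.op_sub, T.op_X, ← e1]; module
  have f2 : P.adj (y - y') + (Z - Z') = μ • ((X - X') - (Ξ - X')) := by
    have : P.adj (y - y') + (Z - Z') = (P.adj y + Z) - (P.adj y' + Z') := by
      rw [SDP.adj_sub]; abel
    rw [this, T.adj_y, ← e2]; module
  -- Coercivity bounds the differences by twice `⟨X - X', Z - Z'⟩` plus the proximal offsets. That
  -- inner product is at most `⟨X, Z⟩ + ⟨X', Z'⟩ = O(μ n)`, so `μ` cancels.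
  have f3 := P.le_ip_of_coupled hμp.le (hX.symm'.sub T.X_symm) f1 f2
  have f4 : ip (X - X') (Z - Z') ≤ μ * (x * n) := by
    rw [ip_sub_left, ip_sub_right, ip_sub_right, hip]
    have k1 := T.le_ip_X Z hZ
    have k2 := T.le_ip_Z X hX
    have k3 := T.ip_le
    have k8 : 0 ≤ θ * (c * X.trace) := mul_nonneg h0.le (mul_nonneg hc.le hX.trace_nonneg)
    have k9 : 0 ≤ θ * (c * Z.trace) := mul_nonneg h0.le (mul_nonneg hc.le hZ.trace_nonneg)
    have k10 : μ * (x * n) = n * μ + θ * (K * n) := by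
      rw [hμ, hx]; field_simp
    linarith
  have g1 : normF (Ξ - X') ≤ (L + K) * n := by
    have := normF_sub_le Ξ X'; have := T.X_le; linarith
  have g2 : normE (lam - y') ≤ (L + K) * n := by
    have := normE_sub_le lam y'; have := T.y_le; linarith
  have g1' := pow_le_pow_left₀ (normF_nonneg _) g1 2
  have g2' := pow_le_pow_left₀ (normE_nonneg _) g2 2
  have f5 : normF (X - X') ^ 2 + normE (y - y') ^ 2 ≤ (M * n) ^ 2 := by
    have q1 : μ * (normF (X - X') ^ 2 + normE (y - y') ^ 2) ≤
        μ * (2 * (x * n) + 2 * ((L + K) * n) ^ 2) := by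
      have := mul_le_mul_of_nonneg_left (add_le_add g1' g2') hμp.le
      linarith
    have q2 := le_of_mul_le_mul_left q1 hμp
    refine q2.trans ?_
    exact sum_sq_bound hx1 (by positivity) hN1
  have hMn : 0 ≤ M * n := by positivity
  have u1 : normF (X - X') ≤ M * n :=
    (abs_le_of_sq_le_sq' ((le_add_of_nonneg_right (sq_nonneg _)).trans f5) hMn).2
  have u2 : normE (y - y') ≤ M * n :=
    (abs_le_of_sq_le_sq' ((le_add_of_nonneg_left (sq_nonneg _)).trans f5) hMn).2
  have w1 : normF X ≤ (M + K) * n := by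
    have := normF_add_le (X - X') X'
    rw [sub_add_cancel] at this
    have := T.X_le
    linarith
  have w2 : normE y ≤ (M + K) * n := by
    have := normE_add_le (y - y') y'
    rw [sub_add_cancel] at this
    have := T.y_le
    linarith
  have pos1 : 0 ≤ (p.ρ ^ 2 * (M + K + L) + b * M) * n := by positivity
  refine ⟨by linarith, by linarith, ?_⟩
  -- Coercivity says nothing about `Z`; its bound is read off from the dual equation.
  have z1 : Z = Z' + (μ • (X - Ξ) - P.adj (y - y')) := by
    have : μ • (X - Ξ) = P.adj (y - y') + (Z - Z') := by rw [f2]; congr 1; abel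
    rw [this]; abel
  have z2 : normF (μ • (X - Ξ)) ≤ p.ρ ^ 2 * ((M + K + L) * n) := by
    rw [normF_smul, abs_of_pos hμp]
    refine mul_le_mul hμ1 ?_ (normF_nonneg _) (by positivity)
    have := normF_sub_le X Ξ
    linarith
  have z3 : normF (P.adj (y - y')) ≤ b * (M * n) :=
    (S.wc.normF_adj_le hb.le _).trans (mul_le_mul_of_nonneg_left u2 hb.le)
  rw [z1]
  have z4 := normF_add_le Z' (μ • (X - Ξ) - P.adj (y - y'))
  have z5 := normF_sub_le (μ • (X - Ξ)) (P.adj (y - y'))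
  have z6 := T.Z_le
  linarith

end Bounds

/-! ### Estimates in the scaled space. -/

section Scaling

variable {n : ℕ}

theorem normF_half_anticomm_le (W D : Mat n) :
    normF ((1 / 2 : ℝ) • (W * D + D * W)) ≤ normF D * normF W := by
  rw [normF_smul, abs_of_pos (by norm_num)]
  have h1 := normF_add_le (W * D) (D * W)
  have h2 := normF_mul_le W D
  have h3 := normF_mul_le D W
  linarith

theorem anticomm_eq (W X : Mat n) (μ : ℝ) :
    (1 / 2 : ℝ) • (W * X + X * W) = μ • W +
      (1 / 2 : ℝ) • (W * (X - μ • (1 : Mat n)) + (X - μ • (1 : Mat n)) * W) := by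
  simp only [mul_sub, sub_mul, Matrix.mul_smul, Matrix.smul_mul, Matrix.mul_one, Matrix.one_mul]
  module

/-- The last hypothesis says `X ⪰ Y = c S⁻²`. The squared left side is `⟨pYp, Y⟩`, and replacing `Y`
by `X` in one factor at a time only increases it. In this way `‖X‖` replaces a bound on the inverse
of `Z`. -/
theorem normF_inv_conj_le {X S p : Mat n} {c : ℝ} (hc : 0 < c) (hX : X.PosSemidef) (hS : S.IsSymm)
    (hu : IsUnit S.det) (hp : p.IsSymm) (h : (S * X * S - c • (1 : Mat n)).PosSemidef) :
    c * normF (S⁻¹ * p * S⁻¹) ≤ normF X * normF p := by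
  have hSi := isSymm_inv hS
  set Y : Mat n := c • (S⁻¹ * S⁻¹) with hY
  have hYp : Y.PosSemidef := by
    have := (posSemidef_self_mul_conjTranspose S⁻¹).smul hc.le
    rwa [conjTranspose_eq_transpose_of_trivial, hSi] at this
  have conj : ∀ {M q : Mat n}, q.IsSymm → M.PosSemidef → (q * M * q).PosSemidef := by
    intro M q hq hM
    have := hM.mul_mul_conjTranspose_same q
    rwa [conjTranspose_eq_transpose_of_trivial, hq] at this
  have hD : (X - Y).PosSemidef := by
    have h1 := conj hSi h
    have h2 : S⁻¹ * (S * X * S - c • (1 : Mat n)) * S⁻¹ = X - Y := by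
      rw [mul_sub, sub_mul, hY]
      congr 1
      · calc S⁻¹ * (S * X * S) * S⁻¹ = (S⁻¹ * S) * X * (S * S⁻¹) := by simp only [Matrix.mul_assoc]
          _ = X := by rw [mul_nonsing_inv S hu, nonsing_inv_mul S hu, Matrix.one_mul, Matrix.mul_one]
      · rw [Matrix.mul_smul, Matrix.smul_mul, Matrix.mul_one]
    rwa [h2] at h1
  have h1 : (c * normF (S⁻¹ * p * S⁻¹)) ^ 2 = ip (p * Y * p) Y := by
    rw [mul_pow, ← ip_self (isSymm_conj hSi hp), hY]
    have e : (S⁻¹ * p * S⁻¹ * (S⁻¹ * p * S⁻¹)).trace =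
        (p * (S⁻¹ * S⁻¹) * p * (S⁻¹ * S⁻¹)).trace := by
      rw [show S⁻¹ * p * S⁻¹ * (S⁻¹ * p * S⁻¹) = S⁻¹ * (p * S⁻¹ * (S⁻¹ * p * S⁻¹)) by
        simp only [Matrix.mul_assoc], trace_mul_comm]
      simp only [Matrix.mul_assoc]
    simp only [ip, Matrix.mul_smul, Matrix.smul_mul, trace_smul, smul_eq_mul, e]
    ring
  have h2 := ip_nonneg (conj hp hX) hD
  have h3 := ip_nonneg (conj hp hD) hYp
  rw [ip_sub_right] at h2
  rw [mul_sub, sub_mul, ip_sub_left] at h3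
  have h4 : ip (p * X * p) X ≤ (normF X * normF p) ^ 2 := by
    refine (ip_le _ _).trans ?_
    have k1 := normF_mul_le (p * X) p
    have k2 := normF_mul_le p X
    have k3 : normF (p * X * p) ≤ normF p * normF X * normF p :=
      k1.trans (mul_le_mul_of_nonneg_right k2 (normF_nonneg _))
    refine (mul_le_mul_of_nonneg_right k3 (normF_nonneg _)).trans (le_of_eq (by ring))
  exact (abs_le_of_sq_le_sq' (by linarith) (mul_nonneg (normF_nonneg _) (normF_nonneg _))).2

/-- Here `X` is the scaled matrix `Z^{1/2} X Z^{1/2}`. If it were exactly `μ I`, the equation would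
read `U + μ W = G` and squaring would suffice; centrality makes the error at most `γ μ ‖W‖`, which
is absorbed because `γ < 1`. -/
theorem scaled_energy {X U W G : Mat n} {μ γ : ℝ} (hγ0 : 0 ≤ γ) (hγ : γ < 1)
    (hU : U.IsSymm) (hW : W.IsSymm) (hX : normF (X - μ • (1 : Mat n)) ≤ γ * μ)
    (h : U + (1 / 2 : ℝ) • (W * X + X * W) = G) :
    normF U ^ 2 + (1 - γ) * (μ * normF W) ^ 2 + 2 * μ * ip U W ≤ normF G ^ 2 / (1 - γ) := by
  rw [anticomm_eq W X μ] at h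
  set D := X - μ • (1 : Mat n)
  have h1 : U + μ • W = G - (1 / 2 : ℝ) • (W * D + D * W) := by rw [← h]; abel
  have h2 : normF (U + μ • W) ≤ normF G + γ * (μ * normF W) := by
    rw [h1]
    refine (normF_sub_le _ _).trans (add_le_add_right ?_ _)
    refine (normF_half_anticomm_le W D).trans ?_
    rw [← mul_assoc]
    exact mul_le_mul_of_nonneg_right hX (normF_nonneg _)
  have h3 : normF (U + μ • W) ^ 2 = normF U ^ 2 + (μ * normF W) ^ 2 + 2 * μ * ip U W := by
    rw [← ip_self (hU.add (hW.smul μ)), ip_add_left, ip_add_right, ip_add_right]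
    simp only [ip_smul_left, ip_smul_right]
    rw [ip_self hU, ip_self hW, ip_comm W U]
    ring
  have h4 := pow_le_pow_left₀ (normF_nonneg _) h2 2
  rw [h3] at h4
  set w := μ * normF W
  set g := normF G
  have hg1 : 0 < 1 - γ := by linarith
  -- Convexity of the square applied to `(1 - γ) * (g / (1 - γ)) + γ * w`.
  have h5 : (g + γ * w) ^ 2 ≤ g ^ 2 / (1 - γ) + γ * w ^ 2 := by
    have : g ^ 2 / (1 - γ) + γ * w ^ 2 - (g + γ * w) ^ 2 =
        γ / (1 - γ) * (g - (1 - γ) * w) ^ 2 := by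
      field_simp; ring
    have h6 : 0 ≤ γ / (1 - γ) * (g - (1 - γ) * w) ^ 2 := by positivity
    linarith
  linarith

end Scaling

/-! ### The Newton system. -/

section Newton

variable {n m : ℕ} {P : SDP n m} {p : Params} {y0 y lam dy εp : Fin m → ℝ}
  {X Z Ξ dX dZ Ed : Mat n} {σ : ℝ}

/-- The third block of the Newton system in matrix form, after scaling by `Z^{1/2}`. -/
theorem NewtonSystem.scaled (hZ : Z.PosDef)
    (h : NewtonSystem P p y0 X y Z Ξ lam σ dX dy dZ Ed εp) (hX : X.IsSymm) :
    msqrt Z * dX * msqrt Z + (1 / 2 : ℝ) •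
      (((msqrt Z)⁻¹ * dZ * (msqrt Z)⁻¹) * (msqrt Z * X * msqrt Z) +
        (msqrt Z * X * msqrt Z) * ((msqrt Z)⁻¹ * dZ * (msqrt Z)⁻¹)) =
      (σ * mu X Z) • (1 : Mat n) - msqrt Z * X * msqrt Z := by
  obtain ⟨-, -, -, -, h5⟩ := h
  set S := msqrt Z
  have hS : S.IsSymm := isSymm_msqrt Z
  have hSi := isSymm_inv hS
  have hu : IsUnit S.det := isUnit_det_msqrt hZ
  rw [smul_mulVec, add_mulVec] at h5
  simp only [kronecker_mulVec_vec, transpose_mul, hS.eq, hSi.eq, hX.eq] at h5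
  rw [← vec_add, ← vec_smul, ← vec_add, ← vec_neg, ← vec_smul, ← vec_add] at h5
  have h6 := vec_bijective.1 h5
  have e1 : (S⁻¹ * dZ * S⁻¹) * (S * X * S) = S⁻¹ * dZ * (X * S) := by
    calc (S⁻¹ * dZ * S⁻¹) * (S * X * S) = S⁻¹ * dZ * (S⁻¹ * S) * (X * S) := by
          simp only [Matrix.mul_assoc]
      _ = _ := by rw [nonsing_inv_mul S hu, Matrix.mul_one]
  have e2 : (S * X * S) * (S⁻¹ * dZ * S⁻¹) = S * X * dZ * S⁻¹ := by
    calc (S * X * S) * (S⁻¹ * dZ * S⁻¹) = S * X * (S * S⁻¹) * dZ * S⁻¹ := by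
          simp only [Matrix.mul_assoc]
      _ = _ := by rw [mul_nonsing_inv S hu, Matrix.mul_one]
  rw [e1, e2, h6]
  abel

/-- Symmetry of the error is forced by the first block, whose other terms are all symmetric. It lets
the error be decomposed with symmetric matrices. -/
theorem NewtonSystem.isSymm_Ed (h : NewtonSystem P p y0 X y Z Ξ lam σ dX dy dZ Ed εp)
    (hX : X.IsSymm) (hZ : Z.IsSymm) (hΞ : Ξ.IsSymm) : Ed.IsSymm := by
  obtain ⟨h1, h2, h3, -, -⟩ := h
  rw [← sub_eq_iff_eq_add'] at h3
  rw [← h3]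
  refine IsSymm.sub ?_ ?_
  · exact (((h1.smul _).neg).add (P.adj_isSymm _)).add h2
  · exact (((P.C_symm.add ((isSymm_Cbar P p y0).smul _)).sub (P.adj_isSymm y)).sub hZ).add
      ((hX.sub hΞ).smul _)

end Newton

/-- The data of an iterate in the neighbourhood, with explicit residuals and bounds. -/
structure Iterate (p : Params) (B : ℝ) {n m : ℕ} (P : SDP n m) (y0 : Fin m → ℝ) (θ : ℝ)
    (X : Mat n) (y : Fin m → ℝ) (Z : Mat n) (Ξ : Mat n) (lam bt : Fin m → ℝ) (Ct : Mat n) :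
    Prop where
  θ_pos : 0 < θ
  θ_le : θ ≤ 1
  mu_eq : mu X Z = θ * p.ρ ^ 2
  X_pd : X.PosDef
  Z_pd : Z.PosDef
  Ξ_symm : Ξ.IsSymm
  primal : P.op X + (θ * p.ρ ^ 2) • (y - lam) = P.b + θ • (bbar P p + bt)
  dual : P.adj y + Z - (θ * p.ρ ^ 2) • (X - Ξ) = P.C + θ • (Cbar P p y0 + Ct)
  pair_le : normPair bt Ct ≤ p.KN
  semi_le : P.semiNorm bt Ct ≤ p.γS * p.ρ
  central : normF (msqrt Z * X * msqrt Z - (θ * p.ρ ^ 2) • (1 : Mat n)) ≤ p.γμ * (θ * p.ρ ^ 2)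
  X_le : normF X ≤ B * n
  y_le : normE y ≤ B * n
  Z_le : normF Z ≤ B * n
  Ξ_le : normF Ξ ≤ B * n
  lam_le : normE lam ≤ B * n

/-! ### Bounds on the Newton direction. -/

section Direction

variable {p : Params} {a b Ks Ky B : ℝ} {n m : ℕ} {P : SDP n m}
  {y0 y lam bt dy εp : Fin m → ℝ} {X Z Ξ Ct dX dZ Ed : Mat n} {σ θ : ℝ}
  {Xs : Mat n} {ys : Fin m → ℝ} {Zs : Mat n}

theorem Iterate.isSymm_Ct (I : Iterate p B P y0 θ X y Z Ξ lam bt Ct) : Ct.IsSymm := by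
  have h : Ct = θ⁻¹ • (P.adj y + Z - (θ * p.ρ ^ 2) • (X - Ξ) - P.C) - Cbar P p y0 := by
    rw [I.dual, add_sub_cancel_left, smul_smul, inv_mul_cancel₀ I.θ_pos.ne', one_smul,
      add_sub_cancel_left]
  rw [h]
  exact (((((P.adj_isSymm y).add I.Z_pd.symm').sub ((I.X_pd.symm'.sub I.Ξ_symm).smul _)).sub
    P.C_symm).smul _).sub (isSymm_Cbar P p y0)

/-- A shift of the Newton direction that makes the first two blocks of the system homogeneous up to
the proximal terms. -/
theorem exists_shift (S : Setting p a b Ks Ky P y0 Xs ys Zs)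
    (I : Iterate p B P y0 θ X y Z Ξ lam bt Ct) (hσ0 : 0 < σ) (hσ1 : σ ≤ 1)
    (hN : NewtonSystem P p y0 X y Z Ξ lam σ dX dy dZ Ed εp)
    (hA : Accurate P p (mu X Z) Ed εp) :
    ∃ (pX : Mat n) (py : Fin m → ℝ) (pZ : Mat n), pX.IsSymm ∧ pZ.IsSymm ∧
      P.op (dX + pX) = -((θ * p.ρ ^ 2) • ((dy + py) - (py + (1 - σ) • (y - lam)))) ∧
      P.adj (dy + py) + (dZ + pZ) =
        (θ * p.ρ ^ 2) • ((dX + pX) - (pX + (1 - σ) • (X - Ξ))) ∧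
      normF pX ≤ θ * ((Ks + Ky + 3 * p.ρ + 2 * (a⁻¹ * (p.KN + p.ρ))) * n) ∧
      normE py ≤ θ * ((Ks + Ky + 3 * p.ρ + 2 * (a⁻¹ * (p.KN + p.ρ))) * n) ∧
      normF pZ ≤ θ * ((Ks + Ky + 3 * p.ρ + 2 * (a⁻¹ * (p.KN + p.ρ))) * n) := by
  have hEd := hN.isSymm_Ed I.X_pd.symm' I.Z_pd.symm' I.Ξ_symm
  obtain ⟨h1, h2⟩ := hA
  obtain ⟨hdX, hdZ, hN1, hN2, -⟩ := hN
  have hρ := p.ρ_pos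
  have hsm := p.σmin_pos
  have hsm4 : p.σmin / 4 ≤ 1 := by have := p.σmin_le; have := p.σmax_le; linarith
  have hθ := I.θ_pos
  have hq : p.σmin / (4 * p.ρ ^ 2) * (θ * p.ρ ^ 2) = p.σmin / 4 * θ := by field_simp
  rw [mu0_eq S.n_pos, I.mu_eq] at h1 h2
  obtain ⟨X1, y1, Z1, hX1, hZ1, e1, f1, nX1, nZ1, ny1⟩ := S.exists_decomp I.isSymm_Ct (t := 1)
    one_pos (by simpa using I.pair_le) (by simpa using I.semi_le)
  obtain ⟨X2, y2, Z2, hX2, hZ2, e2, f2, nX2, nZ2, ny2⟩ := S.exists_decomp hEd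
    (t := p.σmin / 4 * θ) (by positivity) (h1.trans (le_of_eq (by rw [← hq]; ring)))
    (h2.trans (le_of_eq (by rw [← hq]; ring)))
  have hγρ : p.γ' * p.ρ ≤ p.ρ := by nlinarith [p.γ'_lt]
  have hai : 0 < a⁻¹ * (p.KN + p.ρ) :=
    mul_pos (inv_pos.2 S.wc.pos) (add_pos p.KN_pos hρ)
  have hγρ0 : 0 < p.γ' * p.ρ := mul_pos p.γ'_pos hρ
  have small : ∀ {r : ℝ}, 0 ≤ r → p.σmin / 4 * θ * r ≤ θ * r := by
    intro r hr
    have : 0 ≤ θ * r := by positivity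
    nlinarith
  rw [one_mul] at nX1 nZ1 ny1
  replace nX2 := nX2.trans (small hγρ0.le)
  replace nZ2 := nZ2.trans (small hγρ0.le)
  replace ny2 := ny2.trans (small hai.le)
  have hsn := sqrt_natCast_le S.n_pos
  have hn1 : (1 : ℝ) ≤ n := by exact_mod_cast S.n_pos
  have hKs := S.Ks_pos
  have hKy := S.Ky_pos
  have shiftF : ∀ {Q Q1 Q2 : Mat n}, normF Q ≤ Ks * √n → normF Q1 ≤ p.γ' * p.ρ →
      normF Q2 ≤ θ * (p.γ' * p.ρ) →
      normF (θ • ((1 - σ) • (init p - Q) + Q1) - Q2) ≤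
        θ * ((Ks + Ky + 3 * p.ρ + 2 * (a⁻¹ * (p.KN + p.ρ))) * n) := by
    intro Q Q1 Q2 k0 k1 k2
    have l1 := normF_sub_le (θ • ((1 - σ) • (init p - Q) + Q1)) Q2
    rw [normF_smul, abs_of_pos hθ] at l1
    have l2 := normF_add_le ((1 - σ) • (init p - Q)) Q1
    rw [normF_smul, abs_of_nonneg (sub_nonneg.2 hσ1)] at l2
    have l3 := normF_sub_le (init p) Q
    rw [normF_init] at l3
    have l4 : (1 - σ) * normF (init p - Q) ≤ normF (init p - Q) := by
      nlinarith [normF_nonneg (init p - Q)]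
    have l5 : normF ((1 - σ) • (init p - Q) + Q1) + p.γ' * p.ρ ≤
        (Ks + Ky + 3 * p.ρ + 2 * (a⁻¹ * (p.KN + p.ρ))) * n := by
      have r1 : p.ρ * √n ≤ p.ρ * n := mul_le_mul_of_nonneg_left hsn hρ.le
      have r2 : Ks * √n ≤ Ks * n := mul_le_mul_of_nonneg_left hsn hKs.le
      have r3 : p.ρ ≤ p.ρ * n := le_mul_of_one_le_right hρ.le hn1
      have r4 : 0 ≤ (Ky + 2 * (a⁻¹ * (p.KN + p.ρ))) * n := by positivity
      linarith
    have l6 := mul_le_mul_of_nonneg_left l5 hθ.le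
    linarith
  -- Subtracting the residual equations from the Newton blocks leaves `-(1 - σ) θ b̄ - θ bt + εp`
  -- and its dual analogue, besides proximal terms. Each part is the image of a known triple: `(init
  -- p - Xs, y0 - ys, init p - Zs)`, `(X1, y1, Z1)` and `(X2, y2, Z2)`.
  refine ⟨θ • ((1 - σ) • (init p - Xs) + X1) - X2, θ • ((1 - σ) • (y0 - ys) + y1) - y2,
    θ • ((1 - σ) • (init p - Zs) + Z1) - Z2, ?_, ?_, ?_, ?_, shiftF S.Xs_le nX1 nX2, ?_,
    shiftF S.Zs_le nZ1 nZ2⟩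
  · exact (((((isSymm_init p).sub S.Xs_psd.symm').smul _).add hX1).smul _).sub hX2
  · exact (((((isSymm_init p).sub S.Zs_psd.symm').smul _).add hZ1).smul _).sub hZ2
  · have k1 : P.op dX = -P.op X - (σ * mu X Z) • (y - lam) +
        (P.b + (σ * mu X Z / mu0 n p) • bbar P p) + εp - mu X Z • dy := by rw [← hN2]; abel
    rw [mu0_eq S.n_pos, I.mu_eq, show σ * (θ * p.ρ ^ 2) / p.ρ ^ 2 = σ * θ by field_simp,
      eq_sub_of_add_eq I.primal] at k1
    rw [SDP.op_add, SDP.op_sub, SDP.op_smul, SDP.op_add, SDP.op_smul, ← S.bbar_eq, e1, e2, k1]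
    module
  · have k1 : dZ = (P.C + (σ * mu X Z / mu0 n p) • Cbar P p y0) - P.adj y - Z +
        (σ * mu X Z) • (X - Ξ) + Ed + mu X Z • dX - P.adj dy := by rw [← hN1]; abel
    rw [mu0_eq S.n_pos, I.mu_eq, show σ * (θ * p.ρ ^ 2) / p.ρ ^ 2 = σ * θ by field_simp] at k1
    have k2 : Z = P.C + θ • (Cbar P p y0 + Ct) + (θ * p.ρ ^ 2) • (X - Ξ) - P.adj y := by
      rw [← I.dual]; abel
    rw [k1]
    nth_rw 1 [k2]
    simp only [SDP.adj_add, SDP.adj_sub, SDP.adj_smul]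
    rw [← f1, ← f2, S.Cbar_eq, SDP.adj_sub]
    module
  · have l1 := normE_sub_le (θ • ((1 - σ) • (y0 - ys) + y1)) y2
    rw [normE_smul, abs_of_pos hθ] at l1
    have l2 := normE_add_le ((1 - σ) • (y0 - ys)) y1
    rw [normE_smul, abs_of_nonneg (sub_nonneg.2 hσ1)] at l2
    have l3 := normE_sub_le y0 ys
    have l4 : (1 - σ) * normE (y0 - ys) ≤ normE (y0 - ys) := by
      nlinarith [normE_nonneg (y0 - ys)]
    have l5 : normE ((1 - σ) • (y0 - ys) + y1) + a⁻¹ * (p.KN + p.ρ) ≤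
        (Ks + Ky + 3 * p.ρ + 2 * (a⁻¹ * (p.KN + p.ρ))) * n := by
      have r1 := S.y0_le
      have r2 := S.ys_le
      have r1' : Ky * √n ≤ Ky * n := mul_le_mul_of_nonneg_left hsn hKy.le
      have r2' : Ks * √n ≤ Ks * n := mul_le_mul_of_nonneg_left hsn hKs.le
      have r3 : a⁻¹ * (p.KN + p.ρ) ≤ a⁻¹ * (p.KN + p.ρ) * n := le_mul_of_one_le_right hai.le hn1
      have r4 : 0 ≤ 3 * p.ρ * n := by positivity
      linarith
    have l6 := mul_le_mul_of_nonneg_left l5 hθ.le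
    linarith

end Direction

/-- Adding `1` in `H` makes `H² ≥ h / (1 - γ) ≥ h`, so one constant without square roots serves all
three bounds. -/
theorem sq_bounds_of_energy {u w A R H N μ γ h : ℝ} (hμ : 0 < μ) (hN : 0 ≤ N) (hγ : γ < 1)
    (hγ0 : 0 ≤ γ) (hA : 0 ≤ A) (hh : 0 ≤ h) (hH : H = h / (1 - γ) + 1)
    (hR : R ≤ h * (μ * N) ^ 2)
    (hE : u ^ 2 + (1 - γ) * (μ * w) ^ 2 + μ ^ 2 * A ≤ R) :
    u ≤ H * (μ * N) ∧ w ≤ H * N ∧ A ≤ (H * N) ^ 2 := by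
  have hg : 0 < 1 - γ := by linarith
  have h1 : 0 ≤ h / (1 - γ) := by positivity
  have h2 : h / (1 - γ) ≤ H ^ 2 := by rw [hH]; nlinarith
  have h3 : h ≤ h / (1 - γ) := by
    rw [le_div_iff₀ hg]; nlinarith
  have hH0 : 0 < H := by rw [hH]; positivity
  have hsq : 0 ≤ (μ * N) ^ 2 := sq_nonneg _
  have hw : 0 ≤ (1 - γ) * (μ * w) ^ 2 := mul_nonneg hg.le (sq_nonneg _)
  have hA' : 0 ≤ μ ^ 2 * A := by positivity
  have key : h * (μ * N) ^ 2 ≤ (H * (μ * N)) ^ 2 := by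
    rw [mul_pow H]; exact mul_le_mul_of_nonneg_right (h3.trans h2) hsq
  refine ⟨?_, ?_, ?_⟩
  · exact (abs_le_of_sq_le_sq' (by nlinarith [sq_nonneg u]) (by positivity)).2
  · have k1 : (μ * w) ^ 2 ≤ (μ * (H * N)) ^ 2 := by
      have k2 : (1 - γ) * (μ * w) ^ 2 ≤ h * (μ * N) ^ 2 := by nlinarith [sq_nonneg u]
      rw [mul_comm, ← le_div_iff₀ hg] at k2
      refine k2.trans ?_
      rw [mul_div_right_comm, show μ * (H * N) = H * (μ * N) by ring, mul_pow H]
      exact mul_le_mul_of_nonneg_right h2 hsq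
    exact le_of_mul_le_mul_left (abs_le_of_sq_le_sq' k1 (by positivity)).2 hμ
  · have k1 : μ ^ 2 * A ≤ μ ^ 2 * (H * N) ^ 2 := by
      have : μ ^ 2 * (H * N) ^ 2 = (H * (μ * N)) ^ 2 := by ring
      nlinarith [sq_nonneg u]
    exact le_of_mul_le_mul_left k1 (by positivity)

theorem le_mul_sq_of_le {x K N : ℝ} (hK : 0 ≤ K) (hN : 1 ≤ N) (h : x ≤ K * N) : x ≤ K * N ^ 2 := by
  refine h.trans (mul_le_mul_of_nonneg_left ?_ hK)
  nlinarith

section Direction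

theorem posSemidef_sub_of_central {n : ℕ} {X : Mat n} {μ γ : ℝ} (hX : X.IsSymm)
    (h : normF (X - μ • (1 : Mat n)) ≤ γ * μ) : (X - ((1 - γ) * μ) • (1 : Mat n)).PosSemidef := by
  have h1 := posSemidef_smul_one_add (hX.sub (isSymm_smul_one μ)) h
  have e : (γ * μ) • (1 : Mat n) + (X - μ • (1 : Mat n)) =
    X - ((1 - γ) * μ) • (1 : Mat n) := by module
  rwa [e] at h1

theorem normF_centering_le {n : ℕ} {X : Mat n} {μ γ σ t : ℝ} (hμ : 0 < μ)
    (hσ0 : 0 ≤ σ) (hσ1 : σ ≤ 1) (ht : √(n : ℝ) + γ ≤ t)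
    (h : normF (X - μ • (1 : Mat n)) ≤ γ * μ) : normF ((σ * μ) • (1 : Mat n) - X) ≤ t * μ := by
  have e : (σ * μ) • (1 : Mat n) - X = ((σ - 1) * μ) • (1 : Mat n) - (X - μ • (1 : Mat n)) := by
    module
  rw [e]
  refine (normF_sub_le _ _).trans ?_
  rw [normF_smul, normF_one, abs_mul, abs_of_pos hμ, abs_of_nonpos (by linarith)]
  have k2 : -(σ - 1) * μ * √(n : ℝ) ≤ μ * √(n : ℝ) :=
    mul_le_mul_of_nonneg_right (by nlinarith) (Real.sqrt_nonneg _)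
  nlinarith

theorem normF_half_anticomm_central_le {n : ℕ} {X W : Mat n} {μ γ w : ℝ} (hμ : 0 < μ) (hγ : γ ≤ 1)
    (h : normF (X - μ • (1 : Mat n)) ≤ γ * μ) (hW : normF W ≤ w) :
    normF ((1 / 2 : ℝ) • (W * X + X * W)) ≤ 2 * w * μ := by
  rw [anticomm_eq W X μ]
  refine (normF_add_le _ _).trans ?_
  rw [normF_smul, abs_of_pos hμ]
  have k1 := normF_half_anticomm_le W (X - μ • (1 : Mat n))
  have k2 : normF (X - μ • (1 : Mat n)) * normF W ≤ μ * normF W :=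
    mul_le_mul_of_nonneg_right (h.trans (by nlinarith)) (normF_nonneg _)
  have k3 := mul_le_mul_of_nonneg_left hW hμ.le
  linarith

theorem ip_conj_inv {n : ℕ} {Q : Mat n} (hQu : IsUnit Q.det) (U W : Mat n) :
    ip (Q * U * Q) (Q⁻¹ * W * Q⁻¹) = ip U W := by
  rw [ip, ip]
  calc (Q * U * Q * (Q⁻¹ * W * Q⁻¹)).trace
      = (Q * (U * (Q * Q⁻¹) * W * Q⁻¹)).trace := by simp only [Matrix.mul_assoc]
    _ = (U * (Q * Q⁻¹) * W * (Q⁻¹ * Q)).trace := by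
        rw [trace_mul_comm]; simp only [Matrix.mul_assoc]
    _ = _ := by
        rw [mul_nonsing_inv Q hQu, nonsing_inv_mul Q hQu, Matrix.mul_one, Matrix.mul_one]

/-- The energy estimate for a shifted solution of the scaled complementarity equation. -/
theorem shifted_energy {n : ℕ} {Q X dX dZ pX pZ : Mat n} {μ γ σ r t : ℝ} (hμ : 0 < μ)
    (hγ0 : 0 ≤ γ) (hγ : γ < 1) (hσ0 : 0 ≤ σ) (hσ1 : σ ≤ 1) (hQ : Q.IsSymm) (hQu : IsUnit Q.det)
    (hX : X.PosSemidef) (hdX : dX.IsSymm) (hdZ : dZ.IsSymm) (hpX : pX.IsSymm) (hpZ : pZ.IsSymm)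
    (hc : normF (Q * X * Q - μ • (1 : Mat n)) ≤ γ * μ)
    (h1 : normF (Q * Q) * normF pX ≤ r * μ) (h2 : normF X * normF pZ ≤ r * μ)
    (ht : √(n : ℝ) + γ ≤ t)
    (he : Q * dX * Q + (1 / 2 : ℝ) • ((Q⁻¹ * dZ * Q⁻¹) * (Q * X * Q) +
      (Q * X * Q) * (Q⁻¹ * dZ * Q⁻¹)) = (σ * μ) • (1 : Mat n) - Q * X * Q) :
    normF (Q * pX * Q) ≤ r * μ ∧ normF (Q⁻¹ * pZ * Q⁻¹) ≤ r / (1 - γ) ∧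
      normF (Q * (dX + pX) * Q) ^ 2 + (1 - γ) * (μ * normF (Q⁻¹ * (dZ + pZ) * Q⁻¹)) ^ 2 +
        2 * μ * ip (dX + pX) (dZ + pZ) ≤ ((t + r + 2 * (r / (1 - γ))) * μ) ^ 2 / (1 - γ) := by
  have hg : 0 < 1 - γ := by linarith
  have nPx : normF (Q * pX * Q) ≤ r * μ := (normF_conj_le hQ hpX).trans h1
  have nPz : normF (Q⁻¹ * pZ * Q⁻¹) ≤ r / (1 - γ) := by
    have k1 := (normF_inv_conj_le (mul_pos hg hμ) hX hQ hQu hpZ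
      (posSemidef_sub_of_central (isSymm_conj hQ hX.symm') hc)).trans h2
    rw [le_div_iff₀ hg]
    refine le_of_mul_le_mul_right (le_trans (le_of_eq ?_) k1) hμ
    ring
  refine ⟨nPx, nPz, ?_⟩
  -- The two scalings are dual to each other, so the inner product controlled by coercivity is the
  -- one in the scaled energy.
  rw [← ip_conj_inv hQu (dX + pX)]
  refine (scaled_energy hγ0 hγ (isSymm_conj hQ (hdX.add hpX))
    (isSymm_conj (isSymm_inv hQ) (hdZ.add hpZ)) hc rfl).trans ?_
  refine div_le_div_of_nonneg_right (pow_le_pow_left₀ (normF_nonneg _) ?_ 2) hg.le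
  have e : Q * (dX + pX) * Q + (1 / 2 : ℝ) • (Q⁻¹ * (dZ + pZ) * Q⁻¹ * (Q * X * Q) +
      Q * X * Q * (Q⁻¹ * (dZ + pZ) * Q⁻¹)) = ((σ * μ) • (1 : Mat n) - Q * X * Q) + Q * pX * Q +
      (1 / 2 : ℝ) • ((Q⁻¹ * pZ * Q⁻¹) * (Q * X * Q) + (Q * X * Q) * (Q⁻¹ * pZ * Q⁻¹)) := by
    rw [← he, mul_add Q dX, add_mul (Q * dX), mul_add Q⁻¹ dZ, add_mul (Q⁻¹ * dZ),
      add_mul (Q⁻¹ * dZ * Q⁻¹), mul_add (Q * X * Q)]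
    module
  rw [e]
  have k1 := normF_centering_le hμ hσ0 hσ1 ht hc
  have k2 := normF_half_anticomm_central_le hμ hγ.le hc nPz
  refine (normF_add_le _ _).trans ((add_le_add ((normF_add_le _ _).trans
    (add_le_add k1 nPx)) k2).trans (le_of_eq (by ring)))

/-- The power `n²` comes from the shift: it is `O(θ n)`, and scaling it costs a factor `‖Z‖` or
`‖X‖`, which is `O(n)`. The centering term, of order `μ √n`, and the proximal offsets, of order `n`,
are dominated by this. -/
theorem exists_direction_bound (p : Params) {a b Ks Ky B : ℝ} (ha : 0 < a) (hKs : 0 < Ks)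
    (hKy : 0 < Ky) (hB : 0 < B) :
    ∃ D > 0, ∀ {n m : ℕ} {P : SDP n m} {y0 y lam bt dy εp : Fin m → ℝ}
      {X Z Ξ Ct dX dZ Ed Xs Zs : Mat n} {ys : Fin m → ℝ} {σ θ : ℝ},
      Setting p a b Ks Ky P y0 Xs ys Zs → Iterate p B P y0 θ X y Z Ξ lam bt Ct →
      0 < σ → σ ≤ 1 → NewtonSystem P p y0 X y Z Ξ lam σ dX dy dZ Ed εp →
      Accurate P p (mu X Z) Ed εp →
      normF (msqrt Z * dX * msqrt Z) ≤ D * (θ * p.ρ ^ 2 * (n : ℝ) ^ 2) ∧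
      normF ((msqrt Z)⁻¹ * dZ * (msqrt Z)⁻¹) ≤ D * (n : ℝ) ^ 2 ∧
      normF dX ≤ D * (n : ℝ) ^ 2 ∧ normE dy ≤ D * (n : ℝ) ^ 2 := by
  have hρ := p.ρ_pos
  have hγ0 := p.γμ_pos
  have hγ1 := p.γμ_lt
  have hg : 0 < 1 - p.γμ := by linarith
  have hai : 0 < a⁻¹ * (p.KN + p.ρ) := mul_pos (inv_pos.2 ha) (add_pos p.KN_pos hρ)
  obtain ⟨K, hKdef⟩ : ∃ K, K = Ks + Ky + 3 * p.ρ + 2 * (a⁻¹ * (p.KN + p.ρ)) := ⟨_, rfl⟩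
  have hK : 0 < K := by rw [hKdef]; positivity
  obtain ⟨κ₁, hκ₁⟩ : ∃ κ, κ = B * K / p.ρ ^ 2 := ⟨_, rfl⟩
  obtain ⟨κ₂, hκ₂⟩ : ∃ κ, κ = κ₁ / (1 - p.γμ) := ⟨_, rfl⟩
  have hκ₁p : 0 < κ₁ := by rw [hκ₁]; positivity
  have hκ₂p : 0 < κ₂ := by rw [hκ₂]; positivity
  obtain ⟨q0, hq0⟩ : ∃ q, q = K + 2 * B := ⟨_, rfl⟩
  obtain ⟨h, hh⟩ : ∃ h, h = (2 + κ₁ + 2 * κ₂) ^ 2 / (1 - p.γμ) + 2 * q0 ^ 2 := ⟨_, rfl⟩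
  have hhp : 0 ≤ h := by rw [hh]; positivity
  obtain ⟨H, hH⟩ : ∃ H, H = h / (1 - p.γμ) + 1 := ⟨_, rfl⟩
  have hHp : 0 < H := by rw [hH]; positivity
  refine ⟨H + K + κ₁ + κ₂, by positivity, ?_⟩
  intro n m P y0 y lam bt dy εp X Z Ξ Ct dX dZ Ed Xs Zs ys σ θ S I hσ0 hσ1 hN hA
  obtain ⟨pX, py, pZ, hpX, hpZ, c1, c2, nX, ny, nZ⟩ := exists_shift S I hσ0 hσ1 hN hA
  rw [← hKdef] at nX ny nZ
  have hsc := hN.scaled I.Z_pd I.X_pd.symm'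
  rw [I.mu_eq] at hsc
  have hcen := I.central
  have hθ := I.θ_pos
  have hθ1 := I.θ_le
  -- The factor `θ` of the shift becomes the factor `μ = θ ρ²` required on the right side of the
  -- scaled equation.
  have hμρ : (B * n) * (θ * (K * n)) = κ₁ * (n : ℝ) ^ 2 * (θ * p.ρ ^ 2) := by
    rw [hκ₁]; field_simp
  have hμ : 0 < θ * p.ρ ^ 2 := by positivity
  have hn1 : (1 : ℝ) ≤ n := by exact_mod_cast S.n_pos
  have hsn := sqrt_natCast_le S.n_pos
  have hBn : 0 ≤ B * n := by positivity
  obtain ⟨XB, yB, ZB, ΞB, lB⟩ : _ ∧ _ ∧ _ ∧ _ ∧ _ := ⟨I.X_le, I.y_le, I.Z_le, I.Ξ_le, I.lam_le⟩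
  have hdet := isUnit_det_msqrt I.Z_pd
  have hQQ := msqrt_mul_self I.Z_pd
  have hQs := isSymm_msqrt Z
  generalize msqrt Z = Q at *
  generalize θ * p.ρ ^ 2 = μ at *
  obtain ⟨nPx, nPz, E1⟩ := shifted_energy (r := κ₁ * (n : ℝ) ^ 2) (t := 2 * (n : ℝ) ^ 2) hμ hγ0.le
    hγ1 hσ0.le hσ1 hQs hdet I.X_pd.posSemidef hN.1 hN.2.1 hpX hpZ hcen
    (by rw [hQQ, ← hμρ]; exact mul_le_mul ZB nX (normF_nonneg _) hBn)
    (by rw [← hμρ]; exact mul_le_mul XB nZ (normF_nonneg _) hBn) (by nlinarith) hsc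
  generalize (n : ℝ) = N at *
  have E2 := P.le_ip_of_coupled hμ.le (hN.1.add hpX) c1 c2
  have qb : ∀ {t r s : ℝ}, t ≤ θ * (K * N) → r ≤ 2 * (B * N) → s ≤ t + (1 - σ) * r → 0 ≤ r →
      s ≤ q0 * N ^ 2 := by
    intro t r s k1 k2 k3 k4
    have k6 : θ * (K * N) ≤ K * N := mul_le_of_le_one_left (by positivity) hθ1
    have k5 : (1 - σ) * r ≤ r := mul_le_of_le_one_left k4 (by linarith)
    refine le_mul_sq_of_le (by rw [hq0]; positivity) hn1 ?_
    rw [hq0]; linarith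
  have q1 : normF (pX + (1 - σ) • (X - Ξ)) ≤ q0 * N ^ 2 := by
    refine qb nX ?_ ((normF_add_le _ _).trans (le_of_eq ?_)) (normF_nonneg (X - Ξ))
    · have := normF_sub_le X Ξ; linarith
    · rw [normF_smul, abs_of_nonneg (sub_nonneg.2 hσ1)]
  have q2 : normE (py + (1 - σ) • (y - lam)) ≤ q0 * N ^ 2 := by
    refine qb ny ?_ ((normE_add_le _ _).trans (le_of_eq ?_)) (normE_nonneg (y - lam))
    · have := normE_sub_le y lam; linarith
    · rw [normE_smul, abs_of_nonneg (sub_nonneg.2 hσ1)]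
  have q1' := pow_le_pow_left₀ (normF_nonneg _) q1 2
  have q2' := pow_le_pow_left₀ (normE_nonneg _) q2 2
  -- Multiplied by `μ`, coercivity bounds the cross term `2 μ ⟨dX + pX, dZ + pZ⟩` of the energy
  -- inequality from below.
  have E3 := mul_le_mul_of_nonneg_left E2 hμ.le
  have E4 := mul_le_mul_of_nonneg_left (add_le_add q1' q2') (sq_nonneg μ)
  have E5 : ((2 * N ^ 2 + κ₁ * N ^ 2 + 2 * (κ₁ * N ^ 2 / (1 - p.γμ))) * μ) ^ 2 / (1 - p.γμ) +
      μ ^ 2 * ((q0 * N ^ 2) ^ 2 + (q0 * N ^ 2) ^ 2) = h * (μ * N ^ 2) ^ 2 := by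
    rw [hh, hκ₂]; ring
  obtain ⟨b1, b2, b3⟩ := sq_bounds_of_energy (N := N ^ 2)
    (A := normF (dX + pX) ^ 2 + normE (dy + py) ^ 2) (u := normF (Q * (dX + pX) * Q))
    (w := normF (Q⁻¹ * (dZ + pZ) * Q⁻¹)) hμ (sq_nonneg N) hγ1 hγ0.le (by positivity) hhp hH
    le_rfl (by linarith)
  have hHN : 0 ≤ H * N ^ 2 := by positivity
  have b4 : normF (dX + pX) ≤ H * N ^ 2 :=
    (abs_le_of_sq_le_sq' ((le_add_of_nonneg_right (sq_nonneg _)).trans b3) hHN).2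
  have b5 : normE (dy + py) ≤ H * N ^ 2 :=
    (abs_le_of_sq_le_sq' ((le_add_of_nonneg_left (sq_nonneg _)).trans b3) hHN).2
  have hKN : θ * (K * N) ≤ K * N ^ 2 :=
    le_mul_sq_of_le hK.le hn1 (mul_le_of_le_one_left (by positivity) hθ1)
  have p1 : 0 ≤ (K + κ₂) * (μ * N ^ 2) := by positivity
  have p2 : 0 ≤ (K + κ₁) * N ^ 2 := by positivity
  have p3 : 0 ≤ (κ₁ + κ₂) * N ^ 2 := by positivity
  refine ⟨?_, ?_, ?_, ?_⟩
  · have k1 := normF_sub_le (Q * (dX + pX) * Q) (Q * pX * Q)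
    have e : Q * (dX + pX) * Q - Q * pX * Q = Q * dX * Q := by
      rw [mul_add, add_mul, add_sub_cancel_right]
    rw [e] at k1
    linarith
  · have k1 := normF_sub_le (Q⁻¹ * (dZ + pZ) * Q⁻¹) (Q⁻¹ * pZ * Q⁻¹)
    have e : Q⁻¹ * (dZ + pZ) * Q⁻¹ - Q⁻¹ * pZ * Q⁻¹ = Q⁻¹ * dZ * Q⁻¹ := by
      rw [mul_add, add_mul, add_sub_cancel_right]
    rw [e] at k1
    have e2 : κ₁ * N ^ 2 / (1 - p.γμ) = κ₂ * N ^ 2 := by rw [hκ₂]; ring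
    rw [e2] at nPz
    linarith
  · have k1 := normF_sub_le (dX + pX) pX
    rw [add_sub_cancel_right] at k1
    linarith
  · have k1 := normE_sub_le (dy + py) py
    rw [add_sub_cancel_right] at k1
    linarith

end Direction

/-! ### Complementarity and centrality along the direction. -/

section Centrality

variable {n : ℕ}

/-- The right side equals `(Tr M² + ‖M‖²) / 2`, and `Tr M² ≤ ‖M‖²`. -/
theorem ip_self_le_normF_half_add_transpose (M : Mat n) :
    ip M M ≤ normF ((1 / 2 : ℝ) • (M + Mᵀ)) ^ 2 := by
  have hs : ((1 / 2 : ℝ) • (M + Mᵀ)).IsSymm := by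
    rw [IsSymm, transpose_smul, transpose_add, transpose_transpose, add_comm]
  have h1 : ip Mᵀ M = normF M ^ 2 := by
    rw [ip_transpose_left, normF_eq_l2, l2_sq]
  have h2 : ip Mᵀ Mᵀ = ip M M := by
    rw [ip, ip, ← transpose_mul, trace_transpose]
  have h3 := ip_le M M
  rw [← ip_self hs, ip_smul_left, ip_smul_right, ip_add_left, ip_add_right, ip_add_right, h2,
    ip_comm M Mᵀ, h1]
  nlinarith

theorem ip_conj_self {Q : Mat n} (hu : IsUnit Q.det) (A : Mat n) :
    ip (Q * A * Q⁻¹) (Q * A * Q⁻¹) = ip A A := by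
  rw [ip, ip]
  calc (Q * A * Q⁻¹ * (Q * A * Q⁻¹)).trace
      = (Q * (A * (Q⁻¹ * Q) * A * Q⁻¹)).trace := by simp only [Matrix.mul_assoc]
    _ = (A * (Q⁻¹ * Q) * A * (Q⁻¹ * Q)).trace := by
        rw [trace_mul_comm]; simp only [Matrix.mul_assoc]
    _ = _ := by rw [nonsing_inv_mul Q hu, Matrix.mul_one, Matrix.mul_one]

theorem msqrt_mul_mul_inv {Z : Mat n} (hZ : Z.PosDef) (X : Mat n) :
    msqrt Z * (X * Z) * (msqrt Z)⁻¹ = msqrt Z * X * msqrt Z := by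
  nth_rw 2 [← msqrt_mul_self hZ]
  calc msqrt Z * (X * (msqrt Z * msqrt Z)) * (msqrt Z)⁻¹
      = msqrt Z * X * msqrt Z * (msqrt Z * (msqrt Z)⁻¹) := by simp only [Matrix.mul_assoc]
    _ = _ := by rw [mul_nonsing_inv _ (isUnit_det_msqrt hZ), Matrix.mul_one]

theorem symmetrize_msqrt {X Z : Mat n} (hX : X.IsSymm) (hZ : Z.PosDef) :
    symmetrize (msqrt Z) (X * Z) = msqrt Z * X * msqrt Z := by
  rw [symmetrize, msqrt_mul_mul_inv hZ, (isSymm_conj (isSymm_msqrt Z) hX).eq, ← two_smul ℝ,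
    smul_smul]
  norm_num

/-- The centrality measure in the scaling by `Z^{1/2}` is the smallest among all scalings. -/
theorem normF_central_le {X Z Q : Mat n} (hX : X.IsSymm) (hZ : Z.PosDef) (hu : IsUnit Q.det)
    (μ : ℝ) : normF (symmetrize (msqrt Z) (X * Z) - μ • (1 : Mat n)) ≤
      normF (symmetrize Q (X * Z) - μ • (1 : Mat n)) := by
  have hconj : ∀ S : Mat n, IsUnit S.det →
      S * (X * Z) * S⁻¹ - μ • (1 : Mat n) = S * (X * Z - μ • (1 : Mat n)) * S⁻¹ := by
    intro S hS
    rw [mul_sub, sub_mul, Matrix.mul_smul, Matrix.smul_mul, Matrix.mul_one, mul_nonsing_inv S hS]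
  -- In the scaling by `Z^{1/2}` the conjugated product is already symmetric, so the squared norm is
  -- the similarity invariant `Tr (XZ - μ I)²`; for any other scaling this is only a lower bound.
  have h1 : normF (symmetrize (msqrt Z) (X * Z) - μ • (1 : Mat n)) ^ 2 =
      ip (X * Z - μ • (1 : Mat n)) (X * Z - μ • (1 : Mat n)) := by
    rw [symmetrize_msqrt hX hZ,
      ← ip_self ((isSymm_conj (isSymm_msqrt Z) hX).sub (isSymm_smul_one μ)),
      ← msqrt_mul_mul_inv hZ, hconj _ (isUnit_det_msqrt hZ), ip_conj_self (isUnit_det_msqrt hZ)]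
  have h2 := ip_self_le_normF_half_add_transpose (Q * (X * Z) * Q⁻¹ - μ • (1 : Mat n))
  rw [hconj Q hu, ip_conj_self hu, ← h1, ← hconj Q hu] at h2
  have e : (1 / 2 : ℝ) • ((Q * (X * Z) * Q⁻¹ - μ • (1 : Mat n)) +
      (Q * (X * Z) * Q⁻¹ - μ • (1 : Mat n))ᵀ) = symmetrize Q (X * Z) - μ • (1 : Mat n) := by
    rw [symmetrize, transpose_sub, (isSymm_smul_one (n := n) μ).eq]
    module
  rw [e] at h2
  exact (abs_le_of_sq_le_sq' h2 (normF_nonneg _)).2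

/-- The symmetrized product along the Newton direction. -/
theorem symmetrize_newton {X Z Q dX dZ : Mat n} {μ σ α : ℝ} (hQ : Q.IsSymm) (hu : IsUnit Q.det)
    (hQQ : Q * Q = Z) (hX : X.IsSymm) (hdX : dX.IsSymm) (hdZ : dZ.IsSymm)
    (he : Q * dX * Q + (1 / 2 : ℝ) • ((Q⁻¹ * dZ * Q⁻¹) * (Q * X * Q) +
      (Q * X * Q) * (Q⁻¹ * dZ * Q⁻¹)) = (σ * μ) • (1 : Mat n) - Q * X * Q) :
    symmetrize Q ((X + α • dX) * (Z + α • dZ)) = (1 - α) • (Q * X * Q) +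
      (α * (σ * μ)) • (1 : Mat n) + (α ^ 2) • ((1 / 2 : ℝ) • ((Q⁻¹ * dZ * Q⁻¹) * (Q * dX * Q) +
        (Q * dX * Q) * (Q⁻¹ * dZ * Q⁻¹))) := by
  have h1 : Q * ((X + α • dX) * (Z + α • dZ)) * Q⁻¹ =
      (Q * X * Q + α • (Q * dX * Q)) * (1 + α • (Q⁻¹ * dZ * Q⁻¹)) := by
    have k1 : Q * X * Q + α • (Q * dX * Q) = Q * (X + α • dX) * Q := by
      rw [mul_add, add_mul, Matrix.mul_smul, Matrix.smul_mul]
    have k2 : (1 : Mat n) + α • (Q⁻¹ * dZ * Q⁻¹) = Q⁻¹ * (Z + α • dZ) * Q⁻¹ := by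
      rw [mul_add, add_mul, Matrix.mul_smul, Matrix.smul_mul, ← hQQ, ← Matrix.mul_assoc,
        nonsing_inv_mul Q hu, Matrix.one_mul, mul_nonsing_inv Q hu]
    rw [k1, k2]
    calc _ = Q * (X + α • dX) * (1 : Mat n) * (Z + α • dZ) * Q⁻¹ := by
          simp only [Matrix.mul_assoc, Matrix.one_mul]
      _ = _ := by rw [← mul_nonsing_inv Q hu]; simp only [Matrix.mul_assoc]
  have sX := (isSymm_conj hQ hX).eq
  have sdX := (isSymm_conj hQ hdX).eq
  have sdZ := (isSymm_conj (isSymm_inv hQ) hdZ).eq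
  rw [symmetrize, h1]
  generalize Q * X * Q = A at *
  generalize Q * dX * Q = dA at *
  generalize Q⁻¹ * dZ * Q⁻¹ = dB at *
  have h2 : (α * (σ * μ)) • (1 : Mat n) = α • (dA + (1 / 2 : ℝ) • (dB * A + A * dB)) + α • A := by
    rw [he]; module
  rw [h2, transpose_mul, transpose_add, transpose_add, transpose_smul, transpose_smul,
    transpose_one, sX, sdX, sdZ]
  simp only [mul_add, add_mul, Matrix.mul_one, Matrix.one_mul, Matrix.mul_smul, Matrix.smul_mul]
  module

theorem trace_newton {X Z Q dX dZ : Mat n} {μ σ : ℝ} (hu : IsUnit Q.det)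
    (hQQ : Q * Q = Z)
    (he : Q * dX * Q + (1 / 2 : ℝ) • ((Q⁻¹ * dZ * Q⁻¹) * (Q * X * Q) +
      (Q * X * Q) * (Q⁻¹ * dZ * Q⁻¹)) = (σ * μ) • (1 : Mat n) - Q * X * Q) :
    ip X dZ + ip dX Z = n * (σ * μ) - ip X Z := by
  have h := congrArg trace he
  have t : ∀ Y : Mat n, (Q * Y * Q).trace = ip Y Z := by
    intro Y; rw [← hQQ, ip, Matrix.mul_assoc, trace_mul_comm, Matrix.mul_assoc]
  rw [trace_add, trace_smul, trace_add, trace_sub, trace_smul, trace_one, Fintype.card_fin, t, t,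
    trace_mul_comm (Q⁻¹ * dZ * Q⁻¹), ← ip, ip_conj_inv hu] at h
  simp only [smul_eq_mul] at h
  linarith

theorem ip_add_smul (X Z dX dZ : Mat n) (α : ℝ) :
    ip (X + α • dX) (Z + α • dZ) = ip X Z + α * (ip X dZ + ip dX Z) + α ^ 2 * ip dX dZ := by
  simp only [ip_add_left, ip_add_right, ip_smul_left, ip_smul_right]
  ring

theorem mu_newton {X Z Q dX dZ : Mat n} {σ α : ℝ} (hn : 0 < n) (hu : IsUnit Q.det)
    (hQQ : Q * Q = Z)
    (he : Q * dX * Q + (1 / 2 : ℝ) • ((Q⁻¹ * dZ * Q⁻¹) * (Q * X * Q) +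
      (Q * X * Q) * (Q⁻¹ * dZ * Q⁻¹)) = (σ * mu X Z) • (1 : Mat n) - Q * X * Q) :
    mu (X + α • dX) (Z + α • dZ) =
      (1 - α + α * σ) * mu X Z + α ^ 2 * (ip dX dZ / n) := by
  have hn' : (n : ℝ) ≠ 0 := by positivity
  rw [mu, ip_add_smul, trace_newton hu hQQ he, mu]
  field_simp
  ring

/-- The scaling `Q` stays fixed at the old point, which makes the symmetrized product an exact
quadratic in `α`: its affine part contracts the defect by `1 - α`, and the remainder is bounded by
the product of the scaled directions. -/
theorem normF_central_newton_le {X Z Q dX dZ : Mat n} {σ α γ q : ℝ} (hn : 0 < n)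
    (hα1 : α ≤ 1) (hQ : Q.IsSymm) (hu : IsUnit Q.det)
    (hQQ : Q * Q = Z) (hX : X.IsSymm) (hdX : dX.IsSymm) (hdZ : dZ.IsSymm)
    (hc : normF (Q * X * Q - mu X Z • (1 : Mat n)) ≤ γ * mu X Z)
    (hq : normF (Q * dX * Q) * normF (Q⁻¹ * dZ * Q⁻¹) ≤ q)
    (he : Q * dX * Q + (1 / 2 : ℝ) • ((Q⁻¹ * dZ * Q⁻¹) * (Q * X * Q) +
      (Q * X * Q) * (Q⁻¹ * dZ * Q⁻¹)) = (σ * mu X Z) • (1 : Mat n) - Q * X * Q) :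
    normF (symmetrize Q ((X + α • dX) * (Z + α • dZ)) -
      mu (X + α • dX) (Z + α • dZ) • (1 : Mat n)) ≤
      (1 - α) * (γ * mu X Z) + 2 * (α ^ 2 * q) := by
  rw [symmetrize_newton hQ hu hQQ hX hdX hdZ he, mu_newton hn hu hQQ he]
  have hip : |ip dX dZ| ≤ q := by
    rw [← ip_conj_inv hu]; exact (abs_ip_le _ _).trans hq
  have hT := (normF_half_anticomm_le (Q⁻¹ * dZ * Q⁻¹) (Q * dX * Q)).trans hq
  have hI : normF ((ip dX dZ / n) • (1 : Mat n)) ≤ q := by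
    rw [normF_smul, normF_one, abs_div, abs_of_nonneg (Nat.cast_nonneg n : (0 : ℝ) ≤ n)]
    have hnp : (0 : ℝ) < n := by exact_mod_cast hn
    rw [div_mul_eq_mul_div, div_le_iff₀ hnp]
    exact mul_le_mul hip (sqrt_natCast_le hn) (Real.sqrt_nonneg _) ((abs_nonneg _).trans hip)
  generalize (1 / 2 : ℝ) • ((Q⁻¹ * dZ * Q⁻¹) * (Q * dX * Q) +
        (Q * dX * Q) * (Q⁻¹ * dZ * Q⁻¹)) = T at *
  generalize mu X Z = μ at *
  have e : (1 - α) • (Q * X * Q) + (α * (σ * μ)) • (1 : Mat n) + (α ^ 2) • T -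
      ((1 - α + α * σ) * μ + α ^ 2 * (ip dX dZ / n)) • (1 : Mat n) =
      (1 - α) • (Q * X * Q - μ • (1 : Mat n)) +
        (α ^ 2) • (T - (ip dX dZ / n) • (1 : Mat n)) := by module
  rw [e]
  refine (normF_add_le _ _).trans ?_
  rw [normF_smul, normF_smul, abs_of_nonneg (sub_nonneg.2 hα1), abs_of_nonneg (sq_nonneg α)]
  have k1 := mul_le_mul_of_nonneg_left hc (sub_nonneg.2 hα1)
  have k2 := mul_le_mul_of_nonneg_left ((normF_sub_le T ((ip dX dZ / n) • (1 : Mat n))).trans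
    (add_le_add hT hI)) (sq_nonneg α)
  linarith

/-- After congruence, the new matrices are `μ I` and `I` plus symmetric perturbations of norm below
`μ` and `1`. -/
theorem posDef_newton {X Z Q dX dZ : Mat n} {μ α γ d : ℝ} (hα0 : 0 ≤ α)
    (hQ : Q.IsSymm) (hu : IsUnit Q.det) (hQQ : Q * Q = Z) (hX : X.IsSymm) (hdX : dX.IsSymm)
    (hdZ : dZ.IsSymm) (hμ : 0 < μ)
    (hc : normF (Q * X * Q - μ • (1 : Mat n)) ≤ γ * μ)
    (h1 : normF (Q * dX * Q) ≤ d * μ) (h2 : normF (Q⁻¹ * dZ * Q⁻¹) ≤ d)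
    (hd : α * d < 1 - γ) (hγ : 0 ≤ γ) :
    (X + α • dX).PosDef ∧ (Z + α • dZ).PosDef := by
  constructor
  · have k1 : normF (Q * X * Q - μ • (1 : Mat n) + α • (Q * dX * Q)) < μ := by
      refine (normF_add_le _ _).trans_lt ?_
      rw [normF_smul, abs_of_nonneg hα0]
      have := mul_le_mul_of_nonneg_left h1 hα0
      nlinarith
    have k2 := posDef_smul_one_add (((isSymm_conj hQ hX).sub (isSymm_smul_one μ)).add
      ((isSymm_conj hQ hdX).smul α)) k1
    have hdi : IsUnit (Q⁻¹).det := by rw [det_nonsing_inv]; exact hu.ringInverse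
    have k3 := posDef_conj (isSymm_inv hQ) hdi k2
    have e : μ • (1 : Mat n) + (Q * X * Q - μ • (1 : Mat n) + α • (Q * dX * Q)) =
        Q * (X + α • dX) * Q := by
      rw [mul_add, add_mul, Matrix.mul_smul, Matrix.smul_mul]; abel
    have e2 : Q⁻¹ * (Q * (X + α • dX) * Q) * Q⁻¹ = X + α • dX := by
      calc Q⁻¹ * (Q * (X + α • dX) * Q) * Q⁻¹ = (Q⁻¹ * Q) * (X + α • dX) * (Q * Q⁻¹) := by
            simp only [Matrix.mul_assoc]
        _ = _ := by rw [nonsing_inv_mul Q hu, mul_nonsing_inv Q hu, Matrix.one_mul, Matrix.mul_one]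
    rwa [e, e2] at k3
  · have k1 : normF (α • (Q⁻¹ * dZ * Q⁻¹)) < 1 := by
      rw [normF_smul, abs_of_nonneg hα0]
      have := mul_le_mul_of_nonneg_left h2 hα0
      linarith
    have k3 := posDef_conj hQ hu
      (posDef_smul_one_add ((isSymm_conj (isSymm_inv hQ) hdZ).smul α) k1)
    rw [one_smul, mul_add, add_mul, Matrix.mul_one, hQQ, Matrix.mul_smul, Matrix.smul_mul,
      conj_inv_cancel hu] at k3
    exact k3

end Centrality

/-! ### Residuals after a step. -/

section Residuals

variable {n m : ℕ} {P : SDP n m} {p : Params} {y0 y lam dy εp bt : Fin m → ℝ}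
  {X Z Ξ dX dZ Ed Ct : Mat n} {σ θ θ' α δ : ℝ}

/-- Here `r` stands for `μ₀`, and `δ` is the deviation of the new `μ` from its first-order
prediction. The old residual is damped by `1 - α`, the Newton error enters with weight `α`, and the
rest is of second order. -/
theorem primal_residual_newton {r μ : ℝ} (hr : r ≠ 0) (hθ' : θ' ≠ 0)
    (hp : P.op X + (θ * r) • (y - lam) = P.b + θ • (bbar P p + bt))
    (hN : P.op dX + (θ * r) • dy =
      -P.op X - (σ * (θ * r)) • (y - lam) + (P.b + (σ * (θ * r) / r) • bbar P p) + εp)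
    (hμ : μ = (1 - α + α * σ) * (θ * r) + δ) (hμθ : μ = θ' * r) :
    P.op (X + α • dX) + μ • (y + α • dy - lam) = P.b + (μ / r) • (bbar P p +
      θ'⁻¹ • ((((1 - α) * θ) • bt + α • εp) + (-(δ / r) • bbar P p + δ • (y - lam) +
        (α * (μ - θ * r)) • dy))) := by
  have k1 : P.op dX = -P.op X - (σ * (θ * r)) • (y - lam) +
      (P.b + (σ * (θ * r) / r) • bbar P p) + εp - (θ * r) • dy := by rw [← hN]; abel
  have e1 : μ / r = θ' := by rw [hμθ]; field_simp
  have e2 : σ * (θ * r) / r = σ * θ := by field_simp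
  have e3 : δ / r = θ' - (1 - α + α * σ) * θ := by
    rw [← e1, hμ]; field_simp; ring
  rw [SDP.op_add, SDP.op_smul, k1, eq_sub_of_add_eq hp, e1, e2, e3, smul_add θ', smul_smul θ',
    mul_inv_cancel₀ hθ', one_smul, hμ]
  module

theorem dual_residual_newton {r μ : ℝ} (hr : r ≠ 0) (hθ' : θ' ≠ 0)
    (hp : P.adj y + Z - (θ * r) • (X - Ξ) = P.C + θ • (Cbar P p y0 + Ct))
    (hN : -((θ * r) • dX) + P.adj dy + dZ =
      (P.C + (σ * (θ * r) / r) • Cbar P p y0) - P.adj y - Z + (σ * (θ * r)) • (X - Ξ) + Ed)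
    (hμ : μ = (1 - α + α * σ) * (θ * r) + δ) (hμθ : μ = θ' * r) :
    P.adj (y + α • dy) + (Z + α • dZ) - μ • (X + α • dX - Ξ) = P.C + (μ / r) • (Cbar P p y0 +
      θ'⁻¹ • ((((1 - α) * θ) • Ct + α • Ed) + (-(δ / r) • Cbar P p y0 - δ • (X - Ξ) -
        (α * (μ - θ * r)) • dX))) := by
  have k1 : dZ = (P.C + (σ * (θ * r) / r) • Cbar P p y0) - P.adj y - Z +
      (σ * (θ * r)) • (X - Ξ) + Ed + (θ * r) • dX - P.adj dy := by rw [← hN]; abel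
  have k2 : Z = P.C + θ • (Cbar P p y0 + Ct) + (θ * r) • (X - Ξ) - P.adj y := by
    rw [← hp]; abel
  have e1 : μ / r = θ' := by rw [hμθ]; field_simp
  have e2 : σ * (θ * r) / r = σ * θ := by field_simp
  have e3 : δ / r = θ' - (1 - α + α * σ) * θ := by
    rw [← e1, hμ]; field_simp; ring
  rw [k1, k2, SDP.adj_add, SDP.adj_smul, e1, e2, e3, smul_add θ', smul_smul θ',
    mul_inv_cancel₀ hθ', one_smul, hμ]
  module

end Residuals

/-! ### Initial residuals and the admissible step length. -/

theorem Setting.normE_bbar_le {p : Params} {a b Ks Ky : ℝ} {n m : ℕ} {P : SDP n m}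
    {y0 ys : Fin m → ℝ} {Xs Zs : Mat n} (S : Setting p a b Ks Ky P y0 Xs ys Zs) :
    normE (bbar P p) ≤ (b * (p.ρ + Ks + Ky) + p.ρ + Ks) * n := by
  have hsn := sqrt_natCast_le S.n_pos
  have hρ := p.ρ_pos
  have hKs := S.Ks_pos
  have hKy := S.Ky_pos
  have hb := S.b_pos
  rw [S.bbar_eq]
  have k1 := S.wc.normE_op_le (init p - Xs)
  have k2 := normF_sub_le (init p) Xs
  rw [normF_init] at k2
  have k3 : normF (init p - Xs) ≤ (p.ρ + Ks) * n := by
    have := mul_le_mul_of_nonneg_left hsn (add_pos hρ hKs).le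
    have := S.Xs_le
    linarith
  have k4 := mul_le_mul_of_nonneg_left k3 hb.le
  have k5 : 0 ≤ (b * Ky + p.ρ + Ks) * n := by positivity
  linarith

theorem Setting.normF_Cbar_le {p : Params} {a b Ks Ky : ℝ} {n m : ℕ} {P : SDP n m}
    {y0 ys : Fin m → ℝ} {Xs Zs : Mat n} (S : Setting p a b Ks Ky P y0 Xs ys Zs) :
    normF (Cbar P p y0) ≤ (b * (p.ρ + Ks + Ky) + p.ρ + Ks) * n := by
  have hsn := sqrt_natCast_le S.n_pos
  have hρ := p.ρ_pos
  have hKs := S.Ks_pos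
  have hKy := S.Ky_pos
  have hb := S.b_pos
  rw [S.Cbar_eq]
  have k1 := normF_add_le (P.adj (y0 - ys)) (init p - Zs)
  have k2 := normF_sub_le (init p) Zs
  rw [normF_init] at k2
  have k3 : normF (init p - Zs) ≤ (p.ρ + Ks) * n := by
    have := mul_le_mul_of_nonneg_left hsn (add_pos hρ hKs).le
    have := S.Zs_le
    linarith
  have k4 : normE (y0 - ys) ≤ (Ky + Ks) * n := by
    have := mul_le_mul_of_nonneg_left hsn (add_pos hKy hKs).le
    have := S.y0_le
    have := S.ys_le
    have := normE_sub_le y0 ys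
    linarith
  have k5 := (S.wc.normF_adj_le hb.le (y0 - ys)).trans (mul_le_mul_of_nonneg_left k4 hb.le)
  have k6 : 0 ≤ (b * p.ρ) * n := by positivity
  linarith

theorem eventually_mul_le (c : ℝ) {r : ℝ} (hr : 0 < r) : ∀ᶠ κ in 𝓝[>] (0 : ℝ), κ * c ≤ r := by
  have h : Tendsto (fun κ : ℝ => κ * c) (𝓝[>] 0) (𝓝 (0 * c)) :=
    (Continuous.tendsto (by fun_prop) 0).mono_left nhdsWithin_le_nhds
  rw [zero_mul] at h
  exact (h.eventually_lt_const hr).mono fun κ hκ => hκ.le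

/-- The radius shrinks to first order by `1 - α + α σ`, the quantity to be contained by `1 - α + α
σm / 4`. The margin of at least `(3 / 4) α σm θ R` pays for the second-order terms. Used with `R`
equal to `KN`, `γS * ρ` and `γμ`. -/
theorem neighbourhood_slack {θ α σ σm κ c d R δ : ℝ} (hθ : 0 ≤ θ) (hα : 0 ≤ α) (hR : 0 ≤ R)
    (hσ : σm ≤ σ) (hδ : -(α * κ * d * θ) ≤ δ) (h : κ * (c + d * R) ≤ 3 / 4 * σm * R) :
    (1 - α) * θ * R + α * (σm / 4 * θ * R) + α * κ * θ * c ≤ ((1 - α + α * σ) * θ + δ) * R := by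
  have h1 := mul_le_mul_of_nonneg_left h (mul_nonneg hα hθ)
  have h2 := mul_le_mul_of_nonneg_right hδ hR
  have h3 := mul_le_mul_of_nonneg_left hσ (mul_nonneg (mul_nonneg hα hθ) hR)
  nlinarith

/-- The size of the second-order terms in the residuals. -/
theorem second_order_le {δ δ' α κ μ N d D B β r x₁ x₂ x₃ : ℝ} (hr : 0 < r) (hN : 1 ≤ N)
    (hα : 0 ≤ α) (hμ : 0 ≤ μ) (hB : 0 ≤ B) (hβ : 0 ≤ β) (hD : 0 ≤ D)
    (hαN : α * N ^ 4 ≤ κ) (hδ : |δ| * N ≤ α * κ * d * μ) (hδ' : |δ'| ≤ 2 * α * μ)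
    (h1 : x₁ ≤ β * N) (h2 : x₂ ≤ 2 * B * N) (h3 : x₃ ≤ D * N ^ 2) :
    |δ| / r * x₁ + |δ| * x₂ + α * |δ'| * x₃ ≤
      α * κ * μ * (d * β / r + 2 * B * d + 2 * D) := by
  have k1 : |δ| / r * x₁ ≤ α * κ * μ * (d * β / r) := by
    calc |δ| / r * x₁ ≤ |δ| / r * (β * N) := mul_le_mul_of_nonneg_left h1 (by positivity)
      _ = (|δ| * N) * (β / r) := by ring
      _ ≤ (α * κ * d * μ) * (β / r) := mul_le_mul_of_nonneg_right hδ (by positivity)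
      _ = _ := by ring
  have k2 : |δ| * x₂ ≤ α * κ * μ * (2 * B * d) := by
    calc |δ| * x₂ ≤ |δ| * (2 * B * N) := mul_le_mul_of_nonneg_left h2 (abs_nonneg _)
      _ = (|δ| * N) * (2 * B) := by ring
      _ ≤ (α * κ * d * μ) * (2 * B) := mul_le_mul_of_nonneg_right hδ (by positivity)
      _ = _ := by ring
  have hN4 : α * N ^ 2 ≤ κ :=
    (mul_le_mul_of_nonneg_left (pow_le_pow_right₀ hN (by norm_num)) hα).trans hαN
  have k3 : α * |δ'| * x₃ ≤ α * κ * μ * (2 * D) := by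
    calc α * |δ'| * x₃ ≤ α * |δ'| * (D * N ^ 2) := mul_le_mul_of_nonneg_left h3 (by positivity)
      _ ≤ α * (2 * α * μ) * (D * N ^ 2) := by gcongr
      _ = (α * N ^ 2) * (2 * D * α * μ) := by ring
      _ ≤ κ * (2 * D * α * μ) := mul_le_mul_of_nonneg_right hN4 (by positivity)
      _ = _ := by ring
  linarith

/-- Sufficiently short steps along the Newton direction are acceptable. -/
theorem exists_step_bound (p : Params) {a b Ks Ky B D : ℝ} (ha : 0 < a) (hb : 0 < b) (hKs : 0 < Ks)
    (hKy : 0 < Ky) (hB : 0 < B) (hD : 0 < D) :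
    ∃ κ : ℝ, 0 < κ ∧ κ < 1 ∧ ∀ {n m : ℕ} {P : SDP n m} {y0 y lam bt dy εp : Fin m → ℝ}
      {X Z Ξ Ct dX dZ Ed Xs Zs : Mat n} {ys : Fin m → ℝ} {σ θ α : ℝ},
      Setting p a b Ks Ky P y0 Xs ys Zs → Iterate p B P y0 θ X y Z Ξ lam bt Ct →
      p.σmin ≤ σ → σ ≤ p.σmax → NewtonSystem P p y0 X y Z Ξ lam σ dX dy dZ Ed εp →
      Accurate P p (mu X Z) Ed εp →
      normF (msqrt Z * dX * msqrt Z) ≤ D * (θ * p.ρ ^ 2 * (n : ℝ) ^ 2) →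
      normF ((msqrt Z)⁻¹ * dZ * (msqrt Z)⁻¹) ≤ D * (n : ℝ) ^ 2 →
      normF dX ≤ D * (n : ℝ) ^ 2 → normE dy ≤ D * (n : ℝ) ^ 2 →
      0 < α → α * (n : ℝ) ^ 4 ≤ κ → Acceptable P p y0 X y Z Ξ lam dX dy dZ α := by
  have hρ := p.ρ_pos
  have hKN := p.KN_pos
  have hγS := p.γS_pos
  have hγ0 := p.γμ_pos
  have hγ1 := p.γμ_lt
  have hσm := p.σmin_pos
  obtain ⟨β, hβ⟩ : ∃ β, β = b * (p.ρ + Ks + Ky) + p.ρ + Ks := ⟨_, rfl⟩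
  have hβp : 0 < β := by rw [hβ]; positivity
  obtain ⟨C, hC⟩ : ∃ C, C = D ^ 2 * β / p.ρ ^ 2 + 2 * B * D ^ 2 + 2 * D := ⟨_, rfl⟩
  -- The conditions give, in order: `α < 1`; the decrease of `μ`, with `0.49 = 1 - 1/2 - 0.01` since
  -- `σ ≤ 1/2`; the margins for the norm, the semi-norm and the centrality; positive definiteness;
  -- positivity of the new `μ`.
  obtain ⟨κ, ⟨⟨⟨⟨⟨⟨⟨hκ0, hκ1⟩, c0⟩, c1⟩, c2⟩, c3⟩, c4⟩, c5⟩⟩ :=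
    (((((((eventually_mem_nhdsWithin (a := (0 : ℝ)) (s := Set.Ioi 0)).and
      (eventually_mul_le 2 one_pos)).and
      (eventually_mul_le (D ^ 2) (show (0 : ℝ) < 0.49 by norm_num))).and
      (eventually_mul_le (2 * p.ρ ^ 2 * C + D ^ 2 * p.KN)
        (show 0 < 3 / 4 * p.σmin * p.KN by positivity))).and
      (eventually_mul_le ((a⁻¹ + 1) * p.ρ ^ 2 * C + D ^ 2 * (p.γS * p.ρ))
        (show 0 < 3 / 4 * p.σmin * (p.γS * p.ρ) by positivity))).and
      (eventually_mul_le (2 * D ^ 2 + D ^ 2 * p.γμ)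
        (show 0 < 3 / 4 * p.σmin * p.γμ by positivity))).and
      (eventually_mul_le D (show 0 < (1 - p.γμ) / 2 by linarith))).and
      (eventually_mul_le (D ^ 2) (show 0 < p.σmin / 2 by positivity)) |>.exists
  replace hκ0 : 0 < κ := hκ0
  refine ⟨κ, hκ0, by linarith, ?_⟩
  intro n m P y0 y lam bt dy εp X Z Ξ Ct dX dZ Ed Xs Zs ys σ θ α S I hσ0 hσ1 hN hA d1 d2 d3 d4
    hα hακ
  have hσ1' : σ ≤ 1 / 2 := hσ1.trans p.σmax_le
  have hσp : 0 < σ := hσm.trans_le hσ0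
  have hsc := hN.scaled I.Z_pd I.X_pd.symm'
  have hu := isUnit_det_msqrt I.Z_pd
  have hQQ := msqrt_mul_self I.Z_pd
  have hQs := isSymm_msqrt Z
  have hn1 : (1 : ℝ) ≤ n := by exact_mod_cast S.n_pos
  have hnp : (0 : ℝ) < n := by linarith
  have hθ := I.θ_pos
  have hμp : 0 < θ * p.ρ ^ 2 := by positivity
  have hr : p.ρ ^ 2 ≠ 0 := by positivity
  have hακ' : α ≤ κ := le_trans (le_mul_of_one_le_right hα.le (one_le_pow₀ hn1)) hακ
  have hα1 : α < 1 := by linarith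
  have hμ := mu_newton (α := α) S.n_pos hu hQQ hsc
  have hq : normF (msqrt Z * dX * msqrt Z) * normF ((msqrt Z)⁻¹ * dZ * (msqrt Z)⁻¹) ≤
      D ^ 2 * (n : ℝ) ^ 4 * (θ * p.ρ ^ 2) := by
    refine (mul_le_mul d1 d2 (normF_nonneg _) (by positivity)).trans (le_of_eq (by ring))
  have hcen := normF_central_newton_le (α := α) (γ := p.γμ) S.n_pos hα1.le hQs hu hQQ I.X_pd.symm'
    hN.1 hN.2.1 (by rw [I.mu_eq]; exact I.central) hq hsc
  obtain ⟨pdX, pdZ⟩ := posDef_newton (α := α) (γ := p.γμ) (d := D * (n : ℝ) ^ 2) hα.le hQs hu hQQ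
    I.X_pd.symm' hN.1 hN.2.1 hμp I.central (d1.trans (le_of_eq (by ring))) d2
    (by
      have : α * (n : ℝ) ^ 2 ≤ κ :=
        (mul_le_mul_of_nonneg_left (pow_le_pow_right₀ hn1 (by norm_num)) hα.le).trans hακ
      have := mul_le_mul_of_nonneg_right this hD.le
      linarith) hγ0.le
  have hip : |ip dX dZ| ≤ D ^ 2 * (n : ℝ) ^ 4 * (θ * p.ρ ^ 2) := by
    rw [← ip_conj_inv hu]; exact (abs_ip_le _ _).trans hq
  rw [I.mu_eq] at hμ hcen
  -- One factor `α n⁴` of the second-order term is traded for `κ`; this fixes the exponent `4`.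
  have hsq : α ^ 2 * (D ^ 2 * (n : ℝ) ^ 4 * (θ * p.ρ ^ 2)) ≤ α * κ * D ^ 2 * (θ * p.ρ ^ 2) := by
    have := mul_le_mul_of_nonneg_left hακ (show 0 ≤ α * D ^ 2 * (θ * p.ρ ^ 2) by positivity)
    linarith
  obtain ⟨δ, hδ⟩ : ∃ δ, δ = α ^ 2 * (ip dX dZ / n) := ⟨_, rfl⟩
  rw [← hδ] at hμ
  -- The division by `n` in the definition of `μ` offsets the `O(n)` size of `b̄`, `C̄` and the
  -- proximal differences, which `δ` multiplies.
  have hδN : |δ| * n ≤ α * κ * D ^ 2 * (θ * p.ρ ^ 2) := by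
    have e : |δ| * n = α ^ 2 * |ip dX dZ| := by
      rw [hδ, abs_mul, abs_div, abs_of_nonneg (sq_nonneg α), abs_of_pos hnp]; field_simp
    rw [e]
    exact (mul_le_mul_of_nonneg_left hip (sq_nonneg α)).trans hsq
  have hδ1 : |δ| ≤ α * κ * D ^ 2 * (θ * p.ρ ^ 2) :=
    (le_mul_of_one_le_right (abs_nonneg δ) hn1).trans hδN
  obtain ⟨hδl, hδu⟩ := abs_le.1 hδ1
  obtain ⟨μ', hμ'⟩ : ∃ μ', μ' = mu (X + α • dX) (Z + α • dZ) := ⟨_, rfl⟩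
  rw [← hμ'] at hμ hcen
  have hαμ : 0 < α * (θ * p.ρ ^ 2) := by positivity
  have s1 := mul_le_mul_of_nonneg_left c0 hαμ.le
  have s2 := mul_le_mul_of_nonneg_left c5 hαμ.le
  have s3 := mul_le_mul_of_nonneg_left hσ1' hαμ.le
  have s4 := mul_le_mul_of_nonneg_left hσ0 hαμ.le
  have hμ'p : 0 < μ' := by
    have : 0 < (1 - α) * (θ * p.ρ ^ 2) := mul_pos (by linarith) hμp
    have : 0 < α * (θ * p.ρ ^ 2) * (p.σmin / 2) := by positivity
    rw [hμ]; linarith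
  obtain ⟨θ', hθ'⟩ : ∃ θ', θ' = μ' / p.ρ ^ 2 := ⟨_, rfl⟩
  have hθ'p : 0 < θ' := by rw [hθ']; positivity
  have hμθ : μ' = θ' * p.ρ ^ 2 := by rw [hθ']; field_simp
  have hθ'e : θ' = (1 - α + α * σ) * θ + δ / p.ρ ^ 2 := by
    rw [hθ', hμ]; field_simp
  have hδr : -(α * κ * D ^ 2 * θ) ≤ δ / p.ρ ^ 2 := by
    rw [le_div_iff₀ (by positivity)]; linarith
  have hdiff : |μ' - θ * p.ρ ^ 2| ≤ 2 * α * (θ * p.ρ ^ 2) := by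
    have : 0 ≤ α * (θ * p.ρ ^ 2) * σ := by positivity
    rw [abs_le, hμ]
    constructor <;> linarith
  have hpr := I.primal
  have hdr := I.dual
  obtain ⟨hdX, -, hN1, hN2, -⟩ := hN
  rw [mu0_eq S.n_pos, I.mu_eq] at hN1 hN2
  have R1 := primal_residual_newton hr hθ'p.ne' hpr hN2 hμ hμθ
  have R2 := dual_residual_newton hr hθ'p.ne' hdr hN1 hμ hμθ
  obtain ⟨e₁, he₁⟩ : ∃ e, e = -(δ / p.ρ ^ 2) • bbar P p + δ • (y - lam) +
    (α * (μ' - θ * p.ρ ^ 2)) • dy := ⟨_, rfl⟩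
  obtain ⟨e₂, he₂⟩ : ∃ e, e = -(δ / p.ρ ^ 2) • Cbar P p y0 - δ • (X - Ξ) -
    (α * (μ' - θ * p.ρ ^ 2)) • dX := ⟨_, rfl⟩
  rw [← he₁] at R1
  rw [← he₂] at R2
  have ne₁ : normE e₁ ≤ α * κ * (θ * p.ρ ^ 2) * C := by
    rw [hC]
    refine le_trans ?_ (second_order_le (x₁ := normE (bbar P p)) (x₂ := normE (y - lam))
      (x₃ := normE dy) (pow_pos hρ 2) hn1 hα.le hμp.le hB.le hβp.le hD.le hακ hδN hdiff
      (by rw [hβ]; exact S.normE_bbar_le) ?_ d4)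
    · rw [he₁]
      refine (normE_add_le _ _).trans (add_le_add ((normE_add_le _ _).trans (add_le_add ?_ ?_)) ?_)
      · rw [normE_smul, abs_neg, abs_div, abs_of_nonneg (sq_nonneg p.ρ)]
      · rw [normE_smul]
      · rw [normE_smul, abs_mul, abs_of_pos hα]
    · have := normE_sub_le y lam
      have := I.y_le
      have := I.lam_le
      linarith
  have ne₂ : normF e₂ ≤ α * κ * (θ * p.ρ ^ 2) * C := by
    rw [hC]
    refine le_trans ?_ (second_order_le (x₁ := normF (Cbar P p y0)) (x₂ := normF (X - Ξ))
      (x₃ := normF dX) (pow_pos hρ 2) hn1 hα.le hμp.le hB.le hβp.le hD.le hακ hδN hdiff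
      (by rw [hβ]; exact S.normF_Cbar_le) ?_ d3)
    · rw [he₂]
      refine (normF_sub_le _ _).trans (add_le_add ((normF_sub_le _ _).trans (add_le_add ?_ ?_)) ?_)
      · rw [normF_smul, abs_neg, abs_div, abs_of_nonneg (sq_nonneg p.ρ)]
      · rw [normF_smul]
      · rw [normF_smul, abs_mul, abs_of_pos hα]
    · have := normF_sub_le X Ξ
      have := I.X_le
      have := I.Ξ_le
      linarith
  obtain ⟨A1, A2⟩ := hA
  rw [mu0_eq S.n_pos, I.mu_eq] at A1 A2
  have hq4 : p.σmin / (4 * p.ρ ^ 2) * (θ * p.ρ ^ 2) = p.σmin / 4 * θ := by field_simp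
  have A1' : normPair εp Ed ≤ p.σmin / 4 * θ * p.KN := A1.trans (le_of_eq (by rw [← hq4]; ring))
  have A2' : P.semiNorm εp Ed ≤ p.σmin / 4 * θ * (p.γS * p.ρ) :=
    A2.trans (le_of_eq (by rw [← hq4]; ring))
  have h1α : 0 < (1 - α) * θ := mul_pos (by linarith) hθ
  refine ⟨hα, hα1.le, ?_, ⟨?_, pdX, pdZ, ?_⟩⟩
  · rw [← hμ', hμ, I.mu_eq]
    linarith
  · rw [← hμ', mu0_eq S.n_pos]
    refine ⟨_, _, R1, R2, ?_, ?_⟩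
    · rw [normPair_smul, abs_of_pos (inv_pos.2 hθ'p), inv_mul_le_iff₀ hθ'p]
      refine (normPair_add_le _ _ _ _).trans ?_
      have k1 := normPair_add_le (((1 - α) * θ) • bt) (α • εp) (((1 - α) * θ) • Ct) (α • Ed)
      rw [normPair_smul, normPair_smul, abs_of_pos h1α, abs_of_pos hα] at k1
      have k2 := mul_le_mul_of_nonneg_left I.pair_le h1α.le
      have k3 := mul_le_mul_of_nonneg_left A1' hα.le
      have k4 := (normPair_le_add e₁ e₂).trans (add_le_add ne₁ ne₂)
      have k5 := neighbourhood_slack (c := 2 * p.ρ ^ 2 * C) hθ.le hα.le hKN.le hσ0 hδr c1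
      rw [← hθ'e] at k5
      linarith
    · refine (S.wc.semiNorm_smul_le (inv_pos.2 hθ'p) _ _).trans ?_
      rw [inv_mul_le_iff₀ hθ'p]
      refine (S.wc.semiNorm_add_le _ _ _ _).trans ?_
      have k1 := S.wc.semiNorm_add_le (((1 - α) * θ) • bt) (α • εp) (((1 - α) * θ) • Ct) (α • Ed)
      have l1 := S.wc.semiNorm_smul_le h1α bt Ct
      have l2 := S.wc.semiNorm_smul_le hα εp Ed
      have k2 := mul_le_mul_of_nonneg_left I.semi_le h1α.le
      have k3 := mul_le_mul_of_nonneg_left A2' hα.le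
      have k4 := S.wc.semiNorm_le e₁ e₂
      have k4' := mul_le_mul_of_nonneg_left ne₁ (inv_pos.2 ha).le
      have k5 := neighbourhood_slack (c := (a⁻¹ + 1) * p.ρ ^ 2 * C) hθ.le hα.le
        (mul_pos hγS hρ).le hσ0 hδr c2
      rw [← hθ'e] at k5
      linarith
  -- The neighbourhood scales by the square root of the new `Z`; minimality of that scaling
  -- transfers the estimate made with the old one.
  · refine (normF_central_le (I.X_pd.symm'.add (hdX.smul α)) pdZ hu _).trans ?_
    rw [← hμ']
    refine hcen.trans ?_
    have k5 := neighbourhood_slack (c := 2 * D ^ 2) hμp.le hα.le hγ0.le hσ0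
      (d := D ^ 2) (δ := δ) (κ := κ) (by linarith) c3
    rw [← hμ] at k5
    have : 0 ≤ α * (p.σmin / 4 * (θ * p.ρ ^ 2) * p.γμ) := by positivity
    linarith

/-! ### Linear convergence of contracting sequences. -/

section LinearConvergence

variable {u : ℕ → ℝ} {q : ℝ}

theorem le_pow_mul_of_contracting (hq : 0 ≤ q) (h : ∀ k, u (k + 1) ≤ q * u k) (k : ℕ) :
    u k ≤ q ^ k * u 0 := by
  induction k with
  | zero => simp
  | succ k ih =>
    calc u (k + 1) ≤ q * u k := h k
      _ ≤ q * (q ^ k * u 0) := mul_le_mul_of_nonneg_left ih hq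
      _ = _ := by ring

theorem qLinear_of_contracting (h0 : ∀ k, 0 ≤ u k) (hq : 0 < q) (hq1 : q < 1)
    (h : ∀ k, u (k + 1) ≤ q * u k) : QLinear u 0 := by
  refine ⟨?_, q, hq, hq1, Eventually.of_forall fun k => ?_⟩
  · have h1 : Tendsto (fun k : ℕ => q ^ k * u 0) atTop (𝓝 (0 * u 0)) :=
      (tendsto_pow_atTop_nhds_zero_of_lt_one hq.le hq1).mul_const _
    rw [zero_mul] at h1
    exact squeeze_zero h0 (le_pow_mul_of_contracting hq.le h) h1
  · rw [sub_zero, sub_zero, abs_of_nonneg (h0 _), abs_of_nonneg (h0 _)]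
    exact h k

theorem rLinear_of_le_mul {v : ℕ → ℝ} {c : ℝ} (hc : 0 ≤ c) (h0 : ∀ k, 0 ≤ u k) (hq : 0 < q)
    (hq1 : q < 1) (h : ∀ k, u (k + 1) ≤ q * u k) (hv0 : ∀ k, 0 ≤ v k) (hv : ∀ k, v k ≤ c * u k) :
    RLinear v 0 := by
  refine ⟨fun k => c * u k, fun k => ⟨mul_nonneg hc (h0 k), ?_⟩,
    qLinear_of_contracting (fun k => mul_nonneg hc (h0 k)) hq hq1 fun k => ?_⟩
  · rw [sub_zero, abs_of_nonneg (hv0 k)]; exact hv k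
  · have := mul_le_mul_of_nonneg_left (h k) hc
    linarith

end LinearConvergence

/-! ### Preservation of the neighbourhood and of the bounds. -/

section Iterates

variable {n m : ℕ} {P : SDP n m} {p : Params} {y0 y lam : Fin m → ℝ} {X Z Ξ : Mat n} {μ : ℝ}

theorem mu_pos (hn : 0 < n) (hX : X.PosDef) (hZ : Z.PosDef) : 0 < mu X Z := by
  have : Nonempty (Fin n) := ⟨⟨0, hn⟩⟩
  have h := (posDef_conj (isSymm_msqrt Z) (isUnit_det_msqrt hZ) hX).trace_pos
  rw [Matrix.mul_assoc, trace_mul_comm, Matrix.mul_assoc, msqrt_mul_self hZ] at h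
  exact div_pos h (by exact_mod_cast hn)

theorem nbhd_init (hn : 0 < n) (P : SDP n m) (p : Params) (y0 : Fin m → ℝ) {a b : ℝ}
    (h : P.WellConditioned a b) :
    Nbhd P p y0 (mu (init p : Mat n) (init p)) (init p) y0 (init p) y0 (init p) := by
  have hpd : (init p : Mat n).PosDef := PosDef.one.smul p.ρ_pos
  have hμ : mu (init p : Mat n) (init p) = p.ρ ^ 2 := mu0_eq hn p
  have hr : p.ρ ^ 2 ≠ 0 := pow_ne_zero 2 p.ρ_pos.ne'
  refine ⟨⟨0, 0, ?_, ?_, ?_, ?_⟩, hpd, hpd, ?_⟩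
  · rw [mu0_eq hn, hμ, div_self hr, bbar]; module
  · rw [mu0_eq hn, hμ, div_self hr, Cbar]; module
  · rw [normPair]; simp only [vec_zero, dotProduct_zero, add_zero, Real.sqrt_zero]
    exact p.KN_pos.le
  · refine (h.semiNorm_le 0 0).trans ?_
    rw [normE, normF]
    simp only [vec_zero, dotProduct_zero, Real.sqrt_zero, mul_zero, add_zero]
    exact (mul_pos p.γS_pos p.ρ_pos).le
  · rw [symmetrize_msqrt hpd.symm' hpd]
    have e : msqrt (init p : Mat n) * init p * msqrt (init p) = p.ρ ^ 2 • (1 : Mat n) := by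
      rw [init, Matrix.mul_smul, Matrix.smul_mul, Matrix.mul_one]
      have := msqrt_mul_self hpd
      rw [init] at this
      rw [this, smul_smul, pow_two]
    rw [e, hμ, sub_self, normF]
    simp only [vec_zero, dotProduct_zero, Real.sqrt_zero]
    exact (mul_pos p.γμ_pos (pow_pos p.ρ_pos 2)).le

/-- Passing the update test means being in the neighbourhood of the updated proximal estimates. -/
theorem Nbhd.of_updateTest {a b : ℝ} (hn : 0 < n) (hw : P.WellConditioned a b)
    (h : Nbhd P p y0 (mu X Z) Ξ lam X y Z) (ht : UpdateTest P p y0 X y Z) :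
    Nbhd P p y0 (mu X Z) X y X y Z := by
  obtain ⟨-, hX, hZ, hc⟩ := h
  obtain ⟨t1, t2⟩ := ht
  have hθ : 0 < mu X Z / mu0 n p := by
    rw [mu0_eq hn]; exact div_pos (mu_pos hn hX hZ) (pow_pos p.ρ_pos 2)
  obtain ⟨θ, hθe⟩ : ∃ θ, θ = mu X Z / mu0 n p := ⟨_, rfl⟩
  rw [← hθe] at t1 t2 hθ
  rw [Nbhd, ← hθe]
  refine ⟨⟨θ⁻¹ • (P.op X - (P.b + θ • bbar P p)),
    θ⁻¹ • -((P.C + θ • Cbar P p y0) - P.adj y - Z), ?_, ?_, ?_, ?_⟩, hX, hZ, hc⟩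
  · rw [smul_add θ, smul_smul θ, mul_inv_cancel₀ hθ.ne']; module
  · rw [smul_add θ, smul_smul θ, mul_inv_cancel₀ hθ.ne']; module
  · rw [normPair_smul, abs_of_pos (inv_pos.2 hθ), normPair_neg_right, inv_mul_le_iff₀ hθ, mul_comm]
    exact t1
  · refine (hw.semiNorm_smul_le (inv_pos.2 hθ) _ _).trans ?_
    rw [inv_mul_le_iff₀ hθ, mul_comm]
    exact (hw.semiNorm_neg_right_le _ _).trans t2

/-- The neighbourhood does not ask for a symmetric `Ct`; symmetry follows from the dual equation. -/
theorem isSymm_dualResidual (hn : 0 < n) {Ct : Mat n} (hX : X.PosDef)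
    (hZ : Z.PosDef) (hΞ : Ξ.IsSymm)
    (h : P.adj y + Z - μ • (X - Ξ) = P.C + (mu X Z / mu0 n p) • (Cbar P p y0 + Ct)) :
    Ct.IsSymm := by
  have hθ : 0 < mu X Z / mu0 n p := by
    rw [mu0_eq hn]; exact div_pos (mu_pos hn hX hZ) (pow_pos p.ρ_pos 2)
  have e : Ct = (mu X Z / mu0 n p)⁻¹ • (P.adj y + Z - μ • (X - Ξ) - P.C) - Cbar P p y0 := by
    rw [h, add_sub_cancel_left, smul_smul, inv_mul_cancel₀ hθ.ne', one_smul, add_sub_cancel_left]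
  rw [e]
  exact (((((P.adj_isSymm y).add hZ.symm').sub ((hX.symm'.sub hΞ).smul _)).sub
    P.C_symm).smul _).sub (isSymm_Cbar P p y0)

end Iterates

/-- The properties of the iterates that are preserved by the method. -/
structure Invariant (p : Params) (L : ℝ) {n m : ℕ} (P : SDP n m) (y0 : Fin m → ℝ)
    (X : Mat n) (y : Fin m → ℝ) (Z : Mat n) (Ξ : Mat n) (lam : Fin m → ℝ) : Prop where
  nbhd : Nbhd P p y0 (mu X Z) Ξ lam X y Z
  Ξ_symm : Ξ.IsSymm
  Ξ_le : normF Ξ ≤ L * n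
  lam_le : normE lam ≤ L * n
  mu_le : mu X Z ≤ p.ρ ^ 2

theorem exists_iterate_bound (p : Params) {a b Ks Ky L : ℝ} (ha : 0 < a) (hb : 0 < b)
    (hKs : 0 < Ks) (hKy : 0 < Ky) (hL : 0 < L) :
    ∃ B > 0, ∀ {n m : ℕ} {P : SDP n m} {y0 y lam ys : Fin m → ℝ} {X Z Ξ Xs Zs : Mat n},
      Setting p a b Ks Ky P y0 Xs ys Zs → Invariant p L P y0 X y Z Ξ lam →
      ∃ θ bt Ct, Iterate p B P y0 θ X y Z Ξ lam bt Ct := by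
  obtain ⟨B, hB, h⟩ := exists_bound_of_proximal p ha hb hKs hKy hL
  have hρ := p.ρ_pos
  refine ⟨B + L, by positivity, ?_⟩
  intro n m P y0 y lam ys X Z Ξ Xs Zs S I
  obtain ⟨⟨bt, Ct, e1, e2, n1, n2⟩, hX, hZ, hc⟩ := I.nbhd
  have hCt := isSymm_dualResidual S.n_pos hX hZ I.Ξ_symm e2
  have hμ := mu_pos S.n_pos hX hZ
  have hnp : (0 : ℝ) < n := by exact_mod_cast S.n_pos
  obtain ⟨θ, hθ⟩ : ∃ θ, θ = mu X Z / p.ρ ^ 2 := ⟨_, rfl⟩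
  have hμθ : mu X Z = θ * p.ρ ^ 2 := by rw [hθ]; field_simp
  have hθ0 : 0 < θ := by rw [hθ]; positivity
  have hθ1 : θ ≤ 1 := by rw [hθ, div_le_one (by positivity)]; exact I.mu_le
  have hip : ip X Z = n * (θ * p.ρ ^ 2) := by
    rw [← hμθ, mu]; field_simp
  rw [mu0_eq S.n_pos, ← hθ, hμθ] at e1 e2
  rw [symmetrize_msqrt hX.symm' hZ, hμθ] at hc
  obtain ⟨b1, b2, b3⟩ := h S hθ0 hθ1 n1 n2 hX.posSemidef hZ.posSemidef hCt hip e1 e2 I.Ξ_le I.lam_le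
  have hBn : 0 ≤ B * n := by positivity
  have hLn : 0 ≤ L * n := by positivity
  have k1 := I.Ξ_le
  have k2 := I.lam_le
  exact ⟨θ, bt, Ct, hθ0, hθ1, hμθ, hX, hZ, I.Ξ_symm, e1, e2, n1, n2, hc, by linarith, by linarith,
    by linarith, by linarith, by linarith⟩

/-- Although proved by induction, the bound does not grow: after an update the new proximal
estimates are bounded afresh by `exists_bound_of_feasible`, without reference to the old ones. -/
theorem exists_invariant_bound (p : Params) {a Ks Ky : ℝ} (ha : 0 < a) (hKs : 0 < Ks)
    (hKy : 0 < Ky) :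
    ∃ L > 0, ∀ {b : ℝ} {n m : ℕ} {P : SDP n m} (R : Run P p) {ys : Fin m → ℝ} {Xs Zs : Mat n},
      Setting p a b Ks Ky P (R.y 0) Xs ys Zs →
      ∀ k, Invariant p L P (R.y 0) (R.X k) (R.y k) (R.Z k) (R.Ξ k) (R.lam k) := by
  obtain ⟨L, hL, h⟩ := exists_bound_of_feasible p ha hKs hKy
  have hρ := p.ρ_pos
  refine ⟨L + (p.ρ + Ky), by positivity, ?_⟩
  intro b n m P R ys Xs Zs S k
  have hsn := sqrt_natCast_le S.n_pos
  have hnp : (0 : ℝ) < n := by exact_mod_cast S.n_pos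
  have hLn : 0 ≤ L * n := by positivity
  have hρn : 0 ≤ (p.ρ + Ky) * n := by positivity
  have hKyn : 0 ≤ Ky * n := by positivity
  have hρn' : 0 ≤ p.ρ * n := by positivity
  induction k with
  | zero =>
    rw [R.Ξ_zero, R.lam_zero, R.X_zero, R.Z_zero]
    refine ⟨nbhd_init S.n_pos P p _ S.wc, isSymm_init p, ?_, ?_, (mu0_eq S.n_pos p).le⟩
    · rw [normF_init]
      have := mul_le_mul_of_nonneg_left hsn hρ.le
      linarith
    · have := mul_le_mul_of_nonneg_left hsn hKy.le
      have := S.y0_le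
      linarith
  | succ k ih =>
    obtain ⟨hα0, -, hdec, hnb⟩ := (R.step k).1
    rw [← R.X_succ, ← R.Z_succ, ← R.y_succ] at hnb
    rw [← R.X_succ, ← R.Z_succ] at hdec
    have hX := hnb.2.1
    have hZ := hnb.2.2.1
    have hμk := mu_pos S.n_pos ih.nbhd.2.1 ih.nbhd.2.2.1
    have hμ1 := mu_pos S.n_pos hX hZ
    have hμle : mu (R.X (k + 1)) (R.Z (k + 1)) ≤ p.ρ ^ 2 := by
      have : 0 ≤ 0.01 * R.α k * mu (R.X k) (R.Z k) := by positivity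
      have := ih.mu_le
      linarith
    by_cases ht : UpdateTest P p (R.y 0) (R.X (k + 1)) (R.y (k + 1)) (R.Z (k + 1))
    · obtain ⟨u1, u2⟩ := R.update k ht
      have hnb' := hnb.of_updateTest S.n_pos S.wc ht
      rw [u1, u2]
      obtain ⟨⟨bt, Ct, e1, e2, n1, n2⟩, -, -, -⟩ := id hnb'
      have hCt := isSymm_dualResidual S.n_pos hX hZ hX.symm' e2
      -- With `Ξ = X` and `lam = y` the proximal terms vanish, which is the setting of the feasible
      -- bound.
      rw [sub_self, smul_zero, mu0_eq S.n_pos] at e1 e2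
      rw [add_zero] at e1
      rw [sub_zero] at e2
      obtain ⟨b1, b2⟩ := h S (div_pos hμ1 (pow_pos hρ 2))
        ((div_le_one (pow_pos hρ 2)).2 hμle) n1 n2 hX.posSemidef hZ.posSemidef hCt
        (by rw [mu]; field_simp) e1 e2
      exact ⟨hnb', hX.symm', by linarith, by linarith, hμle⟩
    · obtain ⟨u1, u2⟩ := R.no_update k ht
      rw [u1, u2]
      exact ⟨hnb, ih.Ξ_symm, ih.Ξ_le, ih.lam_le, hμle⟩

/-! ### Residual norms in terms of `μ`. -/

section ResidualNorms

variable {p : Params} {B : ℝ} {n m : ℕ} {P : SDP n m} {y0 y lam bt : Fin m → ℝ} {θ : ℝ}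
  {X Z Ξ Ct : Mat n}

theorem Iterate.normE_primalRes_le (I : Iterate p B P y0 θ X y Z Ξ lam bt Ct) (hn : 0 < n) :
    normE (primalRes P p (mu X Z) lam X y) ≤ p.KN / p.ρ ^ 2 * mu X Z := by
  have hρ := p.ρ_pos
  have hr : p.ρ ^ 2 ≠ 0 := pow_ne_zero 2 hρ.ne'
  have e : primalRes P p (mu X Z) lam X y = θ • bt := by
    rw [primalRes, mu0_eq hn, I.mu_eq, I.primal, mul_div_assoc, div_self hr]; module
  rw [e, normE_smul, abs_of_pos I.θ_pos, I.mu_eq,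
    show p.KN / p.ρ ^ 2 * (θ * p.ρ ^ 2) = θ * p.KN by field_simp]
  exact mul_le_mul_of_nonneg_left ((normE_le_normPair bt Ct).trans I.pair_le) I.θ_pos.le

theorem Iterate.normF_dualRes_le (I : Iterate p B P y0 θ X y Z Ξ lam bt Ct) (hn : 0 < n) :
    normF (dualRes P p y0 (mu X Z) Ξ X y Z) ≤ p.KN / p.ρ ^ 2 * mu X Z := by
  have hρ := p.ρ_pos
  have hr : p.ρ ^ 2 ≠ 0 := pow_ne_zero 2 hρ.ne'
  have e : dualRes P p y0 (mu X Z) Ξ X y Z = θ • Ct := by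
    rw [dualRes, mu0_eq hn, I.mu_eq, I.dual, mul_div_assoc, div_self hr]; module
  rw [e, normF_smul, abs_of_pos I.θ_pos, I.mu_eq,
    show p.KN / p.ρ ^ 2 * (θ * p.ρ ^ 2) = θ * p.KN by field_simp]
  exact mul_le_mul_of_nonneg_left ((normF_le_normPair bt Ct).trans I.pair_le) I.θ_pos.le

end ResidualNorms

end IPPMM

end

/-! ### The main theorem. -/

theorem theorem4p1 (p : Params) (Ks KA1 KA2 Kr1 Kr2 Ky : ℝ)
    (hKs : 0 < Ks) (hKA1 : 0 < KA1) (hKA2 : 0 < KA2) (hKr1 : 0 < Kr1) (hKr2 : 0 < Kr2)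
    (hKy : 0 < Ky) :
    ∃ κ : ℝ, 0 < κ ∧
      ∀ (n m : ℕ) (P : SDP n m), 0 < n → P.Assumption1 Ks → P.Assumption2 KA1 KA2 Kr1 Kr2 →
        ∃ αbar : ℝ, 0 < αbar ∧ αbar < 1 ∧ κ / (n : ℝ) ^ 4 ≤ αbar ∧
          ∀ R : Run P p, normE (R.y 0) ≤ Ky * √n →
            (∀ k, (∀ a : ℝ, 0 < a → a ≤ αbar →
                Acceptable P p (R.y 0) (R.X k) (R.y k) (R.Z k) (R.Ξ k) (R.lam k)
                  (R.dX k) (R.dy k) (R.dZ k) a) ∧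
              αbar ≤ R.α k ∧
              R.μ (k + 1) ≤ (1 - 0.01 * αbar) * R.μ k ∧
              R.primalResNorm k ≤ p.KN * (1 - 0.01 * αbar) ^ k ∧
              R.dualResNorm k ≤ p.KN * (1 - 0.01 * αbar) ^ k) ∧
            QLinear R.μ 0 ∧ RLinear R.primalResNorm 0 ∧ RLinear R.dualResNorm 0 := by
  obtain ⟨L, hL, hinv⟩ := exists_invariant_bound p hKA1 hKs hKy
  obtain ⟨B, hB, hiter⟩ := exists_iterate_bound p hKA1 hKA2 hKs hKy hL
  obtain ⟨D, hD, hdir⟩ := exists_direction_bound p hKA1 hKs hKy hB (b := KA2)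
  obtain ⟨κ, hκ, hκ1, hstep⟩ := exists_step_bound p hKA1 hKA2 hKs hKy hB hD
  refine ⟨κ, hκ, fun n m P hn h1 h2 => ?_⟩
  have hn1 : (1 : ℝ) ≤ n := by exact_mod_cast hn
  have hn4 : 1 ≤ (n : ℝ) ^ 4 := one_le_pow₀ hn1
  have hα1 : κ / (n : ℝ) ^ 4 < 1 := by
    rw [div_lt_one (by positivity)]; linarith
  refine ⟨κ / (n : ℝ) ^ 4, by positivity, hα1, le_rfl, fun R hy => ?_⟩
  obtain ⟨Xs, ys, Zs, S⟩ := exists_setting (p := p) hKs hKA1 hKA2 hKy hn h1 h2 hy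
  have hI := hinv R S
  have hacc : ∀ k, ∀ a : ℝ, 0 < a → a ≤ κ / (n : ℝ) ^ 4 →
      Acceptable P p (R.y 0) (R.X k) (R.y k) (R.Z k) (R.Ξ k) (R.lam k)
        (R.dX k) (R.dy k) (R.dZ k) a := by
    intro k a ha hle
    obtain ⟨θ, bt, Ct, I⟩ := hiter S (hI k)
    have hσ := R.σ_mem k
    have := p.σmax_le
    obtain ⟨d1, d2, d3, d4⟩ := hdir S I (p.σmin_pos.trans_le hσ.1) (by linarith) (R.newton k)
      (R.accurate k)
    refine hstep S I hσ.1 hσ.2 (R.newton k) (R.accurate k) d1 d2 d3 d4 ha ?_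
    rwa [le_div_iff₀ (by positivity)] at hle
  obtain ⟨q, hq⟩ : ∃ q, q = 1 - 0.01 * (κ / (n : ℝ) ^ 4) := ⟨_, rfl⟩
  have hα0 : 0 < κ / (n : ℝ) ^ 4 := by positivity
  have hq0 : 0 < q := by rw [hq]; linarith
  have hq1 : q < 1 := by rw [hq]; linarith
  -- The chosen step is the greatest acceptable one, and `κ / n⁴` is acceptable.
  have hαk : ∀ k, κ / (n : ℝ) ^ 4 ≤ R.α k := fun k => (R.step k).2 (hacc k _ hα0 le_rfl)
  have hμ0 : ∀ k, 0 ≤ R.μ k := fun k => (mu_pos hn (hI k).nbhd.2.1 (hI k).nbhd.2.2.1).le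
  have hdec : ∀ k, R.μ (k + 1) ≤ q * R.μ k := by
    intro k
    have h3 := (R.step k).1.2.2.1
    rw [← R.X_succ, ← R.Z_succ] at h3
    refine h3.trans (mul_le_mul_of_nonneg_right ?_ (hμ0 k))
    rw [hq]
    have := hαk k
    linarith
  have hprim : ∀ k, R.primalResNorm k ≤ p.KN / p.ρ ^ 2 * R.μ k := by
    intro k
    obtain ⟨θ, bt, Ct, I⟩ := hiter S (hI k)
    exact I.normE_primalRes_le hn
  have hdual : ∀ k, R.dualResNorm k ≤ p.KN / p.ρ ^ 2 * R.μ k := by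
    intro k
    obtain ⟨θ, bt, Ct, I⟩ := hiter S (hI k)
    exact I.normF_dualRes_le hn
  have hρ := p.ρ_pos
  have hc : 0 < p.KN / p.ρ ^ 2 := div_pos p.KN_pos (pow_pos hρ 2)
  have hgeo : ∀ k, p.KN / p.ρ ^ 2 * R.μ k ≤ p.KN * q ^ k := by
    intro k
    have h3 := mul_le_mul_of_nonneg_left (le_pow_mul_of_contracting hq0.le hdec k) hc.le
    -- The starting value cancels the denominator of `KN / ρ²`, leaving exactly the constant `KN`.
    have h4 : R.μ 0 = p.ρ ^ 2 := by
      rw [Run.μ, R.X_zero, R.Z_zero]; exact mu0_eq hn p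
    rw [h4] at h3
    refine h3.trans (le_of_eq ?_)
    field_simp
  refine ⟨fun k => ⟨hacc k, hαk k, ?_, ?_, ?_⟩, qLinear_of_contracting hμ0 hq0 hq1 hdec,
    rLinear_of_le_mul hc.le hμ0 hq0 hq1 hdec (fun k => normE_nonneg _) hprim,
    rLinear_of_le_mul hc.le hμ0 hq0 hq1 hdec (fun k => normF_nonneg _) hdual⟩
  · rw [← hq]; exact hdec k
  · rw [← hq]; exact (hprim k).trans (hgeo k)
  · rw [← hq]; exact (hdual k).trans (hgeo k)
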